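/- Let $d\ge 1$ be an integer, $\beta\ge 0$ and $h\in\mathbb R$, and put $\beta_c=\frac1{2d}$. For even $n\ge 2$ let $$O_{d,\beta,h}=\sum_{\substack{\sigma\in\{-1,1\}^n\\ \sum_{i=1}^{n/2}\sigma_i=\sum_{i=n/2+1}^{n}\sigma_i}}\exp\Big\{\frac{d\beta}{n}\Big(\sum_{j=1}^n\sigma_j\Big)^2+h\sum_{j=1}^n\sigma_j\Big\}.$$ For $h\neq 0$, and for $h=0$ with $\beta>\beta_c$, the mean-field equation $\tanh(\frac{\beta}{\beta_c}z+|h|)=z$ has a maximal solution $z_*$; put $t_*=2d\beta z_*+|h|$. For $h=0$, $\beta<\beta_c$ put $t_*=0$. Let $$\varphi(t)=\ln\cosh t-\frac{(t-|h|)^2}{4d\beta},\qquad \psi(t,u)=\frac12\Big(\ln\big(\tfrac12\cosh 2t+\tfrac12\cos u\big)-\frac{(t-|h|)^2}{2d\beta}\Big),$$ and let $\alpha_{p,q}=\frac1{p!\,q!}\partial_t^p\partial_u^q\psi(t_*,0)$ be the coefficients of the Taylor expansion of $\psi$ at $(t_*,0)$. For $p\ge 1$ define $$\gamma_p=\frac{1}{(2\pi)^{3/2}}\sum_{k=1}^{2p}\frac1{k!}\sum\Big(\prod_{j=1}^k\alpha_{p_j,q_j}\Big)(2d\beta)^{-\frac12}(-\alpha_{2,0})^{-\frac{P+1}{2}}(-\alpha_{0,2})^{-\frac{Q+1}{2}}\,\Gamma\Big(\frac{P+1}{2}\Big)\Gamma\Big(\frac{Q+1}{2}\Big),$$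 where the inner sum runs over all $(p_i,q_i)_{1\le i\le k}$ of pairs of non-negative integers with $p_i+q_i\ge 3$, $\sum_i(p_i+q_i)=2(k+p)$, and both $P=\sum_i p_i$ and $Q=\sum_i q_i$ even. When $\beta=0$, expressions containing $1/\beta$ are read as their limits as $\beta\downarrow0$: $(2d\beta)^{-1/2}(-\alpha_{2,0})^{-(P+1)/2}$ is $\sqrt2$ if $P=0$ and $0$ if $P>0$; $\varphi(t_*)=\ln\cosh h$; $\gamma_0^{h\ne0}=\sqrt{2/\pi}\cosh t_*$. Then, for every integer $M\ge 0$, as $n\to\infty$ through the even numbers: (1) If $h=0$ and $\beta<\beta_c$, then $O_{d,\beta,h}=2^n\big(\sum_{p=0}^M\gamma_p^{<}n^{-p-\frac12}+o(n^{-M-\frac12})\big)$, where $\gamma_0^{<}=\sqrt{\frac2\pi}(1-2d\beta)^{-\frac12}$ and $\gamma_p^{<}=\gamma_p$ for $p\ge 1$. (2) If $h=0$ and $\beta=\beta_c$, then $O_{d,\beta,h}=2^n\big(\sum_{p=0}^M\gamma_p^{c}n^{-\frac p2-\frac14}+o(n^{-\frac M2-\frac14})\big)$, where $\gamma_0^c=\frac1\pi\left(\frac34\right)^{\frac14}\Gamma(\frac14)$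 and, for $p\ge1$, $$\gamma_p^c=\frac1{(2\pi)^{3/2}}\sum_{k=1}^p\frac1{k!}\sum\Big(\prod_{j=1}^k\alpha^c_{2p_j,2q_j}\Big)3^{\frac P2+\frac14}\,2^{P+3Q+1}\,\Gamma\Big(\frac P2+\frac14\Big)\Gamma\Big(Q+\frac12\Big),$$ the inner sum being over all $(p_i,q_i)_{1\le i\le k}$ of pairs of non-negative integers with $p_i+2q_i\ge3$ and $P+2Q-2k=p$, where $P=\sum_ip_i$, $Q=\sum_iq_i$, and, for $p+2q\ge3$, $$\alpha^c_{2p,2q}=2^{2p-1}(-1)^q\sum_{n=1}^{p+q}\frac{(-1)^{n-1}}{n2^n}\sum_{\substack{m_1,\dots,m_n\ge1\\ m_1+\cdots+m_n=p+q}}\Big(\prod_{i=1}^n\frac1{(2m_i)!}\Big)\,\#\Big\{S\subseteq\{1,\dots,n\}:\sum_{i\in S}m_i=p,\ \sum_{i\notin S}m_i=q\Big\}$$ (the coefficient of $t^{2p}u^{2q}$ in the Taylor expansion of $\psi$ at $(0,0)$). (3) If $h=0$ and $\beta>\beta_c$, then $O_{d,\beta,h}=2^ne^{n\varphi(t_*)}\big(\sum_{p=0}^M\gamma_p^{>}n^{-p-\frac12}+o(n^{-M-\frac12})\big)$,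 where $\gamma_0^{>}=2\sqrt{\frac2\pi}(2d\beta)^{-\frac12}\big(\frac1{2d\beta}-\frac1{\cosh^2t_*}\big)^{-\frac12}\cosh t_*$ and $\gamma_p^{>}=2\gamma_p$ for $p\ge1$. (4) If $h\ne0$, then $O_{d,\beta,h}=2^ne^{n\varphi(t_*)}\big(\sum_{p=0}^M\gamma_p^{h\ne0}n^{-p-\frac12}+o(n^{-M-\frac12})\big)$, where $\gamma_0^{h\ne0}=\sqrt{\frac2\pi}(2d\beta)^{-\frac12}\big(\frac1{2d\beta}-\frac1{\cosh^2t_*}\big)^{-\frac12}\cosh t_*$ and $\gamma_p^{h\ne0}=\gamma_p$ for $p\ge1$. -/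

import Mathlib

open Filter Asymptotics
open scoped Nat

namespace CurieWeiss

noncomputable section

/-- The critical inverse temperature `β_c = 1 / (2 d)`. -/
def betaC (d : ℕ) : ℝ := 1 / (2 * d)

/-- Total spin `∑ⱼ σⱼ` of a configuration `σ ∈ {-1, 1}ⁿ`; the two spin values `±1` are the units
of `ℤ`. -/
def totalSpin {n : ℕ} (σ : Fin n → ℤˣ) : ℤ := ∑ j, (σ j : ℤ)

/-- (Sum of the spins in the first half) minus (sum of the spins in the second half). -/
def halfDifference {n : ℕ} (σ : Fin n → ℤˣ) : ℤ :=
  (∑ i with i.val < n / 2, (σ i : ℤ)) - ∑ i with n / 2 ≤ i.val, (σ i : ℤ)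

/-- `O_{d,β,h}` for `n` spins: the sum of the Curie-Weiss weights
`exp ((d β / n) (∑ⱼ σⱼ)² + h ∑ⱼ σⱼ)` over the configurations with balanced half-sums. -/
def balancedSum (d : ℕ) (β h : ℝ) (n : ℕ) : ℝ :=
  ∑ σ : Fin n → ℤˣ with halfDifference σ = 0,
    Real.exp (d * β / n * (totalSpin σ : ℝ) ^ 2 + h * (totalSpin σ : ℝ))

/-- `n → ∞` along the even numbers. -/
def evenAtTop : Filter ℕ := atTop ⊓ 𝓟 {n | Even n}

/-- `φ(t) = ln cosh t - (t - |h|)² / (4 d β)`.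
For `β = 0` it is only used at `t = |h|`, where the second term is `0 / 0 = 0`, its limit. -/
def phi (d : ℕ) (β h t : ℝ) : ℝ :=
  Real.log (Real.cosh t) - (t - |h|) ^ 2 / (4 * d * β)

/-- `ψ(t,u) = (ln (cosh (2t) / 2 + cos u / 2) - (t - |h|)² / (2 d β)) / 2`. -/
def psi (d : ℕ) (β h t u : ℝ) : ℝ :=
  (1 / 2) * (Real.log ((1 / 2) * Real.cosh (2 * t) + (1 / 2) * Real.cos u)
    - (t - |h|) ^ 2 / (2 * d * β))

/-- The coefficient `α_{p,q}` of `(s - t)^p u^q` in the Taylor expansion of `ψ(s,u)` at `(t,0)`.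
For `p + q ≥ 3` it does not involve the quadratic term of `ψ`. -/
def alpha (d : ℕ) (β h t : ℝ) (p q : ℕ) : ℝ :=
  iteratedDeriv p (fun s => iteratedDeriv q (fun u => psi d β h s u) 0) t / (p ! * q !)

/-- The families `(p_i, q_i)`, `1 ≤ i ≤ k`, of pairs of natural numbers with `p_i + q_i ≥ 3`,
`∑ (p_i + q_i) = 2 (k + p)`, `∑ p_i` even and `∑ q_i` even. (The range only restates the bound
that the second condition implies.) -/
def regularIndices (p k : ℕ) : Finset (Fin k → ℕ × ℕ) :=
  {c ∈ Fintype.piFinset fun _ : Fin k =>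
      Finset.range (2 * (k + p) + 1) ×ˢ Finset.range (2 * (k + p) + 1) |
    (∀ i, 3 ≤ (c i).1 + (c i).2) ∧ ∑ i, ((c i).1 + (c i).2) = 2 * (k + p) ∧
      Even (∑ i, (c i).1) ∧ Even (∑ i, (c i).2)}

/-- The factor `(2 d β)^{-1/2} (-α_{2,0})^{-(P+1)/2}` for even `P`; at `β = 0`, where `α_{2,0}` is
`-∞`, it is the limit as `β ↓ 0`, namely `√2` for `P = 0` and `0` for `P > 0`. -/
def tFactor (d : ℕ) (β h t : ℝ) (P : ℕ) : ℝ :=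
  if β = 0 then (if P = 0 then √2 else 0)
  else (2 * d * β) ^ (-1 / 2 : ℝ) * (-alpha d β h t 2 0) ^ (-((P : ℝ) + 1) / 2)

/-- The higher coefficients (`p ≥ 1`) coming from one nondegenerate maximum point `(t,0)`
of `ψ`. -/
def gammaMax (d : ℕ) (β h t : ℝ) (p : ℕ) : ℝ :=
  1 / (2 * Real.pi) ^ (3 / 2 : ℝ) *
    ∑ k ∈ Finset.Icc 1 (2 * p), 1 / (k ! : ℝ) *
      ∑ c ∈ regularIndices p k,
        (∏ j, alpha d β h t (c j).1 (c j).2)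
          * tFactor d β h t (∑ i, (c i).1)
          * (-alpha d β h t 0 2) ^ (-(((∑ i, (c i).2 : ℕ) : ℝ) + 1) / 2)
          * Real.Gamma ((((∑ i, (c i).1 : ℕ) : ℝ) + 1) / 2)
          * Real.Gamma ((((∑ i, (c i).2 : ℕ) : ℝ) + 1) / 2)

/-- `γ_p^<`, for `h = 0` and `β < β_c`, where the maximum point is `(0,0)`. -/
def gammaHigh (d : ℕ) (β : ℝ) (p : ℕ) : ℝ :=
  if p = 0 then √(2 / Real.pi) * (1 - 2 * d * β) ^ (-1 / 2 : ℝ)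
  else gammaMax d β 0 0 p

/-- `γ_p^>`, for `h = 0` and `β > β_c`, with `t = t_*`. The two maximum points `(±t,0)` contribute
equally. -/
def gammaLow (d : ℕ) (β t : ℝ) (p : ℕ) : ℝ :=
  if p = 0 then
    2 * √(2 / Real.pi) * (2 * d * β) ^ (-1 / 2 : ℝ)
      * (1 / (2 * d * β) - 1 / Real.cosh t ^ 2) ^ (-1 / 2 : ℝ) * Real.cosh t
  else 2 * gammaMax d β 0 t p

/-- `γ_p^{h ≠ 0}`, with `t = t_*`. At `β = 0` the coefficient `γ_0` is the limit as `β ↓ 0`. -/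
def gammaField (d : ℕ) (β h t : ℝ) (p : ℕ) : ℝ :=
  if p = 0 then
    if β = 0 then √(2 / Real.pi) * Real.cosh t
    else √(2 / Real.pi) * (2 * d * β) ^ (-1 / 2 : ℝ)
      * (1 / (2 * d * β) - 1 / Real.cosh t ^ 2) ^ (-1 / 2 : ℝ) * Real.cosh t
  else gammaMax d β h t p

/-- The compositions `(m_1, …, m_n)` of `N` into `n` positive parts. -/
def compositions (N n : ℕ) : Finset (Fin n → ℕ) :=
  {m ∈ Fintype.piFinset fun _ : Fin n => Finset.Icc 1 N | ∑ i, m i = N}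

/-- The coefficient `α_{2p,2q}` (`p + 2q ≥ 3`) of `t^{2p} u^{2q}` in the Taylor expansion at `(0,0)`
of `ψ` for `h = 0`, `β = β_c`, in closed form. -/
def alphaCrit (p q : ℕ) : ℝ :=
  (2 : ℝ) ^ (2 * (p : ℤ) - 1) * (-1) ^ q *
    ∑ n ∈ Finset.Icc 1 (p + q), (-1 : ℝ) ^ (n - 1) / (n * 2 ^ n) *
      ∑ m ∈ compositions (p + q) n, (∏ i, 1 / ((2 * m i)! : ℝ)) *
        ∑ j ∈ Fintype.piFinset fun i => ({m i, 0} : Finset ℕ),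
          if ∑ i, j i = p ∧ ∑ i, (m i - j i) = q then (1 : ℝ) else 0

/-- The families `(p_i, q_i)`, `1 ≤ i ≤ k`, of pairs of natural numbers with `p_i + 2 q_i ≥ 3` and
`∑ p_i + 2 ∑ q_i - 2 k = p`. (The range only restates a bound that the second condition
implies.) -/
def critIndices (p k : ℕ) : Finset (Fin k → ℕ × ℕ) :=
  {c ∈ Fintype.piFinset fun _ : Fin k =>
      Finset.range (p + 2 * k + 1) ×ˢ Finset.range (p + 2 * k + 1) |
    (∀ i, 3 ≤ (c i).1 + 2 * (c i).2) ∧ ∑ i, (c i).1 + 2 * ∑ i, (c i).2 = p + 2 * k}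

/-- `γ_p^c`, for `h = 0` and `β = β_c`. -/
def gammaCrit (p : ℕ) : ℝ :=
  if p = 0 then 1 / Real.pi * (3 / 4 : ℝ) ^ (1 / 4 : ℝ) * Real.Gamma (1 / 4)
  else 1 / (2 * Real.pi) ^ (3 / 2 : ℝ) *
    ∑ k ∈ Finset.Icc 1 p, 1 / (k ! : ℝ) *
      ∑ c ∈ critIndices p k,
        (∏ j, alphaCrit (c j).1 (c j).2)
          * (3 : ℝ) ^ (((∑ i, (c i).1 : ℕ) : ℝ) / 2 + 1 / 4)
          * (2 : ℝ) ^ (∑ i, (c i).1 + 3 * ∑ i, (c i).2 + 1)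
          * Real.Gamma (((∑ i, (c i).1 : ℕ) : ℝ) / 2 + 1 / 4)
          * Real.Gamma (((∑ i, (c i).2 : ℕ) : ℝ) + 1 / 2)

end

end CurieWeiss

/-!
The sum over balanced configurations is an integral to which Laplace's method applies. The balance
constraint is a Fourier coefficient, `1{Δ = 0} = (2π)⁻¹ ∫ cos (u Δ / 2) du` over `[-π, π]` (the
difference `Δ` of the two half sums is even), and for `β > 0` the quadratic interaction is
linearized by the Hubbard–Stratonovich identity. After that the spins decouple, and with `n = 2 m`
the sum is `2 ^ n` times an explicit prefactor times `∫ exp (n ψ (t, u)) dt du = ∫ F ^ m` over the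
strip `ℝ × [-π, π]`, where `F = exp (2 ψ)` extends continuously to `u = ± π`
(`integral_density_pow`, `balancedSum_eq_integral`).

For fixed `t` the density is maximal at `u = 0`, where `ψ (t, 0) = φ t`. When `h = 0` and
`β ≤ β_c`, the inequality `cosh t < exp (t ^ 2 / 2)` shows that `φ` has the single maximum `0`
(`phi_lt_zero`). Otherwise, since `tanh x / x` is strictly decreasing on the positive axis, `φ` has
a single maximum at `t_*` when `h ≠ 0`, and the two maxima `± t_*` when `h = 0` and `β > β_c`
(`phi_lt_of_nonneg`, `phi_lt_of_ne`). With two maxima the reflection `t ↦ -t` reduces the integral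
to twice that over a half strip (`integral_strip_eq_two_mul`). Everything away from the maximum is
exponentially small (`exists_tail_bound`).

All cases rest on one Laplace expansion, `exists_laplace_expansion`. Suppose that near the maximum
`log F = 2 (-a x ^ (2 w) - b y ^ 2 + R (x, y))`, up to a Taylor error and with `F` normalized to
have maximum `1`, where `R` is a polynomial all of whose monomials `x ^ p y ^ q` have weight
`p + w q > 2 w`. Substituting `x = n ^ (-1 / (2 w)) x'`, `y = n ^ (-1 / 2) y'`, expanding
`exp (n R)` and integrating against `exp (-a x' ^ (2 w) - b y' ^ 2)` gives an expansion in powers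
of `n ^ (-1 / (2 w))`. The error is controlled by a pointwise bound with integrable majorant
(`exists_pointwise_bound`). Nondegenerate maxima are the case `w = 1`; the critical temperature,
where `∂_t² ψ (0, 0) = 0` and `∂_t⁴ ψ (0, 0) < 0`, is the case `w = 2`. The odd powers drop out by
parity, and the remaining coefficients are regrouped into `γ_p` (`gammaMax_eq_laplaceCoeff`,
`gammaCrit_eq_laplaceCoeff`).

The hypotheses on `log F` come from Taylor's formula in two variables with the iterated
derivatives that define `α_{p,q}` (`exists_taylor_two`), except at the critical temperature, where
the combinatorial formula for `α^c` is obtained by substituting the series of `cosh` and `cos`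
into that of the logarithm (`abs_log_sub_sum_le`, `half_sum_coshCosPoly_pow`). For `β = 0` there
is no Hubbard–Stratonovich variable; a decoupled Gaussian factor in `t` is put in its place
(`freeDensity`), which makes the same expansion applicable.
-/

namespace CurieWeiss

open MeasureTheory
open scoped ContDiff

/-! ### Local estimates near a possibly degenerate maximum -/

section

/-- A monomial `x ^ p y ^ q` of weight `p + w q > 2 w` is dominated near the origin by
`x ^ (2 w) + y ^ 2`, with a factor that tends to `0` with the size of the neighbourhood. -/
lemma monomial_le_of_weight {w p q : ℕ} (h : 2 * w + 1 ≤ p + w * q) {δ x y : ℝ}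
    (hδ : δ ≤ 1) (hx0 : 0 ≤ x) (hy0 : 0 ≤ y) (hx : x ≤ δ) (hy : y ≤ δ) :
    x ^ p * y ^ q ≤ δ * (x ^ (2 * w) + y ^ 2) := by
  have hδ0 : 0 ≤ δ := hx0.trans hx
  have hx1 : x ≤ 1 := hx.trans hδ
  have hy1 : y ≤ 1 := hy.trans hδ
  have hxw : 0 ≤ x ^ (2 * w) := by positivity
  have hy2 : 0 ≤ y ^ 2 := by positivity
  rcases Nat.lt_or_ge q 3 with hq | hq
  · interval_cases q
    · have : x ^ p ≤ x ^ (2 * w + 1) := pow_le_pow_of_le_one hx0 hx1 (by omega)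
      have h2 : x ^ (2 * w + 1) ≤ δ * x ^ (2 * w) := by
        rw [pow_succ, mul_comm]; gcongr
      simp only [pow_zero, mul_one]
      nlinarith [mul_nonneg hδ0 hy2]
    · -- here `p ≥ w + 1`, and `x ^ w y` is the mixed term of a square
      have h1 : x ^ p ≤ x ^ (w + 1) := pow_le_pow_of_le_one hx0 hx1 (by omega)
      have h2 : x ^ (w + 1) ≤ δ * x ^ w := by
        rw [pow_succ, mul_comm]; gcongr
      have h3 : x ^ w * y ≤ x ^ (2 * w) + y ^ 2 := by
        rw [mul_comm 2 w, pow_mul]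
        nlinarith [sq_nonneg (x ^ w - y), sq_nonneg (x ^ w), sq_nonneg y]
      calc x ^ p * y ^ 1 ≤ (δ * x ^ w) * y := by rw [pow_one]; gcongr; exact h1.trans h2
        _ = δ * (x ^ w * y) := by ring
        _ ≤ _ := by gcongr
    · have h1 : x ^ p ≤ x ^ 1 := pow_le_pow_of_le_one hx0 hx1 (by omega)
      calc x ^ p * y ^ 2 ≤ δ * y ^ 2 := by gcongr; rw [pow_one] at h1; exact h1.trans hx
        _ ≤ _ := by gcongr; linarith
  · have h1 : x ^ p ≤ 1 := pow_le_one₀ hx0 hx1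
    have h2 : y ^ q ≤ y ^ 3 := pow_le_pow_of_le_one hy0 hy1 hq
    have h3 : y ^ 3 ≤ δ * y ^ 2 := by rw [pow_succ, mul_comm]; gcongr
    calc x ^ p * y ^ q ≤ 1 * y ^ q := by gcongr
      _ ≤ δ * y ^ 2 := by linarith
      _ ≤ _ := by gcongr; linarith

/-- The exponential of a perturbed argument `z + r` against the exponential series at `z`. -/
lemma abs_exp_add_sub_sum_le (z r : ℝ) (n : ℕ) :
    |Real.exp (z + r) - ∑ k ∈ Finset.range n, z ^ k / k !|
      ≤ (|r| + |z| ^ n) * Real.exp (|z| + |r|) := by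
  have h1 : |Real.exp z - ∑ k ∈ Finset.range n, z ^ k / k !| ≤ |z| ^ n * Real.exp |z| := by
    have := Complex.norm_exp_sub_sum_le_norm_mul_exp (z : ℂ) n
    rw [← Complex.ofReal_exp] at this
    have h2 : (∑ m ∈ Finset.range n, (z : ℂ) ^ m / (m ! : ℂ))
        = ((∑ m ∈ Finset.range n, z ^ m / (m ! : ℝ) : ℝ) : ℂ) := by push_cast; rfl
    rw [h2, ← Complex.ofReal_sub, Complex.norm_real, Complex.norm_real] at this
    simpa using this
  have h2 : |Real.exp r - 1| ≤ |r| * Real.exp |r| := by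
    have := Complex.norm_exp_sub_sum_le_norm_mul_exp (r : ℂ) 1
    rw [← Complex.ofReal_exp] at this
    have h2 : (∑ m ∈ Finset.range 1, (r : ℂ) ^ m / (m ! : ℂ)) = ((1 : ℝ) : ℂ) := by simp
    rw [h2, ← Complex.ofReal_sub, Complex.norm_real, Complex.norm_real] at this
    simpa using this
  have h3 : |Real.exp (z + r) - Real.exp z| ≤ |r| * Real.exp (|z| + |r|) := by
    have : Real.exp (z + r) - Real.exp z = Real.exp z * (Real.exp r - 1) := by
      rw [Real.exp_add]; ring
    rw [this, abs_mul, Real.abs_exp, Real.exp_add]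
    calc _ ≤ Real.exp |z| * (|r| * Real.exp |r|) := by
          gcongr; exact le_abs_self z
      _ = _ := by ring
  have h4 : |z| ^ n * Real.exp |z| ≤ |z| ^ n * Real.exp (|z| + |r|) := by
    gcongr; linarith [abs_nonneg r]
  calc _ = |(Real.exp (z + r) - Real.exp z)
        + (Real.exp z - ∑ k ∈ Finset.range n, z ^ k / k !)| := by congr 1; ring
    _ ≤ _ := (abs_add_le _ _).trans (by linarith)

/-- The finite generalized polynomial `∑ᵢ cᵢ s ^ pᵢ u ^ qᵢ`. -/
noncomputable def monomialSum {ι : Type*} (I : Finset ι) (c : ι → ℝ) (p q : ι → ℕ) (s u : ℝ) : ℝ :=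
  ∑ i ∈ I, c i * s ^ p i * u ^ q i

variable {ι : Type*} {I : Finset ι} {c : ι → ℝ} {p q : ι → ℕ} {w : ℕ}

/-- The terms of weight above `2 w` and the remainder are absorbed by half of the principal part
`a s ^ (2 w) + b u ^ 2` near the origin. -/
lemma exists_box_absorb (hw : 1 ≤ w) {a b : ℝ} (ha : 0 < a) (hb : 0 < b)
    (hI : ∀ i ∈ I, 2 * w + 1 ≤ p i + w * q i) {N : ℕ} (hN : 2 * w + 1 ≤ N)
    {C : ℝ} (hC : 0 ≤ C) {δ₀ : ℝ} (hδ₀ : 0 < δ₀) :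
    ∃ δ, 0 < δ ∧ δ ≤ δ₀ ∧ δ ≤ 1 ∧ ∀ s u : ℝ, |s| ≤ δ → |u| ≤ δ →
      |monomialSum I c p q s u| + C * (|s| ^ N + |u| ^ N)
        ≤ (a * s ^ (2 * w) + b * u ^ 2) / 2 := by
  set A : ℝ := ∑ i ∈ I, |c i| + 2 * C with hA
  have hA0 : 0 ≤ A := by positivity
  set m := min a b
  have hm : 0 < m := lt_min ha hb
  refine ⟨min (min δ₀ 1) (m / (2 * (A + 1))), by positivity,
    (min_le_left _ _).trans (min_le_left _ _), (min_le_left _ _).trans (min_le_right _ _), ?_⟩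
  set δ := min (min δ₀ 1) (m / (2 * (A + 1))) with hδ
  intro s u hs hu
  have hδ1 : δ ≤ 1 := (min_le_left _ _).trans (min_le_right _ _)
  have hδ0 : 0 ≤ δ := by positivity
  have hδm : δ * A ≤ m / 2 := by
    have : δ ≤ m / (2 * (A + 1)) := min_le_right _ _
    rw [le_div_iff₀ (by positivity)] at this
    nlinarith
  set X := |s| ^ (2 * w) + |u| ^ 2 with hX
  have hX0 : 0 ≤ X := by positivity
  have key : ∀ P Q : ℕ, 2 * w + 1 ≤ P + w * Q → |s| ^ P * |u| ^ Q ≤ δ * X := fun P Q h =>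
    monomial_le_of_weight h hδ1 (abs_nonneg _) (abs_nonneg _) hs hu
  have h1 : |monomialSum I c p q s u| ≤ (∑ i ∈ I, |c i|) * (δ * X) := by
    rw [Finset.sum_mul]
    refine (Finset.abs_sum_le_sum_abs _ _).trans (Finset.sum_le_sum fun i hi => ?_)
    rw [abs_mul, abs_mul, abs_pow, abs_pow, mul_assoc]
    exact mul_le_mul_of_nonneg_left (key _ _ (hI i hi)) (abs_nonneg _)
  have h2 : |s| ^ N ≤ δ * X := by simpa using key N 0 (by omega)
  have h3 : |u| ^ N ≤ δ * X := by
    have := key 0 N (by nlinarith)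
    simpa using this
  have h4 : m * X ≤ a * s ^ (2 * w) + b * u ^ 2 := by
    have e1 : |s| ^ (2 * w) = s ^ (2 * w) := by rw [pow_mul, sq_abs, ← pow_mul]
    have e2 : 0 ≤ s ^ (2 * w) := by rw [← e1]; positivity
    rw [hX, e1, sq_abs, mul_add]
    gcongr
    · exact min_le_left _ _
    · exact min_le_right _ _
  calc _ ≤ (∑ i ∈ I, |c i|) * (δ * X) + C * (δ * X + δ * X) := by gcongr
    _ = δ * A * X := by rw [hA]; ring
    _ ≤ m / 2 * X := by gcongr
    _ ≤ _ := by linarith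

/-- The square `[-δ, δ]²`. -/
def box (δ : ℝ) : Set (ℝ × ℝ) := {z | |z.1| ≤ δ ∧ |z.2| ≤ δ}

lemma isClosed_box (δ : ℝ) : IsClosed (box δ) :=
  (isClosed_le (f := fun z : ℝ × ℝ => |z.1|) (g := fun _ => δ) (by fun_prop) (by fun_prop)).inter
    (isClosed_le (f := fun z : ℝ × ℝ => |z.2|) (g := fun _ => δ) (by fun_prop) (by fun_prop))

lemma isCompact_box (δ : ℝ) : IsCompact (box δ) := by
  have : box δ ⊆ Metric.closedBall 0 δ := fun z hz => by
    rw [mem_closedBall_zero_iff, Prod.norm_def]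
    exact max_le hz.1 hz.2
  exact (isCompact_closedBall _ _).of_isClosed_subset (isClosed_box δ) this

/-- The coefficients of `ε ^ (-2 w) ∑ᵢ cᵢ (ε x) ^ pᵢ (ε ^ w y) ^ qᵢ` as a generalized polynomial
in `x` and `y`. -/
noncomputable def scaledCoeff (c : ι → ℝ) (p q : ι → ℕ) (w : ℕ) (ε : ℝ) (i : ι) : ℝ :=
  c i * ε ^ (p i + w * q i - 2 * w)

lemma monomialSum_scale (hI : ∀ i ∈ I, 2 * w + 1 ≤ p i + w * q i) {ε : ℝ} (hε : 0 < ε) (x y : ℝ) :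
    (ε ^ (2 * w))⁻¹ * monomialSum I c p q (ε * x) (ε ^ w * y)
      = monomialSum I (scaledCoeff c p q w ε) p q x y := by
  rw [inv_mul_eq_iff_eq_mul₀ (by positivity), monomialSum, monomialSum, Finset.mul_sum]
  refine Finset.sum_congr rfl fun i hi => ?_
  have h : p i + w * q i = 2 * w + (p i + w * q i - 2 * w) := by have := hI i hi; omega
  have e : ε ^ p i * (ε ^ w) ^ q i = ε ^ (2 * w) * ε ^ (p i + w * q i - 2 * w) := by
    rw [← pow_mul, ← pow_add, ← pow_add, ← h]
  rw [mul_pow, mul_pow, scaledCoeff]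
  calc _ = c i * x ^ p i * y ^ q i * (ε ^ p i * (ε ^ w) ^ q i) := by ring
    _ = _ := by rw [e]; ring

lemma abs_scaled_le (hI : ∀ i ∈ I, 2 * w + 1 ≤ p i + w * q i) {ε : ℝ} (hε : 0 < ε) (hε1 : ε ≤ 1)
    (x y : ℝ) :
    |monomialSum I (scaledCoeff c p q w ε) p q x y|
      ≤ ε * ((∑ i ∈ I, |c i|) * (1 + |x| + |y|) ^ (∑ i ∈ I, (p i + q i))) := by
  have hB : 1 ≤ 1 + |x| + |y| := by linarith [abs_nonneg x, abs_nonneg y]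
  rw [Finset.sum_mul, Finset.mul_sum]
  refine (Finset.abs_sum_le_sum_abs _ _).trans (Finset.sum_le_sum fun i hi => ?_)
  rw [scaledCoeff, abs_mul, abs_mul, abs_mul, abs_pow, abs_pow, abs_pow, abs_of_pos hε]
  have h1 : ε ^ (p i + w * q i - 2 * w) ≤ ε := by
    have := hI i hi
    exact pow_le_of_le_one hε.le hε1 (by omega)
  have h2 : |x| ^ p i * |y| ^ q i ≤ (1 + |x| + |y|) ^ (∑ i ∈ I, (p i + q i)) := by
    calc |x| ^ p i * |y| ^ q i ≤ (1 + |x| + |y|) ^ p i * (1 + |x| + |y|) ^ q i := by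
          gcongr
          · linarith [abs_nonneg y]
          · linarith [abs_nonneg x]
      _ = (1 + |x| + |y|) ^ (p i + q i) := (pow_add _ _ _).symm
      _ ≤ _ := pow_le_pow_right₀ hB
          (Finset.single_le_sum (f := fun i => p i + q i) (fun _ _ => Nat.zero_le _) hi)
  calc _ = |c i| * (ε ^ (p i + w * q i - 2 * w) * (|x| ^ p i * |y| ^ q i)) := by ring
    _ ≤ |c i| * (ε * (1 + |x| + |y|) ^ (∑ i ∈ I, (p i + q i))) := by gcongr
    _ = _ := by ring

/-- The pointwise estimate behind the Laplace expansion. Inside the box the integrand is compared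
with the truncated exponential series of its non-principal part; outside the box, where the
rescaled point has size at least `δ / ε`, the truncated series itself is negligible. Both errors
are `O(ε ^ (L + 1))` times one fixed integrable function. -/
lemma exists_pointwise_bound (hw : 1 ≤ w) {a b : ℝ} (ha : 0 < a) (hb : 0 < b)
    (hI : ∀ i ∈ I, 2 * w + 1 ≤ p i + w * q i) {L N : ℕ} (hN : 2 * w + L + 1 ≤ N)
    {C₀ δ₀ : ℝ} (hC₀ : 0 ≤ C₀) (hδ₀ : 0 < δ₀) {ψ : ℝ → ℝ → ℝ}
    (hψ : ∀ s u, |s| ≤ δ₀ → |u| ≤ δ₀ →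
      |ψ s u + (a * s ^ (2 * w) + b * u ^ 2) - monomialSum I c p q s u|
        ≤ C₀ * (|s| ^ N + |u| ^ N)) :
    ∃ δ, 0 < δ ∧ δ ≤ δ₀ ∧ ∃ (C : ℝ) (D : ℕ), ∀ ε, 0 < ε → ε ≤ 1 → ∀ x y : ℝ,
      |(box δ).indicator (fun z => Real.exp ((ε ^ (2 * w))⁻¹ * ψ z.1 z.2)) (ε * x, ε ^ w * y)
        - Real.exp (-(a * x ^ (2 * w) + b * y ^ 2)) * ∑ k ∈ Finset.range (L + 1),
            monomialSum I (scaledCoeff c p q w ε) p q x y ^ k / k !|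
      ≤ C * ε ^ (L + 1) *
          ((1 + |x| + |y|) ^ D * Real.exp (-(a * x ^ (2 * w) + b * y ^ 2) / 2)) := by
  obtain ⟨δ, hδ0, hδδ₀, hδ1, hδ⟩ := exists_box_absorb (I := I) (c := c) (p := p) (q := q) hw ha hb
    hI (N := N) (by omega) hC₀ hδ₀
  set A : ℝ := ∑ i ∈ I, |c i| with hA
  have hA0 : 0 ≤ A := by positivity
  set d : ℕ := ∑ i ∈ I, (p i + q i) with hd
  refine ⟨δ, hδ0, hδδ₀, 2 * C₀ + A ^ (L + 1) + (L + 1) * (1 + A) ^ L * (δ⁻¹) ^ (L + 1),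
    N + d * (L + 1) + (L + 1), fun ε hε hε1 x y => ?_⟩
  set B := 1 + |x| + |y| with hBdef
  have hB : 1 ≤ B := by linarith [abs_nonneg x, abs_nonneg y]
  set E := a * x ^ (2 * w) + b * y ^ 2 with hE
  have hE0 : 0 ≤ E := by
    have : 0 ≤ x ^ (2 * w) := by rw [pow_mul']; positivity
    positivity
  set z := monomialSum I (scaledCoeff c p q w ε) p q x y with hz
  have hzle : |z| ≤ ε * (A * B ^ d) := abs_scaled_le hI hε hε1 x y
  have hBpow : ∀ {k l : ℕ}, k ≤ l → B ^ k ≤ B ^ l := fun h => pow_le_pow_right₀ hB h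
  by_cases hbox : (ε * x, ε ^ w * y) ∈ box δ
  · -- inside the box the exponent is `-E + z + r` with Taylor error `r`, and `|z| + |r| ≤ E / 2`
    rw [Set.indicator_of_mem hbox]
    change |ε * x| ≤ δ ∧ |ε ^ w * y| ≤ δ at hbox
    obtain ⟨hs, hu⟩ := hbox
    set s := ε * x with hsdef
    set u := ε ^ w * y with hudef
    set r := (ε ^ (2 * w))⁻¹ * (ψ s u + (a * s ^ (2 * w) + b * u ^ 2) - monomialSum I c p q s u)
      with hr
    have hprin : (ε ^ (2 * w))⁻¹ * (a * s ^ (2 * w) + b * u ^ 2) = E := by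
      rw [inv_mul_eq_iff_eq_mul₀ (by positivity), hsdef, hudef, hE, mul_pow, mul_pow]; ring
    have hzr : (ε ^ (2 * w))⁻¹ * ψ s u = -E + (z + r) := by
      rw [hz, ← monomialSum_scale hI hε, ← hprin, hr]; ring
    have hR := hψ s u (hs.trans hδδ₀) (hu.trans hδδ₀)
    have hr1 : |r| ≤ (ε ^ (2 * w))⁻¹ * (C₀ * (|s| ^ N + |u| ^ N)) := by
      rw [hr, abs_mul, abs_of_pos (by positivity : 0 < (ε ^ (2 * w))⁻¹)]
      gcongr
    have hsum : |z| + |r| ≤ E / 2 := by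
      have h1 : |z| = (ε ^ (2 * w))⁻¹ * |monomialSum I c p q s u| := by
        rw [hz, ← monomialSum_scale hI hε, abs_mul, abs_of_pos (by positivity : 0 < (ε ^ (2 * w))⁻¹)]
      calc |z| + |r| ≤ (ε ^ (2 * w))⁻¹ * (|monomialSum I c p q s u| + C₀ * (|s| ^ N + |u| ^ N)) := by
            rw [h1, mul_add]; gcongr
        _ ≤ (ε ^ (2 * w))⁻¹ * ((a * s ^ (2 * w) + b * u ^ 2) / 2) := by
            gcongr; exact hδ s u hs hu
        _ = E / 2 := by rw [← hprin]; ring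
    have hrB : |r| ≤ 2 * C₀ * ε ^ (L + 1) * B ^ N := by
      have e1 : |s| ^ N ≤ ε ^ (2 * w) * (ε ^ (L + 1) * B ^ N) := by
        rw [hsdef, abs_mul, abs_of_pos hε, mul_pow, ← mul_assoc, ← pow_add]
        gcongr ?_ * ?_ ^ N
        · exact pow_le_pow_of_le_one hε.le hε1 (by omega)
        · linarith [abs_nonneg y]
      have e2 : |u| ^ N ≤ ε ^ (2 * w) * (ε ^ (L + 1) * B ^ N) := by
        rw [hudef, abs_mul, abs_of_pos (pow_pos hε w), mul_pow, ← mul_assoc, ← pow_add, ← pow_mul]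
        gcongr ?_ * ?_ ^ N
        · exact pow_le_pow_of_le_one hε.le hε1 (by nlinarith)
        · linarith [abs_nonneg x]
      refine hr1.trans ?_
      rw [inv_mul_le_iff₀ (by positivity)]
      calc _ ≤ C₀ * (ε ^ (2 * w) * (ε ^ (L + 1) * B ^ N) + ε ^ (2 * w) * (ε ^ (L + 1) * B ^ N)) := by
            gcongr
        _ = _ := by ring
    have hzB : |z| ^ (L + 1) ≤ A ^ (L + 1) * ε ^ (L + 1) * B ^ (d * (L + 1)) := by
      calc |z| ^ (L + 1) ≤ (ε * (A * B ^ d)) ^ (L + 1) := by gcongr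
        _ = _ := by rw [mul_pow, mul_pow, ← pow_mul]; ring
    have hfac : Real.exp ((ε ^ (2 * w))⁻¹ * ψ s u)
        - Real.exp (-E) * ∑ k ∈ Finset.range (L + 1), z ^ k / k !
        = Real.exp (-E) * (Real.exp (z + r) - ∑ k ∈ Finset.range (L + 1), z ^ k / k !) := by
      rw [hzr, Real.exp_add]; ring
    simp only [] at hfac ⊢
    rw [hfac, abs_mul, Real.abs_exp]
    calc _ ≤ Real.exp (-E) * ((|r| + |z| ^ (L + 1)) * Real.exp (|z| + |r|)) := by
          gcongr; exact abs_exp_add_sub_sum_le z r (L + 1)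
      _ ≤ Real.exp (-E) * ((|r| + |z| ^ (L + 1)) * Real.exp (E / 2)) := by gcongr
      _ = (|r| + |z| ^ (L + 1)) * Real.exp (-E / 2) := by
          rw [mul_comm, mul_assoc, ← Real.exp_add]; congr 2; ring
      _ ≤ (2 * C₀ * ε ^ (L + 1) * B ^ (N + d * (L + 1) + (L + 1))
            + A ^ (L + 1) * ε ^ (L + 1) * B ^ (N + d * (L + 1) + (L + 1))
            + (L + 1) * (1 + A) ^ L * (δ⁻¹) ^ (L + 1) * ε ^ (L + 1)
              * B ^ (N + d * (L + 1) + (L + 1))) * Real.exp (-E / 2) := by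
          refine mul_le_mul_of_nonneg_right ?_ (Real.exp_pos _).le
          have h1 : B ^ N ≤ B ^ (N + d * (L + 1) + (L + 1)) := hBpow (by omega)
          have h2 : B ^ (d * (L + 1)) ≤ B ^ (N + d * (L + 1) + (L + 1)) := hBpow (by omega)
          have h3 : 0 ≤ (L + 1) * (1 + A) ^ L * (δ⁻¹) ^ (L + 1) * ε ^ (L + 1)
              * B ^ (N + d * (L + 1) + (L + 1)) := by positivity
          have h4 := mul_le_mul_of_nonneg_left h1 (by positivity : 0 ≤ 2 * C₀ * ε ^ (L + 1))
          have h5 := mul_le_mul_of_nonneg_left h2 (by positivity : 0 ≤ A ^ (L + 1) * ε ^ (L + 1))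
          linarith
      _ = _ := by ring
  · -- outside the box `ε B / δ ≥ 1`, so that any power of this quotient can be inserted
    rw [Set.indicator_of_notMem hbox, zero_sub, abs_neg, abs_mul, Real.abs_exp]
    have hfar : 1 ≤ ε * B * δ⁻¹ := by
      rw [← div_eq_mul_inv, le_div_iff₀ hδ0, one_mul]
      change ¬ (|ε * x| ≤ δ ∧ |ε ^ w * y| ≤ δ) at hbox
      simp only [not_and_or, not_le, abs_mul, abs_of_pos hε,
        abs_of_pos (pow_pos hε w)] at hbox
      rcases hbox with h | h
      · refine h.le.trans ?_
        gcongr; linarith [abs_nonneg y]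
      · refine h.le.trans ?_
        gcongr
        · exact pow_le_of_le_one hε.le hε1 (by omega)
        · linarith [abs_nonneg x]
    have hsumle : |∑ k ∈ Finset.range (L + 1), z ^ k / k !| ≤ (L + 1) * (1 + A) ^ L * B ^ (d * L) := by
      calc _ ≤ ∑ k ∈ Finset.range (L + 1), (1 + A) ^ L * B ^ (d * L) := by
            refine (Finset.abs_sum_le_sum_abs _ _).trans (Finset.sum_le_sum fun k hk => ?_)
            have hkL : k ≤ L := by simpa [Nat.lt_succ_iff] using hk
            rw [abs_div, abs_pow, Nat.abs_cast]
            calc |z| ^ k / k ! ≤ |z| ^ k :=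
                  div_le_self (by positivity) (by exact_mod_cast Nat.factorial_pos k)
              _ ≤ ((1 + A) * B ^ d) ^ k := by
                  gcongr
                  refine hzle.trans ?_
                  have : ε * (A * B ^ d) ≤ 1 * (A * B ^ d) := by gcongr
                  have h2 : 0 ≤ B ^ d := by positivity
                  linarith
              _ ≤ ((1 + A) * B ^ d) ^ L := by
                  refine pow_le_pow_right₀ ?_ hkL
                  have := one_le_pow₀ hB (n := d)
                  nlinarith
              _ = _ := by rw [mul_pow, ← pow_mul]
        _ = _ := by rw [Finset.sum_const, Finset.card_range, nsmul_eq_mul]; push_cast; ring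
    calc _ ≤ Real.exp (-E / 2) * ((L + 1) * (1 + A) ^ L * B ^ (d * L)) := by
          gcongr; linarith
      _ ≤ Real.exp (-E / 2) * ((L + 1) * (1 + A) ^ L * B ^ (d * L)) * (ε * B * δ⁻¹) ^ (L + 1) :=
          le_mul_of_one_le_right (by positivity) (one_le_pow₀ hfar)
      _ = (L + 1) * (1 + A) ^ L * (δ⁻¹) ^ (L + 1) * ε ^ (L + 1) * B ^ (d * L + (L + 1))
            * Real.exp (-E / 2) := by rw [mul_pow, mul_pow, pow_add]; ring
      _ ≤ (2 * C₀ * ε ^ (L + 1) * B ^ (N + d * (L + 1) + (L + 1))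
            + A ^ (L + 1) * ε ^ (L + 1) * B ^ (N + d * (L + 1) + (L + 1))
            + (L + 1) * (1 + A) ^ L * (δ⁻¹) ^ (L + 1) * ε ^ (L + 1)
              * B ^ (N + d * (L + 1) + (L + 1))) * Real.exp (-E / 2) := by
          refine mul_le_mul_of_nonneg_right ?_ (Real.exp_pos _).le
          have h1 : B ^ (d * L + (L + 1)) ≤ B ^ (N + d * (L + 1) + (L + 1)) :=
            hBpow (by nlinarith)
          have h3 : 0 ≤ 2 * C₀ * ε ^ (L + 1) * B ^ (N + d * (L + 1) + (L + 1)) := by positivity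
          have h4 : 0 ≤ A ^ (L + 1) * ε ^ (L + 1) * B ^ (N + d * (L + 1) + (L + 1)) := by positivity
          have h5 := mul_le_mul_of_nonneg_left h1
            (by positivity : 0 ≤ (L + 1) * (1 + A) ^ L * (δ⁻¹) ^ (L + 1) * ε ^ (L + 1))
          linarith
      _ = _ := by ring

/-! ### Moments and termwise integration -/

lemma integrable_one_add_abs_pow_mul_exp (hw : 1 ≤ w) {a : ℝ} (ha : 0 < a) (D : ℕ) :
    Integrable fun x : ℝ => (1 + |x|) ^ D * Real.exp (-(a * x ^ (2 * w))) := by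
  have h1 : Integrable fun x : ℝ => Real.exp (-a * x ^ 2) := integrable_exp_neg_mul_sq ha
  have h2 : Integrable fun x : ℝ => x ^ (2 * D) * Real.exp (-a * x ^ 2) := by
    have := integrable_rpow_mul_exp_neg_mul_sq ha (s := ((2 * D : ℕ) : ℝ))
      (lt_of_lt_of_le (by norm_num) (Nat.cast_nonneg _))
    simpa only [Real.rpow_natCast] using this
  refine (((h1.add h2).const_mul (2 ^ D * Real.exp a))).mono' (by fun_prop) (ae_of_all _ fun x => ?_)
  have hpow : (1 + |x|) ^ D ≤ 2 ^ D * (1 + x ^ (2 * D)) := by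
    have e : x ^ (2 * D) = |x| ^ (2 * D) := by rw [pow_mul, pow_mul, sq_abs]
    rw [e]
    rcases le_total |x| 1 with h | h
    · calc (1 + |x|) ^ D ≤ 2 ^ D := by gcongr; linarith
        _ ≤ _ := le_mul_of_one_le_right (by positivity) (by
          have : 0 ≤ |x| ^ (2 * D) := by positivity
          linarith)
    · calc (1 + |x|) ^ D ≤ (2 * |x|) ^ D := by gcongr; linarith
        _ = 2 ^ D * |x| ^ D := mul_pow _ _ _
        _ ≤ _ := by
          gcongr
          have := pow_le_pow_right₀ h (show D ≤ 2 * D by omega)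
          linarith
  have hexp : Real.exp (-(a * x ^ (2 * w))) ≤ Real.exp a * Real.exp (-a * x ^ 2) := by
    rw [← Real.exp_add]
    gcongr
    have : x ^ 2 ≤ x ^ (2 * w) + 1 := by
      rw [pow_mul]
      rcases le_total (x ^ 2) 1 with h | h
      · have : 0 ≤ (x ^ 2) ^ w := by positivity
        linarith
      · have := le_self_pow₀ h (show w ≠ 0 by omega)
        linarith
    nlinarith
  rw [Real.norm_of_nonneg (by positivity)]
  calc _ ≤ (2 ^ D * (1 + x ^ (2 * D))) * (Real.exp a * Real.exp (-a * x ^ 2)) :=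
        mul_le_mul hpow hexp (Real.exp_pos _).le ((by positivity : 0 ≤ (1 + |x|) ^ D).trans hpow)
    _ = _ := by simp only [Pi.add_apply]; ring

lemma integrable_dominating (hw : 1 ≤ w) {a b : ℝ} (ha : 0 < a) (hb : 0 < b) (D : ℕ) :
    Integrable fun z : ℝ × ℝ =>
      (1 + |z.1| + |z.2|) ^ D * Real.exp (-(a * z.1 ^ (2 * w) + b * z.2 ^ 2) / 2) := by
  have h1 := integrable_one_add_abs_pow_mul_exp hw (half_pos ha) D
  have h2 := integrable_one_add_abs_pow_mul_exp le_rfl (half_pos hb) D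
  refine (h1.mul_prod h2).mono' (by fun_prop) (ae_of_all _ fun z => ?_)
  rw [Real.norm_of_nonneg (by positivity), mul_one]
  calc _ ≤ ((1 + |z.1|) * (1 + |z.2|)) ^ D
        * (Real.exp (-(a / 2 * z.1 ^ (2 * w))) * Real.exp (-(b / 2 * z.2 ^ 2))) := by
        rw [← Real.exp_add]
        gcongr
        · nlinarith [mul_nonneg (abs_nonneg z.1) (abs_nonneg z.2)]
        · linarith
    _ = _ := by rw [mul_pow]; ring

/-- The moment `∫ x ^ P exp (-a x ^ (2 w)) dx`. -/
noncomputable def moment (w : ℕ) (a : ℝ) (P : ℕ) : ℝ :=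
  ∫ x : ℝ, x ^ P * Real.exp (-(a * x ^ (2 * w)))

lemma integrable_moment (hw : 1 ≤ w) {a : ℝ} (ha : 0 < a) (P : ℕ) :
    Integrable fun x : ℝ => x ^ P * Real.exp (-(a * x ^ (2 * w))) := by
  refine (integrable_one_add_abs_pow_mul_exp hw ha P).mono' (by fun_prop) (ae_of_all _ fun x => ?_)
  rw [Real.norm_eq_abs, abs_mul, abs_pow, Real.abs_exp]
  gcongr
  linarith

lemma moment_odd {P : ℕ} (hP : Odd P) (w : ℕ) (a : ℝ) : moment w a P = 0 := by
  have h := integral_neg_eq_self (fun x : ℝ => x ^ P * Real.exp (-(a * x ^ (2 * w)))) volume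
  have e : (fun x : ℝ => (-x) ^ P * Real.exp (-(a * (-x) ^ (2 * w))))
      = fun x => -(x ^ P * Real.exp (-(a * x ^ (2 * w)))) := by
    funext x
    rw [hP.neg_pow, (even_two_mul w).neg_pow]; ring
  rw [e, integral_neg] at h
  have : -moment w a P = moment w a P := h
  linarith

lemma moment_even (hw : 1 ≤ w) {a : ℝ} (ha : 0 < a) {P : ℕ} (hP : Even P) :
    moment w a P = a ^ (-((P : ℝ) + 1) / (2 * w)) * (1 / w) * Real.Gamma (((P : ℝ) + 1) / (2 * w)) := by
  have hw' : (0 : ℝ) < w := by exact_mod_cast hw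
  have e : moment w a P = ∫ x : ℝ, (fun y : ℝ => y ^ (P : ℝ) * Real.exp (-a * y ^ (2 * w : ℝ))) |x| := by
    refine integral_congr_ae (ae_of_all _ fun x => ?_)
    have : (2 * w : ℝ) = ((2 * w : ℕ) : ℝ) := by push_cast; rfl
    simp only [this, Real.rpow_natCast, hP.pow_abs, (even_two_mul w).pow_abs, neg_mul]
  rw [e, integral_comp_abs (f := fun y : ℝ => y ^ (P : ℝ) * Real.exp (-a * y ^ (2 * w : ℝ))),
    integral_rpow_mul_exp_neg_mul_rpow (by positivity)
    (lt_of_lt_of_le (by norm_num) (Nat.cast_nonneg _)) ha]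
  field_simp

lemma map_volume_scale {ε η : ℝ} (hε : 0 < ε) (hη : 0 < η) :
    Measure.map ((MeasurableEquiv.mulLeft₀ ε hε.ne').prodCongr (MeasurableEquiv.mulLeft₀ η hη.ne'))
      (volume : Measure (ℝ × ℝ)) = ENNReal.ofReal ((ε * η)⁻¹) • volume := by
  have : ⇑((MeasurableEquiv.mulLeft₀ ε hε.ne').prodCongr (MeasurableEquiv.mulLeft₀ η hη.ne'))
      = Prod.map (fun x => ε * x) (fun x => η * x) := rfl
  rw [this, Measure.volume_eq_prod, ← Measure.map_prod_map _ _ (by fun_prop) (by fun_prop),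
    Real.map_volume_mul_left hε.ne', Real.map_volume_mul_left hη.ne', Measure.prod_smul_left,
    Measure.prod_smul_right, smul_smul, ← ENNReal.ofReal_mul (by positivity),
    abs_of_pos (by positivity), abs_of_pos (by positivity), mul_inv]

lemma integral_scale {ε η : ℝ} (hε : 0 < ε) (hη : 0 < η) (f : ℝ × ℝ → ℝ) :
    ∫ z : ℝ × ℝ, f (ε * z.1, η * z.2) = (ε * η)⁻¹ * ∫ z, f z := by
  have h := integral_map_equiv (μ := volume)
    ((MeasurableEquiv.mulLeft₀ ε hε.ne').prodCongr (MeasurableEquiv.mulLeft₀ η hη.ne')) f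
  rw [map_volume_scale hε hη, integral_smul_measure, ENNReal.toReal_ofReal (by positivity),
    smul_eq_mul] at h
  rw [h]; rfl

lemma integrable_scale {ε η : ℝ} (hε : 0 < ε) (hη : 0 < η) {f : ℝ × ℝ → ℝ} (hf : Integrable f) :
    Integrable fun z : ℝ × ℝ => f (ε * z.1, η * z.2) := by
  refine (integrable_map_equiv (μ := volume)
    ((MeasurableEquiv.mulLeft₀ ε hε.ne').prodCongr (MeasurableEquiv.mulLeft₀ η hη.ne')) f).1 ?_
  rw [map_volume_scale hε hη]
  exact hf.smul_measure ENNReal.ofReal_ne_top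

/-- The excess of weight over `2 w`, summed over a family of monomials. -/
def excess (p q : ι → ℕ) (w : ℕ) {k : ℕ} (f : Fin k → ι) : ℕ :=
  ∑ j, (p (f j) + w * q (f j) - 2 * w)

lemma monomialSum_pow (c : ι → ℝ) (ε x y : ℝ) (k : ℕ) :
    monomialSum I (scaledCoeff c p q w ε) p q x y ^ k
      = ∑ f ∈ Fintype.piFinset fun _ : Fin k => I,
          ((∏ j, c (f j)) * ε ^ excess p q w f) * (x ^ (∑ j, p (f j)) * y ^ (∑ j, q (f j))) := by
  have h := Finset.prod_univ_sum (fun _ : Fin k => I)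
    (fun _ i => scaledCoeff c p q w ε i * x ^ p i * y ^ q i)
  rw [Finset.prod_const, Finset.card_univ, Fintype.card_fin] at h
  rw [monomialSum, h]
  refine Finset.sum_congr rfl fun f _ => ?_
  simp only [scaledCoeff, Finset.prod_mul_distrib, Finset.prod_pow_eq_pow_sum, excess]
  ring

lemma integral_gaussian_mul_series (hw : 1 ≤ w) {a b : ℝ} (ha : 0 < a) (hb : 0 < b) (L : ℕ) (ε : ℝ) :
    Integrable (fun z : ℝ × ℝ => Real.exp (-(a * z.1 ^ (2 * w) + b * z.2 ^ 2))
      * ∑ k ∈ Finset.range (L + 1), monomialSum I (scaledCoeff c p q w ε) p q z.1 z.2 ^ k / k !) ∧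
    ∫ z : ℝ × ℝ, Real.exp (-(a * z.1 ^ (2 * w) + b * z.2 ^ 2))
      * ∑ k ∈ Finset.range (L + 1), monomialSum I (scaledCoeff c p q w ε) p q z.1 z.2 ^ k / k !
    = ∑ k ∈ Finset.range (L + 1), 1 / (k ! : ℝ) * ∑ f ∈ Fintype.piFinset fun _ : Fin k => I,
        ((∏ j, c (f j)) * (moment w a (∑ j, p (f j)) * moment 1 b (∑ j, q (f j))))
          * ε ^ excess p q w f := by
  have hint : ∀ P Q : ℕ, Integrable fun z : ℝ × ℝ =>
      (z.1 ^ P * Real.exp (-(a * z.1 ^ (2 * w)))) * (z.2 ^ Q * Real.exp (-(b * z.2 ^ (2 * 1)))) :=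
    fun P Q => (integrable_moment hw ha P).mul_prod (integrable_moment le_rfl hb Q)
  have hval : ∀ P Q : ℕ, ∫ z : ℝ × ℝ,
      (z.1 ^ P * Real.exp (-(a * z.1 ^ (2 * w)))) * (z.2 ^ Q * Real.exp (-(b * z.2 ^ (2 * 1))))
      = moment w a P * moment 1 b Q := fun P Q =>
    integral_prod_mul (fun x : ℝ => x ^ P * Real.exp (-(a * x ^ (2 * w))))
      (fun y : ℝ => y ^ Q * Real.exp (-(b * y ^ (2 * 1))))
  have e : (fun z : ℝ × ℝ => Real.exp (-(a * z.1 ^ (2 * w) + b * z.2 ^ 2))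
      * ∑ k ∈ Finset.range (L + 1), monomialSum I (scaledCoeff c p q w ε) p q z.1 z.2 ^ k / k !)
      = fun z : ℝ × ℝ => ∑ k ∈ Finset.range (L + 1), 1 / (k ! : ℝ) *
        ∑ f ∈ Fintype.piFinset fun _ : Fin k => I, ((∏ j, c (f j)) * ε ^ excess p q w f) *
          ((z.1 ^ (∑ j, p (f j)) * Real.exp (-(a * z.1 ^ (2 * w))))
            * (z.2 ^ (∑ j, q (f j)) * Real.exp (-(b * z.2 ^ (2 * 1))))) := by
    funext z
    rw [Finset.mul_sum]
    refine Finset.sum_congr rfl fun k _ => ?_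
    rw [monomialSum_pow, neg_add, Real.exp_add, mul_one, div_eq_mul_one_div, ← mul_assoc, mul_comm,
      Finset.mul_sum]
    congr 1
    refine Finset.sum_congr rfl fun f _ => ?_
    ring
  have hintf : ∀ k : ℕ, ∀ f : Fin k → ι, Integrable fun z : ℝ × ℝ =>
      ((∏ j, c (f j)) * ε ^ excess p q w f) *
          ((z.1 ^ (∑ j, p (f j)) * Real.exp (-(a * z.1 ^ (2 * w))))
            * (z.2 ^ (∑ j, q (f j)) * Real.exp (-(b * z.2 ^ (2 * 1))))) :=
    fun k f => (hint _ _).const_mul _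
  have hintk : ∀ k : ℕ, Integrable fun z : ℝ × ℝ => 1 / (k ! : ℝ) *
        ∑ f ∈ Fintype.piFinset fun _ : Fin k => I, ((∏ j, c (f j)) * ε ^ excess p q w f) *
          ((z.1 ^ (∑ j, p (f j)) * Real.exp (-(a * z.1 ^ (2 * w))))
            * (z.2 ^ (∑ j, q (f j)) * Real.exp (-(b * z.2 ^ (2 * 1))))) :=
    fun k => (integrable_finsetSum _ fun f _ => hintf k f).const_mul _
  rw [e]
  refine ⟨integrable_finsetSum _ fun k _ => hintk k, ?_⟩
  rw [integral_finsetSum _ fun k _ => hintk k]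
  refine Finset.sum_congr rfl fun k _ => ?_
  rw [integral_const_mul, integral_finsetSum _ fun f _ => hintf k f]
  congr 1
  refine Finset.sum_congr rfl fun f _ => ?_
  rw [integral_const_mul, hval]
  ring

/-- The coefficient of `ε ^ j` in the Laplace expansion with principal part
`-(a s ^ (2 w) + b u ^ 2)` and further terms `cᵢ s ^ pᵢ u ^ qᵢ`, computed with the exponential
series truncated at order `L`. -/
noncomputable def laplaceCoeff (I : Finset ι) (c : ι → ℝ) (p q : ι → ℕ) (w : ℕ) (a b : ℝ) (L j : ℕ) :
    ℝ :=
  ∑ k ∈ Finset.range (L + 1), 1 / (k ! : ℝ) *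
    ∑ f ∈ Fintype.piFinset fun _ : Fin k => I, if excess p q w f = j then
      (∏ j, c (f j)) * (moment w a (∑ j, p (f j)) * moment 1 b (∑ j, q (f j))) else 0

lemma abs_sum_mul_pow_sub_le {κ : Type*} (T : Finset κ) (X : κ → ℝ) (e : κ → ℕ) (L : ℕ) {ε : ℝ}
    (hε : 0 ≤ ε) (hε1 : ε ≤ 1) :
    |∑ f ∈ T, X f * ε ^ e f
        - ∑ j ∈ Finset.range (L + 1), (∑ f ∈ T, if e f = j then X f else 0) * ε ^ j|
      ≤ (∑ f ∈ T, |X f|) * ε ^ (L + 1) := by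
  simp_rw [Finset.sum_mul]
  rw [Finset.sum_comm, ← Finset.sum_sub_distrib]
  refine (Finset.abs_sum_le_sum_abs _ _).trans (Finset.sum_le_sum fun f _ => ?_)
  have : ∑ j ∈ Finset.range (L + 1), (if e f = j then X f else 0) * ε ^ j
      = if e f < L + 1 then X f * ε ^ e f else 0 := by
    simp_rw [ite_mul, zero_mul]
    rw [Finset.sum_ite_eq]
    simp
  rw [this]
  split_ifs with h
  · simp only [sub_self, abs_zero]; positivity
  · rw [sub_zero, abs_mul, abs_pow, abs_of_nonneg hε]
    gcongr ?_ * ?_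
    exact pow_le_pow_of_le_one hε hε1 (by omega)

/-- Collecting the powers of `ε` in the integrated series: the terms of excess above `L`, which
`laplaceCoeff` leaves out, are `O(ε ^ (L + 1))`. -/
lemma exists_regroup_bound (I : Finset ι) (c : ι → ℝ) (p q : ι → ℕ) (w : ℕ) (a b : ℝ) (L : ℕ) :
    ∃ C : ℝ, ∀ ε : ℝ, 0 < ε → ε ≤ 1 →
    |(∑ k ∈ Finset.range (L + 1), 1 / (k ! : ℝ) * ∑ f ∈ Fintype.piFinset fun _ : Fin k => I,
        ((∏ j, c (f j)) * (moment w a (∑ j, p (f j)) * moment 1 b (∑ j, q (f j))))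
          * ε ^ excess p q w f)
      - ∑ j ∈ Finset.range (L + 1), laplaceCoeff I c p q w a b L j * ε ^ j| ≤ C * ε ^ (L + 1) := by
  refine ⟨∑ k ∈ Finset.range (L + 1), 1 / (k ! : ℝ) * ∑ f ∈ Fintype.piFinset fun _ : Fin k => I,
    |(∏ j, c (f j)) * (moment w a (∑ j, p (f j)) * moment 1 b (∑ j, q (f j)))|, fun ε hε hε1 => ?_⟩
  simp_rw [laplaceCoeff]
  simp_rw [Finset.sum_mul _ _ (ε ^ _)]
  rw [Finset.sum_comm, ← Finset.sum_sub_distrib]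
  refine (Finset.abs_sum_le_sum_abs _ _).trans (Finset.sum_le_sum fun k _ => ?_)
  simp_rw [mul_assoc (1 / (k ! : ℝ))]
  rw [← Finset.mul_sum, ← mul_sub, abs_mul, abs_of_nonneg (by positivity : 0 ≤ 1 / (k ! : ℝ))]
  exact mul_le_mul_of_nonneg_left (abs_sum_mul_pow_sub_le _ _ _ L hε.le hε1) (by positivity)

/-- The expansion of the integral over a small box, obtained by integrating the pointwise bound in
the scaled variables; the factor `ε ^ (1 + w)` is the Jacobian of the scaling. -/
lemma exists_box_expansion (hw : 1 ≤ w) {a b : ℝ} (ha : 0 < a) (hb : 0 < b)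
    (hI : ∀ i ∈ I, 2 * w + 1 ≤ p i + w * q i) {L N : ℕ} (hN : 2 * w + L + 1 ≤ N)
    {C₀ δ₀ : ℝ} (hC₀ : 0 ≤ C₀) (hδ₀ : 0 < δ₀) {ψ : ℝ → ℝ → ℝ}
    (hcont : ContinuousOn (fun z : ℝ × ℝ => ψ z.1 z.2) (box δ₀))
    (hψ : ∀ s u, |s| ≤ δ₀ → |u| ≤ δ₀ →
      |ψ s u + (a * s ^ (2 * w) + b * u ^ 2) - monomialSum I c p q s u|
        ≤ C₀ * (|s| ^ N + |u| ^ N)) :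
    ∃ δ, 0 < δ ∧ δ ≤ δ₀ ∧ ∃ C : ℝ, ∀ ε, 0 < ε → ε ≤ 1 →
      |(∫ z in box δ, Real.exp ((ε ^ (2 * w))⁻¹ * ψ z.1 z.2))
        - ε ^ (1 + w) * ∑ j ∈ Finset.range (L + 1), laplaceCoeff I c p q w a b L j * ε ^ j|
      ≤ C * ε ^ (1 + w + (L + 1)) := by
  obtain ⟨δ, hδ0, hδδ₀, C, D, hC⟩ := exists_pointwise_bound hw ha hb hI hN hC₀ hδ₀ hψ
  obtain ⟨C', hC'⟩ := exists_regroup_bound I c p q w a b L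
  set J := ∫ z : ℝ × ℝ, (1 + |z.1| + |z.2|) ^ D * Real.exp (-(a * z.1 ^ (2 * w) + b * z.2 ^ 2) / 2)
    with hJ
  refine ⟨δ, hδ0, hδδ₀, C * J + C', fun ε hε hε1 => ?_⟩
  have hsub : box δ ⊆ box δ₀ := fun z hz => ⟨hz.1.trans hδδ₀, hz.2.trans hδδ₀⟩
  set g : ℝ × ℝ → ℝ := (box δ).indicator fun z => Real.exp ((ε ^ (2 * w))⁻¹ * ψ z.1 z.2) with hg
  have hgint : Integrable g := by
    rw [hg, integrable_indicator_iff (isClosed_box δ).measurableSet]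
    refine ContinuousOn.integrableOn_compact (isCompact_box δ) ?_
    exact Real.continuous_exp.comp_continuousOn (continuousOn_const.mul (hcont.mono hsub))
  have hgval : ∫ z, g z = ∫ z in box δ, Real.exp ((ε ^ (2 * w))⁻¹ * ψ z.1 z.2) := by
    rw [hg, integral_indicator (isClosed_box δ).measurableSet]
  have hsc : ∫ z : ℝ × ℝ, g (ε * z.1, ε ^ w * z.2) = (ε * ε ^ w)⁻¹ * ∫ z, g z :=
    integral_scale hε (pow_pos hε w) g
  have hgsint : Integrable fun z : ℝ × ℝ => g (ε * z.1, ε ^ w * z.2) :=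
    integrable_scale hε (pow_pos hε w) hgint
  obtain ⟨hhint, hhval⟩ := integral_gaussian_mul_series (I := I) (c := c) (p := p) (q := q) hw ha hb
    L ε
  have hdom := (integrable_dominating hw ha hb D).const_mul (C * ε ^ (L + 1))
  have hdiff : |(∫ z : ℝ × ℝ, g (ε * z.1, ε ^ w * z.2))
      - ∑ j ∈ Finset.range (L + 1), laplaceCoeff I c p q w a b L j * ε ^ j|
      ≤ (C * J + C') * ε ^ (L + 1) := by
    have h1 : |(∫ z : ℝ × ℝ, g (ε * z.1, ε ^ w * z.2))
        - ∫ z : ℝ × ℝ, Real.exp (-(a * z.1 ^ (2 * w) + b * z.2 ^ 2))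
      * ∑ k ∈ Finset.range (L + 1), monomialSum I (scaledCoeff c p q w ε) p q z.1 z.2 ^ k / k !|
        ≤ C * ε ^ (L + 1) * J := by
      rw [← integral_sub hgsint hhint, hJ, ← integral_const_mul, ← Real.norm_eq_abs]
      exact norm_integral_le_of_norm_le hdom (ae_of_all _ fun z => hC ε hε hε1 z.1 z.2)
    rw [hhval] at h1
    have h2 := hC' ε hε hε1
    calc _ ≤ _ := abs_sub_le _ _ _
      _ ≤ C * ε ^ (L + 1) * J + C' * ε ^ (L + 1) := add_le_add h1 h2
      _ = _ := by ring
  rw [hsc, hgval] at hdiff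
  have hpow : ε ^ (1 + w) = ε * ε ^ w := by rw [pow_add, pow_one]
  have hpos : 0 < ε * ε ^ w := by positivity
  rw [pow_add _ (1 + w), hpow]
  calc _ = |(ε * ε ^ w) * ((ε * ε ^ w)⁻¹ * (∫ z in box δ, Real.exp ((ε ^ (2 * w))⁻¹ * ψ z.1 z.2))
      - ∑ j ∈ Finset.range (L + 1), laplaceCoeff I c p q w a b L j * ε ^ j)| := by
        congr 1; rw [mul_sub, mul_inv_cancel_left₀ hpos.ne']
    _ ≤ (ε * ε ^ w) * ((C * J + C') * ε ^ (L + 1)) := by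
        rw [abs_mul, abs_of_pos hpos]; gcongr
    _ = _ := by ring

/-! ### The weighted Laplace expansion -/

/-- The length scale `ε = n ^ (-1 / (2 w))`, `n = 2 m`, on which the first variable lives. -/
noncomputable def laplaceScale (w m : ℕ) : ℝ := (2 * m : ℝ) ^ (-(1 / (2 * w : ℝ)))

lemma laplaceScale_pos {m : ℕ} (hm : 1 ≤ m) : 0 < laplaceScale w m := by
  have : (0 : ℝ) < m := by exact_mod_cast hm
  exact Real.rpow_pos_of_pos (by positivity) _

lemma laplaceScale_le_one {m : ℕ} (hm : 1 ≤ m) : laplaceScale w m ≤ 1 := by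
  have : (1 : ℝ) ≤ m := by exact_mod_cast hm
  exact Real.rpow_le_one_of_one_le_of_nonpos (by linarith)
    (by rw [neg_nonpos]; positivity)

lemma laplaceScale_pow {m : ℕ} (k : ℕ) :
    laplaceScale w m ^ k = (2 * m : ℝ) ^ (-((k : ℝ) / (2 * w))) := by
  rw [laplaceScale, ← Real.rpow_natCast, ← Real.rpow_mul (by positivity)]
  congr 1; ring

lemma laplaceScale_pow_two_mul (hw : 1 ≤ w) {m : ℕ} : laplaceScale w m ^ (2 * w) = (2 * m : ℝ)⁻¹ := by
  have : (0 : ℝ) < w := by exact_mod_cast hw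
  rw [laplaceScale_pow, ← Real.rpow_neg_one]
  congr 1; push_cast; field_simp

lemma tendsto_laplaceScale (hw : 1 ≤ w) : Tendsto (laplaceScale w) atTop (nhds 0) := by
  have : (0 : ℝ) < w := by exact_mod_cast hw
  exact (tendsto_rpow_neg_atTop (by positivity : 0 < 1 / (2 * w : ℝ))).comp
    (tendsto_natCast_atTop_atTop.const_mul_atTop (by norm_num))

/-- The tail of the integral is exponentially small, hence below any power of the length scale. -/
lemma exists_geometric_bound (hw : 1 ≤ w) {ρ : ℝ} (hρ0 : 0 ≤ ρ) (hρ : ρ < 1) (K : ℕ) :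
    ∃ C : ℝ, 0 ≤ C ∧ ∀ m : ℕ, 1 ≤ m → ρ ^ (m - 1) ≤ C * laplaceScale w m ^ K := by
  have hw' : (1 : ℝ) ≤ w := by exact_mod_cast hw
  set r := max ρ (1 / 2) with hr
  have hr0 : 0 < r := lt_of_lt_of_le (by norm_num) (le_max_right _ _)
  have hr1 : r < 1 := max_lt hρ (by norm_num)
  obtain ⟨B, hB⟩ := (tendsto_pow_const_mul_const_pow_of_lt_one K hr0.le hr1).bddAbove_range
  have hB0 : 0 ≤ B := le_trans (by positivity) (hB ⟨0, rfl⟩)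
  refine ⟨B * 2 ^ K / r, by positivity, fun m hm => ?_⟩
  have hm' : (1 : ℝ) ≤ m := by exact_mod_cast hm
  have h1 : (m : ℝ) ^ K * r ^ m ≤ B := hB ⟨m, rfl⟩
  have h2 : (2 * m : ℝ)⁻¹ ≤ laplaceScale w m := by
    rw [← laplaceScale_pow_two_mul hw]
    exact pow_le_of_le_one (laplaceScale_pos hm).le (laplaceScale_le_one hm) (by omega)
  have h3 : 1 ≤ m * (2 * laplaceScale w m) := by
    rw [inv_le_iff_one_le_mul₀ (by positivity)] at h2
    linarith
  have h4 : r ^ m = r ^ (m - 1) * r := by rw [← pow_succ, Nat.sub_add_cancel hm]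
  calc ρ ^ (m - 1) ≤ r ^ (m - 1) := by gcongr; exact le_max_left _ _
    _ = r ^ m / r := by rw [h4]; field_simp
    _ ≤ (m * (2 * laplaceScale w m)) ^ K * r ^ m / r := by
        gcongr
        exact le_mul_of_one_le_left (by positivity) (one_le_pow₀ h3)
    _ = (m ^ K * r ^ m) * (2 ^ K * laplaceScale w m ^ K) / r := by rw [mul_pow, mul_pow]; ring
    _ ≤ B * (2 ^ K * laplaceScale w m ^ K) / r := by
        have := (laplaceScale_pos (w := w) hm).le
        gcongr
    _ = _ := by ring

/-- **Laplace expansion** around one maximum point `(t, 0)` of `F`, where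
`F (t + s, u) = exp (2 ψ(s, u))` with `ψ = -(a s ^ (2 w) + b u ^ 2) + ∑ᵢ cᵢ s ^ pᵢ u ^ qᵢ + ⋯`.
The weight `w = 1` is the nondegenerate case, `w = 2` a quartic maximum in the first variable. -/
theorem exists_laplace_expansion (hw : 1 ≤ w) {a b : ℝ} (ha : 0 < a) (hb : 0 < b)
    (hI : ∀ i ∈ I, 2 * w + 1 ≤ p i + w * q i) {L N : ℕ} (hN : 2 * w + L + 1 ≤ N)
    {C₀ δ₀ : ℝ} (hC₀ : 0 ≤ C₀) (hδ₀ : 0 < δ₀) {ψ : ℝ → ℝ → ℝ}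
    (hcont : ContinuousOn (fun z : ℝ × ℝ => ψ z.1 z.2) (box δ₀))
    (hψ : ∀ s u, |s| ≤ δ₀ → |u| ≤ δ₀ →
      |ψ s u + (a * s ^ (2 * w) + b * u ^ 2) - monomialSum I c p q s u|
        ≤ C₀ * (|s| ^ N + |u| ^ N))
    {S : Set (ℝ × ℝ)} (hS : MeasurableSet S) {F : ℝ × ℝ → ℝ} (hF0 : ∀ z ∈ S, 0 ≤ F z)
    (hFm : Measurable F) (hFint : IntegrableOn F S) {t : ℝ}
    (hFψ : ∀ s u, |s| ≤ δ₀ → |u| ≤ δ₀ → (t + s, u) ∈ S ∧ F (t + s, u) = Real.exp (2 * ψ s u))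
    (htail : ∀ δ, 0 < δ → ∃ ρ, 0 ≤ ρ ∧ ρ < 1 ∧ ∀ s u, (t + s, u) ∈ S → (s, u) ∉ box δ →
      F (t + s, u) ≤ ρ) :
    ∃ C : ℝ, ∀ m : ℕ, 1 ≤ m →
      |(∫ z in S, F z ^ m) - laplaceScale w m ^ (1 + w) *
        ∑ j ∈ Finset.range (L + 1), laplaceCoeff I c p q w a b L j * laplaceScale w m ^ j|
      ≤ C * laplaceScale w m ^ (1 + w + (L + 1)) := by
  obtain ⟨δ, hδ0, hδδ₀, C, hC⟩ := exists_box_expansion hw ha hb hI hN hC₀ hδ₀ hcont hψ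
  obtain ⟨ρ, hρ0, hρ1, hρ⟩ := htail δ hδ0
  obtain ⟨C', hC'0, hC'⟩ := exists_geometric_bound hw hρ0 hρ1 (1 + w + (L + 1))
  set B : Set (ℝ × ℝ) := {z | (z.1 - t, z.2) ∈ box δ} with hB
  have hBm : MeasurableSet B :=
    (isClosed_box δ).measurableSet.preimage (f := fun z : ℝ × ℝ => (z.1 - t, z.2)) (by fun_prop)
  have hBS : B ⊆ S := fun z hz => by
    have := (hFψ (z.1 - t) z.2 (hz.1.trans hδδ₀) (hz.2.trans hδδ₀)).1
    rwa [add_sub_cancel] at this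
  refine ⟨C + C' * ∫ z in S, F z, fun m hm => ?_⟩
  have hm' : (1 : ℝ) ≤ m := by exact_mod_cast hm
  set ε := laplaceScale w m with hε
  have hεpos : 0 < ε := laplaceScale_pos hm
  have hbox : ∫ z in B, F z ^ m = ∫ z in box δ, Real.exp ((ε ^ (2 * w))⁻¹ * ψ z.1 z.2) := by
    have hmp : MeasurePreserving (fun z : ℝ × ℝ => z + (t, 0)) :=
      measurePreserving_add_right volume _
    have hemb : MeasurableEmbedding (fun z : ℝ × ℝ => z + (t, 0)) :=
      (MeasurableEquiv.addRight ((t, 0) : ℝ × ℝ)).measurableEmbedding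
    rw [← hmp.setIntegral_preimage_emb hemb]
    have hpre : (fun z : ℝ × ℝ => z + (t, 0)) ⁻¹' B = box δ := by
      ext z
      change ((z.1 + t) - t, z.2 + 0) ∈ box δ ↔ z ∈ box δ
      simp
    rw [hpre]
    refine setIntegral_congr_fun (isClosed_box δ).measurableSet fun z hz => ?_
    have h := (hFψ z.1 z.2 (hz.1.trans hδδ₀) (hz.2.trans hδδ₀)).2
    have e : z + (t, 0) = (t + z.1, z.2) := by ext <;> simp [add_comm]
    simp only [e, h, ← Real.exp_nat_mul]
    rw [hε, laplaceScale_pow_two_mul hw, inv_inv]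
    ring_nf
  have hle : ∀ z ∈ S \ B, F z ^ m ≤ ρ ^ (m - 1) * F z := fun z hz => by
    have h1 : F z ≤ ρ := by
      have := hρ (z.1 - t) z.2 (by rw [add_sub_cancel]; exact hz.1) hz.2
      rwa [add_sub_cancel] at this
    have h0 := hF0 z hz.1
    have e : F z ^ m = F z ^ (m - 1) * F z := by rw [← pow_succ, Nat.sub_add_cancel hm]
    rw [e]
    gcongr
  have hFd : IntegrableOn (fun z => ρ ^ (m - 1) * F z) (S \ B) :=
    (hFint.mono_set Set.sdiff_subset).const_mul _
  have hFmd : IntegrableOn (fun z => F z ^ m) (S \ B) := by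
    refine Integrable.mono' hFd (hFm.pow_const m).aestronglyMeasurable ?_
    filter_upwards [ae_restrict_mem (hS.diff hBm)] with z hz
    rw [Real.norm_of_nonneg (pow_nonneg (hF0 z hz.1) _)]
    exact hle z hz
  have hFmB : IntegrableOn (fun z => F z ^ m) B := by
    have hBc : IsCompact B := by
      have hcl : IsClosed B :=
        (isClosed_box δ).preimage (f := fun z : ℝ × ℝ => (z.1 - t, z.2)) (by fun_prop)
      have hsub : B ⊆ Metric.closedBall (t, 0) δ := fun z hz => by
        rw [mem_closedBall_iff_norm, Prod.norm_def]
        exact max_le hz.1 (by simpa using hz.2)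
      exact (isCompact_closedBall _ _).of_isClosed_subset hcl hsub
    refine ContinuousOn.integrableOn_compact hBc ?_
    have h1 : ContinuousOn (fun z : ℝ × ℝ => Real.exp (2 * ψ (z.1 - t) z.2)) B := by
      refine Real.continuous_exp.comp_continuousOn (continuousOn_const.mul ?_)
      exact hcont.comp (f := fun z : ℝ × ℝ => (z.1 - t, z.2)) (by fun_prop)
        fun z hz => ⟨hz.1.trans hδδ₀, hz.2.trans hδδ₀⟩
    refine (h1.pow m).congr fun z hz => ?_
    have := (hFψ (z.1 - t) z.2 (hz.1.trans hδδ₀) (hz.2.trans hδδ₀)).2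
    rw [add_sub_cancel] at this
    change F z ^ m = Real.exp (2 * ψ (z.1 - t) z.2) ^ m
    rw [← this]
  have hsplit : ∫ z in S, F z ^ m = (∫ z in B, F z ^ m) + ∫ z in S \ B, F z ^ m := by
    rw [← setIntegral_union Set.disjoint_sdiff_right (hS.diff hBm) hFmB hFmd,
      Set.union_sdiff_cancel hBS]
  have htl : |∫ z in S \ B, F z ^ m| ≤ C' * ε ^ (1 + w + (L + 1)) * ∫ z in S, F z := by
    have h0 : 0 ≤ ∫ z in S \ B, F z ^ m :=
      setIntegral_nonneg (hS.diff hBm) fun z hz => pow_nonneg (hF0 z hz.1) _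
    have hFS : 0 ≤ ∫ z in S, F z := setIntegral_nonneg hS hF0
    rw [abs_of_nonneg h0]
    calc _ ≤ ∫ z in S \ B, ρ ^ (m - 1) * F z :=
          setIntegral_mono_on hFmd hFd (hS.diff hBm) hle
      _ = ρ ^ (m - 1) * ∫ z in S \ B, F z := integral_const_mul _ _
      _ ≤ ρ ^ (m - 1) * ∫ z in S, F z := by
          refine mul_le_mul_of_nonneg_left ?_ (by positivity)
          exact setIntegral_mono_set hFint ((ae_restrict_mem hS).mono hF0)
            (Set.sdiff_subset.eventuallyLE)
      _ ≤ _ := by gcongr; exact hC' m hm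
  have hmain := hC ε hεpos (laplaceScale_le_one hm)
  rw [← hbox] at hmain
  rw [hsplit]
  calc _ = |((∫ z in B, F z ^ m) - ε ^ (1 + w) *
        ∑ j ∈ Finset.range (L + 1), laplaceCoeff I c p q w a b L j * ε ^ j)
          + ∫ z in S \ B, F z ^ m| := by congr 1; ring
    _ ≤ _ := (abs_add_le _ _).trans (add_le_add hmain htl)
    _ = _ := by ring

end

/-! ### Taylor expansion in two variables -/

/-- Two-sided Taylor estimate at `0` for a function `g 0` with successive derivatives `g 1, …`. -/
lemma abs_sub_taylor_le {δ C : ℝ} (K : ℕ) (g : ℕ → ℝ → ℝ)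
    (hg : ∀ q ≤ K, ∀ u, |u| ≤ δ → HasDerivAt (g q) (g (q + 1) u) u)
    (hC : ∀ u, |u| ≤ δ → |g (K + 1) u| ≤ C) (u : ℝ) (hu : |u| ≤ δ) :
    |g 0 u - ∑ q ∈ Finset.range (K + 1), g q 0 / q ! * u ^ q| ≤ C * |u| ^ (K + 1) := by
  have hδ : 0 ≤ δ := (abs_nonneg u).trans hu
  have hC0 : 0 ≤ C := (abs_nonneg _).trans (hC 0 (by simpa using hδ))
  have hseg : ∀ x ∈ Set.uIcc 0 u, |x| ≤ |u| := fun x hx => by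
    simpa using Set.abs_sub_left_of_mem_uIcc hx
  induction K generalizing g u with
  | zero =>
    have h := (convex_uIcc (0 : ℝ) u).norm_image_sub_le_of_norm_hasDerivWithin_le (f := g 0)
      (f' := g 1) (C := C) (x := 0) (y := u)
      (fun x hx => (hg 0 le_rfl x ((hseg x hx).trans hu)).hasDerivWithinAt)
      (fun x hx => hC x ((hseg x hx).trans hu)) Set.left_mem_uIcc Set.right_mem_uIcc
    simpa using h
  | succ K ih =>
    set h : ℝ → ℝ := fun x => g 0 x - ∑ q ∈ Finset.range (K + 2), g q 0 / q ! * x ^ q with hh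
    set h' : ℝ → ℝ := fun x => g 1 x - ∑ q ∈ Finset.range (K + 1), g (q + 1) 0 / q ! * x ^ q with hh'
    have hd : ∀ x, |x| ≤ δ → HasDerivAt h (h' x) x := by
      intro x hx
      refine (hg 0 (Nat.zero_le _) x hx).sub ?_
      have : HasDerivAt (fun x => ∑ q ∈ Finset.range (K + 2), g q 0 / q ! * x ^ q)
          (∑ q ∈ Finset.range (K + 2), g q 0 / q ! * (q * x ^ (q - 1))) x :=
        HasDerivAt.fun_sum fun q _ => (hasDerivAt_pow q x).const_mul _
      refine this.congr_deriv ?_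
      rw [Finset.sum_range_succ' _ (K + 1)]
      simp only [Nat.cast_zero, zero_mul, mul_zero, add_zero, Nat.add_sub_cancel]
      refine Finset.sum_congr rfl fun q _ => ?_
      rw [Nat.factorial_succ]
      push_cast
      have h1 : ((q : ℝ) + 1) ≠ 0 := by positivity
      have h2 : (q ! : ℝ) ≠ 0 := by positivity
      field_simp
    have hb : ∀ x ∈ Set.uIcc 0 u, ‖h' x‖ ≤ C * |u| ^ (K + 1) := by
      intro x hx
      have hxu := hseg x hx
      have := ih (fun q => g (q + 1)) (fun q hq v hv => hg (q + 1) (by omega) v hv)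
        (fun v hv => hC v hv) x (hxu.trans hu) (fun y hy => by
          simpa using Set.abs_sub_left_of_mem_uIcc hy)
      refine this.trans ?_
      gcongr
    have := (convex_uIcc (0 : ℝ) u).norm_image_sub_le_of_norm_hasDerivWithin_le (f := h)
      (f' := h') (x := 0) (y := u)
      (fun x hx => (hd x ((hseg x hx).trans hu)).hasDerivWithinAt) hb
      Set.left_mem_uIcc Set.right_mem_uIcc
    have h0 : h 0 = 0 := by
      simp [hh, Finset.sum_range_succ' _ (K + 1)]
    rw [h0, sub_zero, sub_zero, Real.norm_eq_abs, Real.norm_eq_abs] at this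
    calc _ ≤ _ := this
      _ = _ := by rw [pow_succ _ (K + 1)]; ring

lemma contDiffOn_iteratedDeriv {f : ℝ → ℝ} {V : Set ℝ} (hV : IsOpen V) (hf : ContDiffOn ℝ ∞ f V)
    (p : ℕ) : ContDiffOn ℝ ∞ (iteratedDeriv p f) V := by
  induction p with
  | zero => simpa using hf
  | succ p ih => rw [iteratedDeriv_succ]; exact ih.deriv_of_isOpen hV (by simp)

lemma hasDerivAt_iteratedDeriv {f : ℝ → ℝ} {V : Set ℝ} (hV : IsOpen V) (hf : ContDiffOn ℝ ∞ f V)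
    (p : ℕ) {x : ℝ} (hx : x ∈ V) : HasDerivAt (iteratedDeriv p f) (iteratedDeriv (p + 1) f x) x := by
  rw [iteratedDeriv_succ]
  exact (((contDiffOn_iteratedDeriv hV hf p).differentiableOn (by simp) x hx).differentiableAt
    (hV.mem_nhds hx)).hasDerivAt

/-- All iterated partial derivatives in the second variable of a smooth function of two variables
are jointly smooth. -/
lemma contDiffOn_iteratedDeriv_snd {f : ℝ → ℝ → ℝ} {U : Set (ℝ × ℝ)} (hU : IsOpen U)
    (hf : ContDiffOn ℝ ∞ (fun z : ℝ × ℝ => f z.1 z.2) U) (q : ℕ) :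
    ContDiffOn ℝ ∞ (fun z : ℝ × ℝ => iteratedDeriv q (f z.1) z.2) U := by
  induction q with
  | zero => simpa using hf
  | succ q ih =>
    have h1 : ContDiffOn ℝ ∞ (fun z => fderiv ℝ (fun z : ℝ × ℝ => iteratedDeriv q (f z.1) z.2) z
        ((0, 1) : ℝ × ℝ)) U :=
      (ih.fderiv_of_isOpen hU (by simp)).clm_apply contDiffOn_const
    refine h1.congr fun z hz => ?_
    have h2 : HasFDerivAt (fun z : ℝ × ℝ => iteratedDeriv q (f z.1) z.2) _ z :=
      ((ih.differentiableOn (by simp) z hz).differentiableAt (hU.mem_nhds hz)).hasFDerivAt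
    have h3 : HasDerivAt (fun u : ℝ => (z.1, u)) ((0, 1) : ℝ × ℝ) z.2 :=
      (hasDerivAt_const _ _).prodMk (hasDerivAt_id _)
    have h4 := HasFDerivAt.comp_hasDerivAt (f := fun u : ℝ => (z.1, u)) z.2 h2 h3
    rw [iteratedDeriv_succ]
    exact h4.deriv

/-- Taylor expansion in two variables, with coefficients the iterated partial derivatives. The
remainder `|s| ^ (K + 1) + |u| ^ (K + 1)` is uniform on the box. -/
theorem exists_taylor_two {f : ℝ → ℝ → ℝ} {U : Set (ℝ × ℝ)} (hU : IsOpen U)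
    (hf : ContDiffOn ℝ ∞ (fun z : ℝ × ℝ => f z.1 z.2) U) {t δ : ℝ} (hδ : 0 < δ) (hδ1 : δ ≤ 1)
    (hbox : ∀ s u, |s| ≤ δ → |u| ≤ δ → (t + s, u) ∈ U) (K : ℕ) :
    ∃ C, 0 ≤ C ∧ ∀ s u, |s| ≤ δ → |u| ≤ δ →
      |f (t + s) u - ∑ i ∈ Finset.range (K + 1) ×ˢ Finset.range (K + 1),
        iteratedDeriv i.1 (fun s => iteratedDeriv i.2 (f s) 0) t / (i.1 ! * i.2 !)
          * s ^ i.1 * u ^ i.2| ≤ C * (|s| ^ (K + 1) + |u| ^ (K + 1)) := by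
  -- expansion in `u`, uniformly in `s`
  obtain ⟨C₁, hC₁⟩ : ∃ C, ∀ z ∈ box δ, ‖iteratedDeriv (K + 1) (f (t + z.1)) z.2‖ ≤ C := by
    refine (isCompact_box δ).exists_bound_of_continuousOn ?_
    exact (contDiffOn_iteratedDeriv_snd hU hf (K + 1)).continuousOn.comp
      (f := fun z : ℝ × ℝ => (t + z.1, z.2)) (by fun_prop) fun z hz => hbox _ _ hz.1 hz.2
  have h1 : ∀ s u, |s| ≤ δ → |u| ≤ δ →
      |f (t + s) u - ∑ q ∈ Finset.range (K + 1), iteratedDeriv q (f (t + s)) 0 / q ! * u ^ q|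
        ≤ C₁ * |u| ^ (K + 1) := by
    intro s u hs hu
    have := abs_sub_taylor_le (δ := δ) (C := C₁) K (fun q => iteratedDeriv q (f (t + s))) ?_
      (fun v hv => hC₁ (s, v) ⟨hs, hv⟩) u hu
    · simpa using this
    · intro q _ v hv
      have hV : IsOpen {v : ℝ | (t + s, v) ∈ U} := hU.preimage (by fun_prop)
      refine hasDerivAt_iteratedDeriv hV ?_ q (hbox s v hs hv)
      exact hf.comp (f := fun v : ℝ => (t + s, v)) (by fun_prop) fun v hv => hv
  -- expansion of the coefficients in `s`
  have hV : IsOpen {s : ℝ | (s, (0 : ℝ)) ∈ U} := hU.preimage (by fun_prop)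
  have hsm : ∀ q, ContDiffOn ℝ ∞ (fun s => iteratedDeriv q (f s) 0) {s : ℝ | (s, (0 : ℝ)) ∈ U} :=
    fun q => (contDiffOn_iteratedDeriv_snd hU hf q).comp (f := fun s : ℝ => (s, (0 : ℝ)))
      (by fun_prop) fun v hv => hv
  have h2 : ∀ q, ∃ C, 0 ≤ C ∧ ∀ s, |s| ≤ δ → |iteratedDeriv q (f (t + s)) 0
      - ∑ p ∈ Finset.range (K + 1),
        iteratedDeriv p (fun s => iteratedDeriv q (f s) 0) t / p ! * s ^ p|
      ≤ C * |s| ^ (K + 1) := by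
    intro q
    obtain ⟨C, hC⟩ : ∃ C, ∀ s ∈ Set.Icc (-δ) δ,
        ‖iteratedDeriv (K + 1) (fun s => iteratedDeriv q (f s) 0) (t + s)‖ ≤ C := by
      refine isCompact_Icc.exists_bound_of_continuousOn ?_
      exact (contDiffOn_iteratedDeriv hV (hsm q) (K + 1)).continuousOn.comp
        (f := fun s : ℝ => t + s) (by fun_prop)
        fun s hs => hbox s 0 (abs_le.2 hs) (by simpa using hδ.le)
    refine ⟨C, (norm_nonneg _).trans (hC 0 ⟨by linarith, hδ.le⟩), fun s hs => ?_⟩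
    have := abs_sub_taylor_le (δ := δ) (C := C) K
      (fun p s => iteratedDeriv p (fun s => iteratedDeriv q (f s) 0) (t + s)) ?_
      (fun v hv => hC v (abs_le.1 hv)) s hs
    · simpa using this
    · intro p _ v hv
      have h := hasDerivAt_iteratedDeriv hV (hsm q) p (hbox v 0 hv (by simpa using hδ.le))
      exact h.comp_const_add t v
  choose C₂ hC₂0 hC₂ using h2
  have hC₁0 : 0 ≤ C₁ := (norm_nonneg _).trans (hC₁ (0, 0) (by simp [box, hδ.le]))
  refine ⟨C₁ + ∑ q ∈ Finset.range (K + 1), C₂ q, by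
    have := Finset.sum_nonneg fun q (_ : q ∈ Finset.range (K + 1)) => hC₂0 q
    positivity, fun s u hs hu => ?_⟩
  have h3 : |∑ q ∈ Finset.range (K + 1), iteratedDeriv q (f (t + s)) 0 / q ! * u ^ q
      - ∑ i ∈ Finset.range (K + 1) ×ˢ Finset.range (K + 1),
        iteratedDeriv i.1 (fun s => iteratedDeriv i.2 (f s) 0) t / (i.1 ! * i.2 !)
          * s ^ i.1 * u ^ i.2| ≤ (∑ q ∈ Finset.range (K + 1), C₂ q) * |s| ^ (K + 1) := by
    rw [Finset.sum_product_right, ← Finset.sum_sub_distrib, Finset.sum_mul]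
    refine (Finset.abs_sum_le_sum_abs _ _).trans (Finset.sum_le_sum fun q _ => ?_)
    have e : iteratedDeriv q (f (t + s)) 0 / q ! * u ^ q
        - ∑ p ∈ Finset.range (K + 1), iteratedDeriv p (fun s => iteratedDeriv q (f s) 0) t
            / (p ! * q !) * s ^ p * u ^ q
        = (iteratedDeriv q (f (t + s)) 0 - ∑ p ∈ Finset.range (K + 1),
          iteratedDeriv p (fun s => iteratedDeriv q (f s) 0) t / p ! * s ^ p) * (u ^ q / q !) := by
      rw [sub_mul, Finset.sum_mul]
      congr 1
      · ring
      · refine Finset.sum_congr rfl fun p _ => ?_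
        field_simp
    rw [e, abs_mul]
    have hle : |u ^ q / q !| ≤ 1 := by
      rw [abs_div, abs_pow, Nat.abs_cast]
      have h1 : |u| ^ q ≤ 1 := pow_le_one₀ (abs_nonneg _) (hu.trans hδ1)
      have h2 : (1 : ℝ) ≤ q ! := by exact_mod_cast Nat.factorial_pos q
      rw [div_le_one (by positivity)]
      linarith
    calc _ ≤ (C₂ q * |s| ^ (K + 1)) * 1 := by
          have := hC₂ q s hs
          have h0 := hC₂0 q
          gcongr
      _ = _ := mul_one _
  have h4 : 0 ≤ ∑ q ∈ Finset.range (K + 1), C₂ q := Finset.sum_nonneg fun q _ => hC₂0 q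
  calc _ ≤ _ := abs_sub_le _ _ _
    _ ≤ _ := add_le_add (h1 s u hs hu) h3
    _ ≤ _ := by
      have e1 : 0 ≤ |s| ^ (K + 1) := by positivity
      have e2 : 0 ≤ |u| ^ (K + 1) := by positivity
      nlinarith [mul_nonneg hC₁0 e1, mul_nonneg h4 e2]

/-! ### Spin sums as integrals over the strip -/

/-- The sign with which a spin enters `halfDifference`. -/
def halfSign (m : ℕ) (j : Fin (2 * m)) : ℤ := if j.val < m then 1 else -1

lemma halfDifference_eq {m : ℕ} (σ : Fin (2 * m) → ℤˣ) :
    halfDifference σ = ∑ j, halfSign m j * (σ j : ℤ) := by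
  have h : 2 * m / 2 = m := by omega
  rw [halfDifference, h, Finset.sum_filter, Finset.sum_filter, ← Finset.sum_sub_distrib]
  refine Finset.sum_congr rfl fun j _ => ?_
  rw [halfSign]
  by_cases hj : j.val < m
  · simp [hj]
  · simp [hj, not_lt.1 hj]

lemma even_halfDifference {m : ℕ} (σ : Fin (2 * m) → ℤˣ) : Even (halfDifference σ) := by
  rw [halfDifference_eq, ← ZMod.intCast_eq_zero_iff_even, Int.cast_sum]
  have : ∀ j, ((halfSign m j * (σ j : ℤ) : ℤ) : ZMod 2) = 1 := fun j => by
    rw [halfSign]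
    rcases Int.units_eq_one_or (σ j) with h | h <;> rw [h] <;> split_ifs <;> simp
  simp only [this, Finset.sum_const, Finset.card_univ, Fintype.card_fin, nsmul_eq_mul, mul_one]
  push_cast
  have : (2 : ZMod 2) = 0 := rfl
  rw [this, zero_mul]

/-- Expansion over spin configurations: each factor `4 (cosh (2t) / 2 + cos u / 2)` is the product
of `2 cosh (t + iu / 2)` and `2 cosh (t - iu / 2)`, one for each half of the spins. -/
lemma pow_eq_sum_spins (m : ℕ) (t u : ℝ) :
    4 ^ m * (1 / 2 * Real.cosh (2 * t) + 1 / 2 * Real.cos u) ^ m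
      = ∑ σ : Fin (2 * m) → ℤˣ, Real.exp (t * totalSpin σ) * Real.cos (halfDifference σ / 2 * u) := by
  set θ : Fin (2 * m) → ℂ := fun j => t + halfSign m j * (u / 2 * Complex.I) with hθ
  have h1 : ∏ j : Fin (2 * m), ∑ e : ℤˣ, Complex.exp ((e : ℤ) * θ j)
      = ∑ σ : Fin (2 * m) → ℤˣ, ∏ j, Complex.exp ((σ j : ℤ) * θ j) := by
    rw [Finset.prod_univ_sum, Fintype.piFinset_univ]
  have h2 : ∀ σ : Fin (2 * m) → ℤˣ, ∏ j, Complex.exp ((σ j : ℤ) * θ j)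
      = Complex.exp ((t * totalSpin σ : ℝ) + (halfDifference σ / 2 * u : ℝ) * Complex.I) := by
    intro σ
    rw [← Complex.exp_sum, halfDifference_eq, totalSpin]
    congr 1
    push_cast
    rw [Finset.mul_sum, Finset.sum_div, Finset.sum_mul, Finset.sum_mul, ← Finset.sum_add_distrib]
    refine Finset.sum_congr rfl fun j _ => ?_
    rw [hθ]; ring
  have h3 : ∏ j : Fin (2 * m), ∑ e : ℤˣ, Complex.exp ((e : ℤ) * θ j)
      = ((4 ^ m * (1 / 2 * Real.cosh (2 * t) + 1 / 2 * Real.cos u) ^ m : ℝ) : ℂ) := by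
    have hsum : ∀ z : ℂ, ∑ e : ℤˣ, Complex.exp ((e : ℤ) * z) = 2 * Complex.cosh z := by
      intro z
      have : (Finset.univ : Finset ℤˣ) = {1, -1} := rfl
      rw [this, Finset.sum_insert (by decide), Finset.sum_singleton, Complex.two_cosh]
      simp
    simp_rw [hsum]
    have hfac : ∀ j : Fin (2 * m), 2 * Complex.cosh (θ j)
        = if j.val < m then 2 * Complex.cosh (t + u / 2 * Complex.I)
          else 2 * Complex.cosh (t - u / 2 * Complex.I) := by
      intro j
      rw [hθ]
      simp only [halfSign]
      split_ifs
      · simp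
      · simp only [Int.reduceNeg, Int.cast_neg, Int.cast_one]; ring_nf
    simp_rw [hfac]
    rw [Finset.prod_ite, Finset.prod_const, Finset.prod_const]
    have hc1 : (Finset.univ.filter fun j : Fin (2 * m) => j.val < m).card = m := by
      rw [Fin.card_filter_val_lt]; omega
    have hc2 : (Finset.univ.filter fun j : Fin (2 * m) => ¬ j.val < m).card = m := by
      have := Finset.card_filter_add_card_filter_not (s := Finset.univ)
        (fun j : Fin (2 * m) => j.val < m)
      rw [hc1, Finset.card_univ, Fintype.card_fin] at this
      omega
    rw [hc1, hc2, ← mul_pow]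
    push_cast
    rw [← mul_pow]
    congr 1
    have key : ∀ A B : ℂ, 2 * Complex.cosh A * (2 * Complex.cosh B)
        = 2 * Complex.cosh (A + B) + 2 * Complex.cosh (A - B) := fun A B => by
      rw [Complex.cosh_add, Complex.cosh_sub]; ring
    have e1 : (t + u / 2 * Complex.I : ℂ) + (t - u / 2 * Complex.I) = 2 * t := by ring
    have e2 : (t + u / 2 * Complex.I : ℂ) - (t - u / 2 * Complex.I) = u * Complex.I := by ring
    rw [key, e1, e2, Complex.cosh_mul_I]
    ring
  have h4 := congrArg Complex.re (h3.symm.trans h1)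
  rw [Complex.ofReal_re, Complex.re_sum] at h4
  rw [h4]
  refine Finset.sum_congr rfl fun σ _ => ?_
  rw [h2, Complex.exp_re]
  simp

lemma integral_cos_halfDifference {m : ℕ} (σ : Fin (2 * m) → ℤˣ) :
    ∫ u in Set.Icc (-Real.pi) Real.pi, Real.cos (halfDifference σ / 2 * u)
      = if halfDifference σ = 0 then 2 * Real.pi else 0 := by
  obtain ⟨k, hk⟩ := even_halfDifference σ
  have e : (halfDifference σ : ℝ) / 2 = k := by rw [hk]; push_cast; ring
  rw [integral_Icc_eq_integral_Ioc, ← intervalIntegral.integral_of_le (by linarith [Real.pi_pos]), e]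
  have h0 : halfDifference σ = 0 ↔ k = 0 := by omega
  rw [if_congr h0 rfl rfl]
  split_ifs with h
  · simp [h]; ring
  · have hk' : (k : ℝ) ≠ 0 := by exact_mod_cast h
    rw [intervalIntegral.integral_comp_mul_left (fun x => Real.cos x) hk', integral_cos, mul_neg,
      Real.sin_neg, Real.sin_int_mul_pi]
    simp

/-- Integration over `u` selects the balanced configurations. -/
lemma integral_Icc_pow_eq (m : ℕ) (t : ℝ) :
    4 ^ m * ∫ u in Set.Icc (-Real.pi) Real.pi, (1 / 2 * Real.cosh (2 * t) + 1 / 2 * Real.cos u) ^ m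
      = 2 * Real.pi * ∑ σ : Fin (2 * m) → ℤˣ with halfDifference σ = 0,
          Real.exp (t * totalSpin σ) := by
  rw [← integral_const_mul]
  simp_rw [pow_eq_sum_spins]
  rw [integral_finsetSum _ fun σ _ => (Continuous.integrableOn_Icc (by fun_prop))]
  simp_rw [integral_const_mul, integral_cos_halfDifference]
  rw [Finset.sum_filter, Finset.mul_sum]
  refine Finset.sum_congr rfl fun σ _ => ?_
  split_ifs <;> ring

lemma balancedSum_neg (d : ℕ) (β h : ℝ) (n : ℕ) : balancedSum d β (-h) n = balancedSum d β h n := by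
  have ht : ∀ σ : Fin n → ℤˣ, totalSpin (-σ) = -totalSpin σ := fun σ => by simp [totalSpin]
  have hd : ∀ σ : Fin n → ℤˣ, halfDifference (-σ) = -halfDifference σ := fun σ => by
    simp [halfDifference]; ring
  rw [balancedSum, balancedSum, Finset.sum_filter, Finset.sum_filter,
    ← Equiv.sum_comp (Equiv.neg (Fin n → ℤˣ))]
  refine Finset.sum_congr rfl fun σ _ => ?_
  simp only [Equiv.neg_apply, ht, hd, neg_eq_zero]
  push_cast
  simp

lemma balancedSum_abs (d : ℕ) (β h : ℝ) (n : ℕ) : balancedSum d β |h| n = balancedSum d β h n := by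
  rcases abs_choice h with e | e <;> rw [e]
  exact balancedSum_neg d β h n

/-- The strip `ℝ × [-π, π]`. -/
def strip : Set (ℝ × ℝ) := Set.univ ×ˢ Set.Icc (-Real.pi) Real.pi

lemma measurableSet_strip : MeasurableSet strip := MeasurableSet.univ.prod measurableSet_Icc

/-- The density whose powers represent the partition function; `κ = 2 d β`. -/
noncomputable def density (κ H : ℝ) (z : ℝ × ℝ) : ℝ :=
  (1 / 2 * Real.cosh (2 * z.1) + 1 / 2 * Real.cos z.2) * Real.exp (-(z.1 - H) ^ 2 / κ)

lemma continuous_density (κ H : ℝ) : Continuous (density κ H) := by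
  unfold density; fun_prop

lemma density_nonneg (κ H : ℝ) (z : ℝ × ℝ) : 0 ≤ density κ H z := by
  have h1 := Real.one_le_cosh (2 * z.1)
  have h2 := Real.neg_one_le_cos z.2
  exact mul_nonneg (by linarith) (Real.exp_pos _).le

lemma integral_exp_tilted_gaussian {A : ℝ} (hA : 0 < A) (H S : ℝ) :
    Integrable (fun t : ℝ => Real.exp (t * S) * Real.exp (-A * (t - H) ^ 2)) ∧
    ∫ t : ℝ, Real.exp (t * S) * Real.exp (-A * (t - H) ^ 2)
      = √(Real.pi / A) * Real.exp (S ^ 2 / (4 * A) + H * S) := by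
  have e : (fun t : ℝ => Real.exp (t * S) * Real.exp (-A * (t - H) ^ 2))
      = fun t => Real.exp (-A * (t - (H + S / (2 * A))) ^ 2) * Real.exp (S ^ 2 / (4 * A) + H * S) := by
    funext t
    rw [← Real.exp_add, ← Real.exp_add]
    congr 1
    field_simp
    ring
  rw [e]
  refine ⟨((integrable_exp_neg_mul_sq hA).comp_sub_right _).mul_const _, ?_⟩
  rw [integral_mul_const,
    integral_sub_right_eq_self (fun t : ℝ => Real.exp (-A * t ^ 2)) (H + S / (2 * A)),
    integral_gaussian]

lemma volume_restrict_strip : (volume : Measure (ℝ × ℝ)).restrict strip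
    = (volume : Measure ℝ).prod (volume.restrict (Set.Icc (-Real.pi) Real.pi)) := by
  rw [strip, Measure.volume_eq_prod, ← Measure.prod_restrict, Measure.restrict_univ]

/-- The Hubbard–Stratonovich representation, with a Fourier integral for the balance condition. -/
lemma integral_density_pow {d : ℕ} {β H : ℝ} {m : ℕ} (hκ : 0 < 2 * d * β) (hm : 1 ≤ m) :
    IntegrableOn (fun z => density (2 * d * β) H z ^ m) strip ∧
    4 ^ m * ∫ z in strip, density (2 * d * β) H z ^ m
      = 2 * Real.pi * √(2 * d * β * Real.pi / m) * balancedSum d β H (2 * m) := by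
  set κ := 2 * d * β with hκdef
  have hm0 : (0 : ℝ) < m := by exact_mod_cast hm
  have hA : 0 < m / κ := by positivity
  have e : ∀ z : ℝ × ℝ, 4 ^ m * density κ H z ^ m = ∑ σ : Fin (2 * m) → ℤˣ,
      (Real.exp (z.1 * totalSpin σ) * Real.exp (-(m / κ) * (z.1 - H) ^ 2))
        * Real.cos (halfDifference σ / 2 * z.2) := by
    intro z
    rw [density, mul_pow, ← mul_assoc, pow_eq_sum_spins, ← Real.exp_nat_mul, Finset.sum_mul]
    refine Finset.sum_congr rfl fun σ _ => ?_
    have : (m : ℝ) * (-(z.1 - H) ^ 2 / κ) = -(m / κ) * (z.1 - H) ^ 2 := by ring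
    rw [this]; ring
  have hint : ∀ σ : Fin (2 * m) → ℤˣ, Integrable (fun z : ℝ × ℝ =>
      (Real.exp (z.1 * totalSpin σ) * Real.exp (-(m / κ) * (z.1 - H) ^ 2))
        * Real.cos (halfDifference σ / 2 * z.2))
      ((volume : Measure ℝ).prod (volume.restrict (Set.Icc (-Real.pi) Real.pi))) := fun σ =>
    (integral_exp_tilted_gaussian hA H (totalSpin σ)).1.mul_prod
      (f := fun t : ℝ => Real.exp (t * totalSpin σ) * Real.exp (-(m / κ) * (t - H) ^ 2))
      (g := fun u : ℝ => Real.cos (halfDifference σ / 2 * u))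
      (Continuous.integrableOn_Icc (by fun_prop))
  have hint4 : IntegrableOn (fun z => 4 ^ m * density κ H z ^ m) strip := by
    rw [IntegrableOn, volume_restrict_strip]
    simp_rw [e]
    exact integrable_finsetSum _ fun σ _ => hint σ
  constructor
  · have := hint4.const_mul ((4 ^ m : ℝ)⁻¹)
    refine this.congr (ae_of_all _ fun z => ?_)
    change (4 ^ m : ℝ)⁻¹ * (4 ^ m * density κ H z ^ m) = _
    rw [inv_mul_cancel_left₀ (by positivity)]
  · rw [← integral_const_mul, volume_restrict_strip]
    simp_rw [e]
    rw [integral_finsetSum _ fun σ _ => hint σ, balancedSum, Finset.sum_filter, Finset.mul_sum]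
    refine Finset.sum_congr rfl fun σ _ => ?_
    rw [integral_prod_mul (fun t : ℝ => Real.exp (t * totalSpin σ) * Real.exp (-(m / κ) * (t - H) ^ 2))
      (fun u : ℝ => Real.cos (halfDifference σ / 2 * u)), integral_cos_halfDifference,
      (integral_exp_tilted_gaussian hA H (totalSpin σ)).2]
    have e1 : Real.pi / (m / κ) = κ * Real.pi / m := by field_simp
    have e2 : (totalSpin σ : ℝ) ^ 2 / (4 * (m / κ))
        = d * β / ((2 * m : ℕ) : ℝ) * (totalSpin σ : ℝ) ^ 2 := by
      rw [hκdef] at hκ ⊢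
      push_cast
      field_simp
      ring
    rw [e1, e2]
    split_ifs <;> ring

/-! ### The mean-field equation and the maximum of `φ` -/

lemma hasDerivAt_tanh (x : ℝ) : HasDerivAt Real.tanh (1 / Real.cosh x ^ 2) x := by
  have e : Real.tanh = fun y => Real.sinh y / Real.cosh y := funext Real.tanh_eq_sinh_div_cosh
  rw [e]
  refine ((Real.hasDerivAt_sinh x).div (Real.hasDerivAt_cosh x) (Real.cosh_pos x).ne').congr_deriv ?_
  have := Real.cosh_sq_sub_sinh_sq x
  congr 1
  linarith

lemma div_cosh_sq_lt_tanh {x : ℝ} (hx : 0 < x) : x / Real.cosh x ^ 2 < Real.tanh x := by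
  have h := Real.self_lt_sinh_iff.2 (show 0 < 2 * x by linarith)
  rw [Real.sinh_two_mul] at h
  have hc := Real.cosh_pos x
  rw [Real.tanh_eq_sinh_div_cosh, div_lt_div_iff₀ (by positivity) hc]
  nlinarith

/-- `tanh x / x` is strictly decreasing for `x > 0`. -/
lemma tanh_mul_lt_tanh_mul {s t : ℝ} (hs : 0 < s) (hst : s < t) :
    Real.tanh t * s < Real.tanh s * t := by
  have hd : ∀ x ∈ Set.Ioi (0 : ℝ), HasDerivAt (fun x => Real.tanh x / x)
      ((1 / Real.cosh x ^ 2 * x - Real.tanh x * 1) / x ^ 2) x := fun x hx =>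
    (hasDerivAt_tanh x).div (hasDerivAt_id x) (ne_of_gt hx)
  have hanti : StrictAntiOn (fun x => Real.tanh x / x) (Set.Ioi 0) := by
    refine strictAntiOn_of_deriv_neg (convex_Ioi 0)
      (fun x hx => (hd x hx).continuousAt.continuousWithinAt) fun x hx => ?_
    rw [interior_Ioi] at hx
    rw [(hd x hx).deriv]
    have hx' : 0 < x := hx
    refine div_neg_of_neg_of_pos ?_ (by positivity)
    have := div_cosh_sq_lt_tanh hx'
    rw [mul_one, one_div_mul_eq_div]
    linarith
  have h := hanti hs (hs.trans hst) hst
  simp only [] at h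
  rwa [div_lt_div_iff₀ (hs.trans hst) hs] at h

lemma tanh_pos {x : ℝ} (hx : 0 < x) : 0 < Real.tanh x := by
  rw [Real.tanh_eq_sinh_div_cosh]
  exact div_pos (Real.sinh_pos_iff.2 hx) (Real.cosh_pos x)

/-- The mean-field equation has a largest solution; it gives a positive zero `κ z + H` of `φ'`. -/
lemma exists_isGreatest_meanField {κ H : ℝ} (hκ : 0 ≤ κ) (hH : 0 ≤ H) (h : 0 < H ∨ 1 < κ) :
    ∃ z, IsGreatest {x : ℝ | Real.tanh (κ * x + H) = x} z ∧ 0 < κ * z + H := by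
  obtain ⟨x₀, hx₀0, hx₀⟩ : ∃ x, 0 ≤ x ∧ x < Real.tanh (κ * x + H) := by
    rcases h with h | h
    · exact ⟨0, le_rfl, by simpa using tanh_pos h⟩
    · rcases hH.eq_or_lt with h0 | h0
      · have hcont : ContinuousAt (fun x : ℝ => Real.cosh (κ * x) ^ 2) 0 := by fun_prop
        have hev : ∀ᶠ x in nhdsWithin (0 : ℝ) (Set.Ioi 0), Real.cosh (κ * x) ^ 2 < κ :=
          (hcont.eventually_lt_const (by simpa using h)).filter_mono nhdsWithin_le_nhds
        obtain ⟨x, hx, hx0⟩ := (hev.and self_mem_nhdsWithin).exists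
        have hx0' : 0 < x := hx0
        refine ⟨x, hx0'.le, ?_⟩
        have h1 := div_cosh_sq_lt_tanh (show 0 < κ * x by positivity)
        rw [← h0, add_zero]
        refine lt_of_le_of_lt ?_ h1
        rw [le_div_iff₀ (by have := Real.cosh_pos (κ * x); positivity)]
        nlinarith
      · exact ⟨0, le_rfl, by simpa using tanh_pos h0⟩
  have hx₀1 : x₀ ≤ 1 := (hx₀.trans (Real.tanh_lt_one _)).le
  have hcont : Continuous fun x : ℝ => x - Real.tanh (κ * x + H) :=
    continuous_id.sub ((continuous_iff_continuousAt.2 fun x => (hasDerivAt_tanh x).continuousAt).comp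
      (by fun_prop))
  obtain ⟨z, hz, hz0⟩ : (0 : ℝ) ∈ (fun x : ℝ => x - Real.tanh (κ * x + H)) '' Set.Icc x₀ 1 :=
    intermediate_value_Icc hx₀1 hcont.continuousOn
      ⟨by linarith, by have := Real.tanh_lt_one (κ * 1 + H); linarith⟩
  have hzeq : Real.tanh (κ * z + H) = z := by simp only [] at hz0; linarith
  have hzx : x₀ < z := lt_of_le_of_ne hz.1 fun e => by rw [e, hzeq] at hx₀; exact lt_irrefl _ hx₀
  have hzpos : 0 < z := hx₀0.trans_lt hzx
  have htpos : 0 < κ * z + H := by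
    rcases h with h | h
    · positivity
    · have : 0 < κ := by linarith
      positivity
  refine ⟨z, ⟨hzeq, fun x hx => ?_⟩, htpos⟩
  by_contra! hlt
  have hx' : Real.tanh (κ * x + H) = x := hx
  rcases hκ.eq_or_lt with h0 | h0
  · rw [← h0] at hx' hzeq
    simp only [zero_mul] at hx' hzeq
    linarith
  · have := tanh_mul_lt_tanh_mul htpos (show κ * z + H < κ * x + H by gcongr)
    rw [hx', hzeq] at this
    nlinarith

lemma continuous_phi (d : ℕ) (β h : ℝ) : Continuous (phi d β h) := by
  unfold phi
  refine Continuous.sub (Continuous.log (by fun_prop) fun x => (Real.cosh_pos x).ne') (by fun_prop)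

lemma hasDerivAt_phi (d : ℕ) (β h x : ℝ) :
    HasDerivAt (phi d β h) (Real.tanh x - (x - |h|) / (2 * d * β)) x := by
  have h1 : HasDerivAt (fun t => Real.log (Real.cosh t)) (Real.sinh x / Real.cosh x) x :=
    (Real.hasDerivAt_cosh x).log (Real.cosh_pos x).ne'
  have h2 : HasDerivAt (fun t : ℝ => (t - |h|) ^ 2 / (4 * d * β))
      (((2 : ℕ) : ℝ) * (x - |h|) ^ (2 - 1) * 1 / (4 * d * β)) x :=
    (((hasDerivAt_id x).sub_const |h|).pow 2).div_const _
  refine (h1.sub h2).congr_deriv ?_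
  rw [Real.tanh_eq_sinh_div_cosh]
  congr 1
  rw [show (4 * d * β : ℝ) = 2 * (2 * d * β) by ring]
  rw [Nat.cast_ofNat, mul_one, pow_one, mul_div_mul_left _ _ (by norm_num)]

/-- A positive critical point of `φ` is its unique maximum point on `[0, ∞)`. -/
lemma phi_lt_of_nonneg {d : ℕ} {β h t : ℝ} (hκ : 0 < 2 * d * β) (ht : 0 < t)
    (hcrit : 2 * d * β * Real.tanh t = t - |h|) {s : ℝ} (hs : 0 ≤ s) (hst : s ≠ t) :
    phi d β h s < phi d β h t := by
  have hH := abs_nonneg h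
  rcases lt_or_gt_of_ne hst with hlt | hlt
  · have : StrictMonoOn (phi d β h) (Set.Icc 0 t) := by
      refine strictMonoOn_of_deriv_pos (convex_Icc 0 t) (continuous_phi d β h).continuousOn
        fun x hx => ?_
      rw [interior_Icc] at hx
      rw [(hasDerivAt_phi d β h x).deriv, sub_pos, div_lt_iff₀ hκ]
      have := tanh_mul_lt_tanh_mul hx.1 hx.2
      have h1 : (t - |h|) * x < Real.tanh x * (2 * d * β) * t := by
        rw [← hcrit]; nlinarith
      have h2 : (x - |h|) * t ≤ (t - |h|) * x := by nlinarith [hx.2]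
      exact lt_of_mul_lt_mul_right (h2.trans_lt h1) ht.le
    exact this ⟨hs, hlt.le⟩ ⟨ht.le, le_rfl⟩ hlt
  · have : StrictAntiOn (phi d β h) (Set.Ici t) := by
      refine strictAntiOn_of_deriv_neg (convex_Ici t) (continuous_phi d β h).continuousOn
        fun x hx => ?_
      rw [interior_Ici] at hx
      have hx' : t < x := hx
      rw [(hasDerivAt_phi d β h x).deriv, sub_neg, lt_div_iff₀ hκ]
      have := tanh_mul_lt_tanh_mul ht hx'
      have h1 : Real.tanh x * (2 * d * β) * t < (t - |h|) * x := by
        rw [← hcrit]; nlinarith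
      have h2 : (t - |h|) * x ≤ (x - |h|) * t := by nlinarith
      exact lt_of_mul_lt_mul_right (h1.trans_le h2) ht.le
    exact this Set.self_mem_Ici hlt.le hlt

/-- In a nonzero field the positive critical point of `φ` is its unique maximum point on `ℝ`. -/
lemma phi_lt_of_ne {d : ℕ} {β h t : ℝ} (hκ : 0 < 2 * d * β) (ht : 0 < t) (hh : h ≠ 0)
    (hcrit : 2 * d * β * Real.tanh t = t - |h|) {s : ℝ} (hst : s ≠ t) :
    phi d β h s < phi d β h t := by
  rcases le_or_gt 0 s with hs | hs
  · exact phi_lt_of_nonneg hκ ht hcrit hs hst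
  · have h1 : phi d β h s < phi d β h (-s) := by
      have hH : 0 < |h| := abs_pos.2 hh
      rw [phi, phi, Real.cosh_neg, sub_lt_sub_iff_left]
      refine div_lt_div_of_pos_right ?_ (by linarith)
      nlinarith
    refine h1.trans_le ?_
    by_cases e : -s = t
    · rw [e]
    · exact (phi_lt_of_nonneg hκ ht hcrit (by linarith) e).le

lemma cosh_lt_exp_half_sq {x : ℝ} (hx : x ≠ 0) : Real.cosh x < Real.exp (x ^ 2 / 2) := by
  have h1 : Real.cosh x = 2 * Real.cosh (x / 2) ^ 2 - 1 := by
    rw [show x = 2 * (x / 2) by ring, Real.cosh_two_mul, Real.sinh_sq,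
      show 2 * (x / 2) / 2 = x / 2 by ring]; ring
  have h2 : 1 < Real.cosh (x / 2) := Real.one_lt_cosh.2 (by simpa using hx)
  have h3 : Real.cosh (x / 2) ^ 4 ≤ Real.exp (x ^ 2 / 2) := by
    calc _ ≤ Real.exp ((x / 2) ^ 2 / 2) ^ 4 := by gcongr; exact Real.cosh_le_exp_half_sq _
      _ = _ := by rw [← Real.exp_nat_mul]; congr 1; push_cast; ring
  nlinarith [mul_pos (sub_pos.2 h2) (sub_pos.2 h2), sq_nonneg (Real.cosh (x / 2) ^ 2 - 1)]

/-- Without field and up to the critical temperature, `0` is the unique maximum point of `φ`. -/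
lemma phi_lt_zero {d : ℕ} {β : ℝ} (hκ : 0 < 2 * d * β) (hκ1 : 2 * d * β ≤ 1) {s : ℝ} (hs : s ≠ 0) :
    phi d β 0 s < phi d β 0 0 := by
  have h0 : phi d β 0 0 = 0 := by simp [phi]
  rw [h0, phi, sub_neg, abs_zero, sub_zero]
  have h1 : Real.log (Real.cosh s) < s ^ 2 / 2 := by
    rw [Real.log_lt_iff_lt_exp (Real.cosh_pos s)]
    exact cosh_lt_exp_half_sq hs
  refine h1.trans_le ?_
  rw [div_le_div_iff₀ (by norm_num) (by linarith)]
  nlinarith [sq_nonneg s]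

/-- The maximum of `φ` at a positive critical point is nondegenerate. -/
lemma inv_cosh_sq_lt {d : ℕ} {β h t : ℝ} (hκ : 0 < 2 * d * β) (ht : 0 < t)
    (hcrit : 2 * d * β * Real.tanh t = t - |h|) : 1 / Real.cosh t ^ 2 < 1 / (2 * d * β) := by
  have h1 := div_cosh_sq_lt_tanh ht
  have hc := Real.cosh_pos t
  rw [div_lt_iff₀ (by positivity)] at h1
  rw [one_div_lt_one_div (by positivity) hκ]
  have h2 : 2 * d * β * Real.tanh t ≤ t := by rw [hcrit]; linarith [abs_nonneg h]
  have h3 := tanh_pos ht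
  by_contra! hle
  nlinarith

lemma density_eq_exp_phi (d : ℕ) (β h s : ℝ) :
    density (2 * d * β) |h| (s, 0) = Real.exp (2 * phi d β h s) := by
  have hc := Real.cosh_pos s
  rw [density, phi, mul_sub, Real.exp_sub, Real.cos_zero, Real.cosh_two_mul, Real.sinh_sq,
    show (2 : ℝ) * Real.log (Real.cosh s) = ((2 : ℕ) : ℝ) * Real.log (Real.cosh s) by norm_num,
    Real.exp_nat_mul, Real.exp_log hc, div_eq_mul_inv (Real.cosh s ^ 2), ← Real.exp_neg]
  congr 1
  · ring
  · congr 1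
    rw [show (4 * d * β : ℝ) = 2 * (2 * d * β) by ring]
    ring

lemma density_lt_of_ne_zero {κ H : ℝ} {s u : ℝ} (hu : u ∈ Set.Icc (-Real.pi) Real.pi) (hu0 : u ≠ 0) :
    density κ H (s, u) < density κ H (s, 0) := by
  refine mul_lt_mul_of_pos_right ?_ (Real.exp_pos _)
  have hpi := Real.pi_pos
  have : Real.cos u < 1 := by
    refine lt_of_le_of_ne (Real.cos_le_one u) fun h => hu0 ?_
    exact (Real.cos_eq_one_iff_of_lt_of_lt (by linarith [hu.1]) (by linarith [hu.2])).1 h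
  simp only [Real.cos_zero]
  linarith

lemma exists_density_le {κ : ℝ} (hκ : 0 < κ) (H : ℝ) {η : ℝ} (hη : 0 < η) :
    ∃ A, ∀ z : ℝ × ℝ, A ≤ |z.1| → density κ H z ≤ η := by
  set B := |Real.log η| with hB
  refine ⟨|H| + (4 * κ + |H| + B), fun z hz => ?_⟩
  set v := |z.1 - H| with hv
  have hB0 : 0 ≤ B := abs_nonneg _
  have hH0 := abs_nonneg H
  have hv1 : 4 * κ + |H| + B ≤ v := by
    have := abs_sub_abs_le_abs_sub z.1 H
    linarith
  have hv2 : |z.1| ≤ v + |H| := by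
    have := abs_sub_abs_le_abs_sub z.1 H
    linarith
  have h1 : 1 / 2 * Real.cosh (2 * z.1) + 1 / 2 * Real.cos z.2 ≤ Real.exp (2 * |z.1|) := by
    have h1 : Real.cosh (2 * z.1) ≤ Real.exp (2 * |z.1|) := by
      rw [← Real.cosh_abs, abs_mul, abs_two]
      have := Real.cosh_add_sinh (2 * |z.1|)
      have h0 : 0 ≤ Real.sinh (2 * |z.1|) := Real.sinh_nonneg_iff.2 (by positivity)
      linarith
    have h2 := Real.cos_le_one z.2
    have h3 := Real.one_le_exp (show 0 ≤ 2 * |z.1| by positivity)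
    linarith
  have h2 : -(z.1 - H) ^ 2 / κ ≤ -4 * v := by
    rw [div_le_iff₀ hκ, ← sq_abs (z.1 - H), ← hv]
    nlinarith
  calc density κ H z ≤ Real.exp (2 * |z.1|) * Real.exp (-4 * v) := by
        rw [density]
        exact mul_le_mul h1 (Real.exp_le_exp.2 h2) (Real.exp_pos _).le (Real.exp_pos _).le
    _ = Real.exp (2 * |z.1| + -4 * v) := (Real.exp_add _ _).symm
    _ ≤ Real.exp (Real.log η) := by
        refine Real.exp_le_exp.2 ?_
        have := neg_abs_le (Real.log η)
        linarith
    _ = η := Real.exp_log hη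

/-- A continuous function which is small for large first coordinate and below `1` away from
`(t, 0)` is bounded by some `ρ < 1` outside every neighbourhood of `(t, 0)`. -/
lemma exists_tail_bound {G : ℝ × ℝ → ℝ} (hG : Continuous G) {T : Set (ℝ × ℝ)} (hT : IsClosed T)
    (hTs : T ⊆ strip) {A : ℝ} (hA : ∀ z : ℝ × ℝ, A ≤ |z.1| → G z ≤ 1 / 2) {t : ℝ}
    (hlt : ∀ z ∈ T, z ≠ (t, 0) → G z < 1) (δ : ℝ) (hδ : 0 < δ) :
    ∃ ρ, 0 ≤ ρ ∧ ρ < 1 ∧ ∀ s u, (t + s, u) ∈ T → (s, u) ∉ box δ → G (t + s, u) ≤ ρ := by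
  set X : Set (ℝ × ℝ) := (T ∩ Set.Icc (-A) A ×ˢ Set.Icc (-Real.pi) Real.pi)
    ∩ {z | δ ≤ max |z.1 - t| |z.2|} with hX
  have hXc : IsCompact X := by
    refine IsCompact.inter_right ?_ (isClosed_le continuous_const (by fun_prop))
    rw [Set.inter_comm]
    exact (isCompact_Icc.prod isCompact_Icc).inter_right hT
  have hXlt : ∀ z ∈ X, G z < 1 := fun z hz => hlt z hz.1.1 fun e => by
    have : δ ≤ max |z.1 - t| |z.2| := hz.2
    rw [e] at this
    simp only [sub_self, abs_zero, max_self] at this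
    linarith
  obtain ⟨ρ, hρ1, hρ⟩ : ∃ ρ < 1, ∀ z ∈ X, G z ≤ ρ := by
    rcases X.eq_empty_or_nonempty with h | h
    · exact ⟨0, one_pos, fun z hz => by rw [h] at hz; exact hz.elim⟩
    · obtain ⟨z, hz, hmax⟩ := hXc.exists_isMaxOn h hG.continuousOn
      exact ⟨G z, hXlt z hz, fun y hy => hmax hy⟩
  refine ⟨max ρ (1 / 2), le_trans (by norm_num) (le_max_right _ _), max_lt hρ1 (by norm_num),
    fun s u hsu hbox => ?_⟩
  rcases le_or_gt A |t + s| with h | h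
  · exact (hA _ h).trans (le_max_right _ _)
  · refine (hρ _ ⟨⟨hsu, abs_le.1 h.le, (hTs hsu).2⟩, ?_⟩).trans (le_max_left _ _)
    change δ ≤ max |t + s - t| |u|
    rw [add_sub_cancel_left]
    by_contra! hlt'
    exact hbox ⟨((le_max_left _ _).trans_lt hlt').le, ((le_max_right _ _).trans_lt hlt').le⟩

/-! ### Regrouping the coefficients of the Laplace expansion -/

lemma evenAtTop_le_map : evenAtTop ≤ map (fun m : ℕ => 2 * m) atTop := by
  intro s hs
  rw [mem_map, mem_atTop_sets] at hs
  obtain ⟨N, hN⟩ := hs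
  rw [evenAtTop, mem_inf_principal, mem_atTop_sets]
  refine ⟨2 * N, fun n hn he => ?_⟩
  obtain ⟨k, hk⟩ := he
  have := hN k (by omega)
  change 2 * k ∈ s at this
  rwa [hk, ← two_mul]

lemma sum_range_even {R : Type*} [AddCommMonoid R] {f : ℕ → R} (hf : ∀ p, f (2 * p + 1) = 0)
    (M : ℕ) :
    ∑ j ∈ Finset.range (2 * M + 1), f j = ∑ p ∈ Finset.range (M + 1), f (2 * p) := by
  induction M with
  | zero => simp
  | succ M ih =>
    rw [show 2 * (M + 1) + 1 = 2 * M + 1 + 1 + 1 by ring, Finset.sum_range_succ,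
      Finset.sum_range_succ, ih, hf, Finset.sum_range_succ _ (M + 1), add_zero,
      show 2 * M + 1 + 1 = 2 * (M + 1) by ring]

/-- From the Laplace expansion of the integral to the asymptotic expansion of the partition
function. The factor `√n` of the Hubbard–Stratonovich transform is `ε ^ (-w)`. -/
lemma isLittleO_of_laplace {w : ℕ} (hw : 1 ≤ w) {Z X J : ℕ → ℝ} {A γ : ℕ → ℝ} {r : ℝ} {M : ℕ}
    (hA : ∀ p, A (2 * p + 1) = 0) (hγ : ∀ p ≤ M, r * A (2 * p) = γ p)
    (hJ : ∃ C : ℝ, ∀ m : ℕ, 1 ≤ m → |J m - laplaceScale w m ^ (1 + w) *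
      ∑ j ∈ Finset.range (2 * M + 1), A j * laplaceScale w m ^ j|
        ≤ C * laplaceScale w m ^ (1 + w + (2 * M + 1)))
    (hZ : ∀ m : ℕ, 1 ≤ m → Z (2 * m) = 2 ^ (2 * m) * X (2 * m) * (r * √(2 * m) * J m)) :
    (fun n : ℕ => Z n - 2 ^ n * X n * ∑ p ∈ Finset.range (M + 1),
        γ p * (n : ℝ) ^ (-((2 * p + 1 : ℕ) / (2 * w : ℝ))))
      =o[evenAtTop]
    (fun n : ℕ => (2 : ℝ) ^ n * X n * (n : ℝ) ^ (-((2 * M + 1 : ℕ) / (2 * w : ℝ)))) := by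
  refine IsLittleO.mono ?_ evenAtTop_le_map
  rw [isLittleO_map]
  obtain ⟨C, hC⟩ := hJ
  have hε0 : Tendsto (fun m => |r| * C * laplaceScale w m) atTop (nhds 0) := by
    simpa using (tendsto_laplaceScale hw).const_mul (|r| * C)
  rw [isLittleO_iff]
  intro η hη
  filter_upwards [eventually_ge_atTop 1, hε0.eventually_lt_const hη] with m hm hmη
  have hm0 : (0 : ℝ) < m := by exact_mod_cast hm
  set ε := laplaceScale w m with hε
  have hεpos : 0 < ε := laplaceScale_pos hm
  have hpow : ∀ k : ℕ, ((2 * m : ℕ) : ℝ) ^ (-((k : ℕ) / (2 * w : ℝ))) = ε ^ k := fun k => by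
    rw [hε, laplaceScale_pow]; push_cast; rfl
  have hsqrt : √(2 * m) * ε ^ w = 1 := by
    have h1 : ε ^ w = √((2 * m : ℝ)⁻¹) := by
      rw [← laplaceScale_pow_two_mul hw (m := m), ← hε, mul_comm 2 w, pow_mul,
        Real.sqrt_sq (by positivity)]
    rw [h1, ← Real.sqrt_mul (by positivity), mul_inv_cancel₀ (by positivity), Real.sqrt_one]
  have hmain : Z (2 * m) - 2 ^ (2 * m) * X (2 * m) * ∑ p ∈ Finset.range (M + 1),
        γ p * ((2 * m : ℕ) : ℝ) ^ (-((2 * p + 1 : ℕ) / (2 * w : ℝ)))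
      = 2 ^ (2 * m) * X (2 * m) * (r * √(2 * m) * (J m - ε ^ (1 + w) *
      ∑ j ∈ Finset.range (2 * M + 1), A j * ε ^ j)) := by
    rw [hZ m hm, sum_range_even fun p => by rw [hA, zero_mul], ← mul_sub]
    congr 1
    rw [mul_sub]
    congr 1
    have : r * √(2 * m) * (ε ^ (1 + w) * ∑ p ∈ Finset.range (M + 1), A (2 * p) * ε ^ (2 * p))
        = (√(2 * m) * ε ^ w) * (r * ε * ∑ p ∈ Finset.range (M + 1), A (2 * p) * ε ^ (2 * p)) := by
      rw [pow_add, pow_one]; ring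
    rw [this, hsqrt, one_mul, Finset.mul_sum]
    refine Finset.sum_congr rfl fun p hp => ?_
    rw [hpow, ← hγ p (by simpa [Nat.lt_succ_iff] using hp)]
    ring
  simp only [Function.comp_apply]
  rw [hmain, hpow, norm_mul, norm_mul _ (ε ^ (2 * M + 1))]
  calc _ ≤ ‖(2 : ℝ) ^ (2 * m) * X (2 * m)‖ * (|r| * √(2 * m) * (C * ε ^ (1 + w + (2 * M + 1)))) := by
        gcongr
        rw [Real.norm_eq_abs, abs_mul, abs_mul, abs_of_nonneg (Real.sqrt_nonneg _)]
        gcongr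
        exact hC m hm
    _ = ‖(2 : ℝ) ^ (2 * m) * X (2 * m)‖ * ((|r| * C * ε) * ε ^ (2 * M + 1)) := by
        congr 1
        calc _ = (√(2 * m) * ε ^ w) * ((|r| * C * ε) * ε ^ (2 * M + 1)) := by
              rw [pow_add, pow_add, pow_one]; ring
          _ = _ := by rw [hsqrt, one_mul]
    _ ≤ ‖(2 : ℝ) ^ (2 * m) * X (2 * m)‖ * (η * ε ^ (2 * M + 1)) := by gcongr
    _ = _ := by
        rw [Real.norm_of_nonneg (by positivity : 0 ≤ ε ^ (2 * M + 1))]; ring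

lemma excess_add {ι : Type*} {p q : ι → ℕ} {w k : ℕ} {f : Fin k → ι}
    (hf : ∀ j, 2 * w + 1 ≤ p (f j) + w * q (f j)) :
    excess p q w f + 2 * w * k = ∑ j, p (f j) + w * ∑ j, q (f j) := by
  have : ∀ j, p (f j) + w * q (f j) = (p (f j) + w * q (f j) - 2 * w) + 2 * w := fun j => by
    have := hf j; omega
  rw [excess, Finset.mul_sum, ← Finset.sum_add_distrib, Finset.sum_congr rfl fun j _ => this j,
    Finset.sum_add_distrib, Finset.sum_const, Finset.card_univ, Fintype.card_fin, smul_eq_mul]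
  ring

lemma le_excess {ι : Type*} {p q : ι → ℕ} {w k : ℕ} {f : Fin k → ι}
    (hf : ∀ j, 2 * w + 1 ≤ p (f j) + w * q (f j)) : k ≤ excess p q w f := by
  calc k = ∑ _j : Fin k, 1 := by simp
    _ ≤ _ := Finset.sum_le_sum fun j _ => by have := hf j; omega

lemma laplaceCoeff_zero {ι : Type*} {I : Finset ι} {c : ι → ℝ} {p q : ι → ℕ} {w : ℕ} {a b : ℝ}
    (hI : ∀ i ∈ I, 2 * w + 1 ≤ p i + w * q i) (L : ℕ) :
    laplaceCoeff I c p q w a b L 0 = moment w a 0 * moment 1 b 0 := by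
  rw [laplaceCoeff, Finset.sum_eq_single_of_mem 0 (by simp)]
  · simp [excess]
  · intro k _ hk
    rw [Finset.sum_eq_zero, mul_zero]
    intro f hf
    rw [if_neg]
    have := le_excess (p := p) (q := q) (w := w) fun j => hI _ (Fintype.mem_piFinset.1 hf j)
    omega

/-- The exponent pairs of the non-quadratic Taylor monomials up to order `K` in each variable. -/
def cubicIndices (K : ℕ) : Finset (ℕ × ℕ) :=
  {i ∈ Finset.range (K + 1) ×ˢ Finset.range (K + 1) | 3 ≤ i.1 + i.2}

lemma le_of_mem_cubicIndices {K : ℕ} : ∀ i ∈ cubicIndices K, 2 * 1 + 1 ≤ i.1 + 1 * i.2 :=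
  fun i hi => by have := (Finset.mem_filter.1 hi).2; omega

/-- Odd orders vanish, because one of the two Gaussian moments is odd. -/
lemma laplaceCoeff_regular_odd (c : ℕ × ℕ → ℝ) (a b : ℝ) (K L p : ℕ) :
    laplaceCoeff (cubicIndices K) c Prod.fst Prod.snd 1 a b L (2 * p + 1) = 0 := by
  refine Finset.sum_eq_zero fun k _ => ?_
  rw [Finset.sum_eq_zero, mul_zero]
  intro f hf
  split_ifs with h
  · have h1 := excess_add (p := Prod.fst) (q := Prod.snd) (w := 1)
      fun j => le_of_mem_cubicIndices _ (Fintype.mem_piFinset.1 hf j)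
    rw [h, one_mul] at h1
    rcases Nat.even_or_odd (∑ j, (f j).1) with h2 | h2
    · have h3 : Odd (∑ j, (f j).2) := by
        obtain ⟨x, hx⟩ := h2
        rw [← Nat.not_even_iff_odd]
        rintro ⟨y, hy⟩
        omega
      rw [moment_odd h3]; ring
    · rw [moment_odd h2]; ring
  · rfl

/-- The even orders are sums over the index sets of `γ_p`. At most `2 p` monomials can have total
excess `2 p`, so their exponents are at most `6 p`, and a cutoff `K ≥ 6 p` is harmless. -/
lemma laplaceCoeff_regular_even (c : ℕ × ℕ → ℝ) (a b : ℝ) {K L p : ℕ} (hp : 1 ≤ p) (hL : 2 * p ≤ L)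
    (hK : 6 * p ≤ K) :
    laplaceCoeff (cubicIndices K) c Prod.fst Prod.snd 1 a b L (2 * p)
      = ∑ k ∈ Finset.Icc 1 (2 * p), 1 / (k ! : ℝ) * ∑ f ∈ regularIndices p k,
        (∏ j, c (f j)) * (moment 1 a (∑ j, (f j).1) * moment 1 b (∑ j, (f j).2)) := by
  rw [laplaceCoeff]
  have hsub : Finset.Icc 1 (2 * p) ⊆ Finset.range (L + 1) := fun k hk => by
    rw [Finset.mem_Icc] at hk
    rw [Finset.mem_range]; omega
  rw [← Finset.sum_subset hsub]
  · refine Finset.sum_congr rfl fun k hk => ?_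
    rw [Finset.mem_Icc] at hk
    congr 1
    rw [← Finset.sum_filter]
    symm
    refine Finset.sum_subset (fun f hf => ?_) fun f hf hnot => ?_
    · obtain ⟨hf1, hf3, hsum, he1, he2⟩ := Finset.mem_filter.1 hf
      have hmem : f ∈ Fintype.piFinset fun _ : Fin k => cubicIndices K := by
        rw [Fintype.mem_piFinset] at hf1 ⊢
        intro j
        have h1 := hf1 j
        rw [Finset.mem_product, Finset.mem_range, Finset.mem_range] at h1
        rw [cubicIndices, Finset.mem_filter, Finset.mem_product, Finset.mem_range, Finset.mem_range]
        exact ⟨⟨by omega, by omega⟩, hf3 j⟩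
      refine Finset.mem_filter.2 ⟨hmem, ?_⟩
      have h1 := excess_add (p := Prod.fst) (q := Prod.snd) (w := 1)
        fun j => le_of_mem_cubicIndices _ (Fintype.mem_piFinset.1 hmem j)
      rw [Finset.sum_add_distrib] at hsum
      omega
    · obtain ⟨hmem, hex⟩ := Finset.mem_filter.1 hf
      have h3 := fun j => le_of_mem_cubicIndices _ (Fintype.mem_piFinset.1 hmem j)
      have h1 := excess_add (p := Prod.fst) (q := Prod.snd) (w := 1) h3
      have hsum : ∑ j, ((f j).1 + (f j).2) = 2 * (k + p) := by
        rw [Finset.sum_add_distrib]; omega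
      have hle : ∀ j, (f j).1 + (f j).2 ≤ 2 * (k + p) := fun j => by
        rw [← hsum]
        exact Finset.single_le_sum (f := fun j => (f j).1 + (f j).2) (fun _ _ => Nat.zero_le _)
          (Finset.mem_univ j)
      rcases Nat.even_or_odd (∑ j, (f j).1) with h2 | h2
      · rcases Nat.even_or_odd (∑ j, (f j).2) with h4 | h4
        · refine absurd (Finset.mem_filter.2 ⟨?_, fun j => ?_, hsum, h2, h4⟩) hnot
          · rw [Fintype.mem_piFinset]
            intro j
            have := hle j
            rw [Finset.mem_product, Finset.mem_range, Finset.mem_range]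
            omega
          · have := h3 j; omega
        · rw [moment_odd h4]; ring
      · rw [moment_odd h2]; ring
  · intro k _ hk
    rw [Finset.sum_eq_zero, mul_zero]
    intro f hf
    rw [if_neg]
    intro hex
    have h3 := fun j => le_of_mem_cubicIndices _ (Fintype.mem_piFinset.1 hf j)
    have h1 := le_excess (p := Prod.fst) (q := Prod.snd) (w := 1) h3
    rw [Finset.mem_Icc] at hk
    have hk0 : k = 0 := by omega
    subst hk0
    simp [excess] at hex
    omega

/-! ### The Taylor coefficients of `ψ` -/

lemma cosh_add_cos_pos (s : ℝ) {u : ℝ} (hu : u ∈ Set.Ioo (-Real.pi) Real.pi) :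
    0 < 1 / 2 * Real.cosh (2 * s) + 1 / 2 * Real.cos u := by
  have h1 := Real.one_le_cosh (2 * s)
  have h2 : -1 < Real.cos u := by
    rw [← Real.cos_pi, ← Real.cos_abs u]
    exact Real.cos_lt_cos_of_nonneg_of_le_pi (abs_nonneg u) le_rfl (abs_lt.2 hu)
  linarith

lemma isOpen_openStrip : IsOpen ((Set.univ : Set ℝ) ×ˢ Set.Ioo (-Real.pi) Real.pi) :=
  isOpen_univ.prod isOpen_Ioo

lemma contDiffOn_psi (d : ℕ) (β h : ℝ) :
    ContDiffOn ℝ ∞ (fun z : ℝ × ℝ => psi d β h z.1 z.2)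
      (Set.univ ×ˢ Set.Ioo (-Real.pi) Real.pi) := by
  unfold psi
  refine contDiffOn_const.mul (ContDiffOn.sub (ContDiffOn.log ?_ ?_) ?_)
  · refine ContDiff.contDiffOn ?_
    exact (contDiff_const.mul (Real.contDiff_cosh.comp (by fun_prop))).add
      (contDiff_const.mul (Real.contDiff_cos.comp (by fun_prop)))
  · exact fun z hz => (cosh_add_cos_pos z.1 hz.2).ne'
  · exact ContDiff.contDiffOn (by fun_prop)

lemma psi_zero_right (d : ℕ) (β h s : ℝ) : psi d β h s 0 = phi d β h s := by
  have hc := Real.cosh_pos s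
  have e : 1 / 2 * Real.cosh (2 * s) + 1 / 2 * Real.cos 0 = Real.cosh s ^ 2 := by
    rw [Real.cos_zero, Real.cosh_two_mul, Real.sinh_sq]; ring
  rw [psi, phi, e, Real.log_pow, show (4 * d * β : ℝ) = 2 * (2 * d * β) by ring]
  push_cast
  ring

lemma exp_two_psi (d : ℕ) (β h s : ℝ) {u : ℝ} (hu : u ∈ Set.Ioo (-Real.pi) Real.pi) :
    Real.exp (2 * psi d β h s u) = density (2 * d * β) |h| (s, u) := by
  rw [psi, density, ← mul_assoc, show (2 : ℝ) * (1 / 2) = 1 by norm_num, one_mul, Real.exp_sub,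
    Real.exp_log (cosh_add_cos_pos s hu), div_eq_mul_inv, ← Real.exp_neg, neg_div]

lemma hasDerivAt_psi_snd (d : ℕ) (β h s : ℝ) {u : ℝ} (hu : u ∈ Set.Ioo (-Real.pi) Real.pi) :
    HasDerivAt (psi d β h s)
      (-(1 / 4) * Real.sin u / (1 / 2 * Real.cosh (2 * s) + 1 / 2 * Real.cos u)) u := by
  have h1 : HasDerivAt (fun u => 1 / 2 * Real.cosh (2 * s) + 1 / 2 * Real.cos u)
      (1 / 2 * -Real.sin u) u := ((Real.hasDerivAt_cos u).const_mul _).const_add _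
  refine (((h1.log (cosh_add_cos_pos s hu).ne').sub_const _).const_mul (1 / 2)).congr_deriv ?_
  ring

lemma zero_mem_Ioo_pi : (0 : ℝ) ∈ Set.Ioo (-Real.pi) Real.pi :=
  ⟨neg_lt_zero.2 Real.pi_pos, Real.pi_pos⟩

lemma alpha_zero_zero (d : ℕ) (β h t : ℝ) : alpha d β h t 0 0 = phi d β h t := by
  simp [alpha, psi_zero_right]

lemma alpha_one_zero (d : ℕ) (β h t : ℝ) :
    alpha d β h t 1 0 = Real.tanh t - (t - |h|) / (2 * d * β) := by
  simp [alpha, psi_zero_right, iteratedDeriv_one]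
  exact (hasDerivAt_phi d β h t).deriv

lemma alpha_two_zero (d : ℕ) (β h t : ℝ) :
    alpha d β h t 2 0 = (1 / Real.cosh t ^ 2 - 1 / (2 * d * β)) / 2 := by
  have h1 : deriv (phi d β h) = fun x => Real.tanh x - (x - |h|) / (2 * d * β) :=
    funext fun x => (hasDerivAt_phi d β h x).deriv
  have h2 : HasDerivAt (fun x => Real.tanh x - (x - |h|) / (2 * d * β))
      (1 / Real.cosh t ^ 2 - 1 / (2 * d * β)) t :=
    (hasDerivAt_tanh t).sub (((hasDerivAt_id t).sub_const _).div_const _)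
  have h3 : (fun s => iteratedDeriv 0 (psi d β h s) 0) = phi d β h := by
    funext s; rw [iteratedDeriv_zero, psi_zero_right]
  rw [alpha, h3, iteratedDeriv_succ, iteratedDeriv_one, h1, h2.deriv]
  norm_num

lemma alpha_one_right (d : ℕ) (β h t : ℝ) (p : ℕ) : alpha d β h t p 1 = 0 := by
  have h3 : (fun s => iteratedDeriv 1 (psi d β h s) 0) = fun _ => 0 := by
    funext s
    rw [iteratedDeriv_one, (hasDerivAt_psi_snd d β h s zero_mem_Ioo_pi).deriv]
    simp
  rw [alpha, h3]
  simp

lemma alpha_zero_two (d : ℕ) (β h t : ℝ) : alpha d β h t 0 2 = -(1 / (8 * Real.cosh t ^ 2)) := by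
  have hc := Real.cosh_pos t
  have h1 : deriv (psi d β h t) =ᶠ[nhds 0] fun u =>
      -(1 / 4) * Real.sin u / (1 / 2 * Real.cosh (2 * t) + 1 / 2 * Real.cos u) := by
    filter_upwards [isOpen_Ioo.mem_nhds zero_mem_Ioo_pi] with u hu
    exact (hasDerivAt_psi_snd d β h t hu).deriv
  have h2 := ((Real.hasDerivAt_sin 0).const_mul (-(1 / 4) : ℝ)).div
    (((Real.hasDerivAt_cos 0).const_mul (1 / 2 : ℝ)).const_add (1 / 2 * Real.cosh (2 * t)))
    (cosh_add_cos_pos t zero_mem_Ioo_pi).ne'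
  have e : 1 / 2 * Real.cosh (2 * t) + 1 / 2 * Real.cos 0 = Real.cosh t ^ 2 := by
    rw [Real.cos_zero, Real.cosh_two_mul, Real.sinh_sq]; ring
  rw [alpha, iteratedDeriv_zero, iteratedDeriv_succ, iteratedDeriv_one, h1.deriv_eq]
  have h3 : deriv (fun u => -(1 / 4) * Real.sin u
      / (1 / 2 * Real.cosh (2 * t) + 1 / 2 * Real.cos u)) 0 = _ := h2.deriv
  rw [h3, e, Real.cos_zero, Real.sin_zero]
  norm_num
  field_simp
  norm_num

/-- Taylor expansion of `ψ` at `(t, 0)`, with all terms of order at most two written out. -/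
lemma exists_psi_taylor (d : ℕ) (β h t : ℝ) {K : ℕ} (hK : 2 ≤ K) :
    ∃ C, 0 ≤ C ∧ ∀ s u, |s| ≤ 1 → |u| ≤ 1 →
      |psi d β h (t + s) u - phi d β h t - alpha d β h t 1 0 * s
        + (-alpha d β h t 2 0 * s ^ (2 * 1) + -alpha d β h t 0 2 * u ^ 2)
        - monomialSum (cubicIndices K) (fun i => alpha d β h t i.1 i.2) Prod.fst Prod.snd s u|
          ≤ C * (|s| ^ (K + 1) + |u| ^ (K + 1)) := by
  obtain ⟨C, hC0, hC⟩ := exists_taylor_two isOpen_openStrip (contDiffOn_psi d β h) (t := t) one_pos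
    le_rfl (fun s u _ hu => ⟨trivial, abs_lt.1 (hu.trans_lt (by linarith [Real.pi_gt_three]))⟩) K
  refine ⟨C, hC0, fun s u hs hu => ?_⟩
  have hlow : (Finset.range (K + 1) ×ˢ Finset.range (K + 1)).filter (fun i => ¬ 3 ≤ i.1 + i.2)
      = {(0, 0), (1, 0), (0, 1), (2, 0), (1, 1), (0, 2)} := by
    ext ⟨x, y⟩
    simp only [Finset.mem_filter, Finset.mem_product, Finset.mem_range, Finset.mem_insert,
      Finset.mem_singleton, Prod.mk.injEq]
    omega
  have hsum : ∑ i ∈ Finset.range (K + 1) ×ˢ Finset.range (K + 1),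
        iteratedDeriv i.1 (fun s => iteratedDeriv i.2 (psi d β h s) 0) t / (i.1 ! * i.2 !)
          * s ^ i.1 * u ^ i.2
      = monomialSum (cubicIndices K) (fun i => alpha d β h t i.1 i.2) Prod.fst Prod.snd s u
        + (phi d β h t + alpha d β h t 1 0 * s
          + (alpha d β h t 2 0 * s ^ 2 + alpha d β h t 0 2 * u ^ 2)) := by
    have hal : ∀ i : ℕ × ℕ,
        iteratedDeriv i.1 (fun s => iteratedDeriv i.2 (psi d β h s) 0) t / (i.1 ! * i.2 !)
          * s ^ i.1 * u ^ i.2 = alpha d β h t i.1 i.2 * s ^ i.1 * u ^ i.2 := fun i => rfl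
    simp_rw [hal]
    rw [← Finset.sum_filter_add_sum_filter_not _ (fun i => 3 ≤ i.1 + i.2), hlow]
    congr 1
    rw [Finset.sum_insert (by decide), Finset.sum_insert (by decide), Finset.sum_insert (by decide),
      Finset.sum_insert (by decide), Finset.sum_insert (by decide), Finset.sum_singleton]
    simp only [alpha_one_right, alpha_zero_zero]
    ring
  have := hC s u hs hu
  rw [hsum] at this
  refine le_trans (le_of_eq ?_) this
  congr 1
  ring

lemma moment_one_even {a : ℝ} (ha : 0 < a) {P : ℕ} (hP : Even P) :
    moment 1 a P = a ^ (-((P : ℝ) + 1) / 2) * Real.Gamma (((P : ℝ) + 1) / 2) := by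
  rw [moment_even le_rfl ha hP]
  norm_num

lemma moment_one_zero (a : ℝ) : moment 1 a 0 = √(Real.pi / a) := by
  rw [moment]
  simpa using integral_gaussian a

lemma two_pi_rpow : (2 * Real.pi) ^ (3 / 2 : ℝ) = 2 * Real.pi * √(2 * Real.pi) := by
  have hpi := Real.pi_pos
  rw [Real.sqrt_eq_rpow, show (3 / 2 : ℝ) = 1 + 1 / 2 by norm_num, Real.rpow_add (by positivity),
    Real.rpow_one]

/-- Normalized Gaussian factors of the Hubbard–Stratonovich representation. -/
lemma normalization_eq {κ : ℝ} (hκ : 0 < κ) {m : ℕ} (hm : 1 ≤ m) :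
    1 / (2 * Real.pi) ^ (3 / 2 : ℝ) * κ ^ (-1 / 2 : ℝ) * √(2 * m)
      * (2 * Real.pi * √(κ * Real.pi / m)) = 1 := by
  have hm0 : (0 : ℝ) < m := by exact_mod_cast hm
  have hpi := Real.pi_pos
  have e2 : κ ^ (-1 / 2 : ℝ) = (√κ)⁻¹ := by
    rw [Real.sqrt_eq_rpow, ← Real.rpow_neg hκ.le]; norm_num
  have e3 : √(2 * m : ℝ) * √(κ * Real.pi / m) = √κ * √(2 * Real.pi) := by
    rw [← Real.sqrt_mul (by positivity), ← Real.sqrt_mul hκ.le]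
    congr 1
    field_simp
  have h1 : √κ ≠ 0 := (Real.sqrt_pos.2 hκ).ne'
  have h2 : √(2 * Real.pi) ≠ 0 := (Real.sqrt_pos.2 (by positivity)).ne'
  rw [two_pi_rpow, e2]
  calc _ = (√(2 * m : ℝ) * √(κ * Real.pi / m)) / (√κ * √(2 * Real.pi)) := by field_simp
    _ = 1 := by rw [e3]; field_simp

/-- The partition function as an integral of powers of the density, normalized by its maximum. -/
lemma balancedSum_eq_integral {d : ℕ} {β h : ℝ} (t : ℝ) (hκ : 0 < 2 * d * β) {m : ℕ} (hm : 1 ≤ m) :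
    balancedSum d β h (2 * m) = 2 ^ (2 * m) * Real.exp ((2 * m : ℕ) * phi d β h t)
      * ((1 / (2 * Real.pi) ^ (3 / 2 : ℝ) * (2 * d * β) ^ (-1 / 2 : ℝ)) * √(2 * m)
        * ∫ z in strip, (density (2 * d * β) |h| z * Real.exp (-(2 * phi d β h t))) ^ m) := by
  have h1 := (integral_density_pow (H := |h|) hκ hm).2
  rw [balancedSum_abs] at h1
  have h2 := normalization_eq hκ hm
  simp_rw [mul_pow]
  rw [integral_mul_const, ← Real.exp_nat_mul]
  have h3 : Real.exp ((2 * m : ℕ) * phi d β h t) * Real.exp (m * -(2 * phi d β h t)) = 1 := by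
    rw [← Real.exp_add, ← Real.exp_zero]; congr 1; push_cast; ring
  have h4 : (2 : ℝ) ^ (2 * m) = 4 ^ m := by rw [pow_mul]; norm_num
  set J := ∫ z in strip, density (2 * d * β) |h| z ^ m
  set r := 1 / (2 * Real.pi) ^ (3 / 2 : ℝ) * (2 * d * β) ^ (-1 / 2 : ℝ)
  calc _ = (r * √(2 * m) * (2 * Real.pi * √(2 * d * β * Real.pi / m)))
        * balancedSum d β h (2 * m) := by rw [h2, one_mul]
    _ = r * √(2 * m) * (4 ^ m * J) := by rw [h1]; ring
    _ = 2 ^ (2 * m) * (Real.exp ((2 * m : ℕ) * phi d β h t) * Real.exp (m * -(2 * phi d β h t)))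
        * (r * √(2 * m) * J) := by rw [h3, h4]; ring
    _ = _ := by ring

/-! ### Nondegenerate maxima -/

lemma neg_alpha_zero_two_pos (d : ℕ) (β h t : ℝ) : 0 < -alpha d β h t 0 2 := by
  have := Real.cosh_pos t
  rw [alpha_zero_two, neg_neg]; positivity

/-- The Laplace expansion of the integral of the normalized density over a subset `S` of the strip
in which `(t, 0)` is the only maximum point of `ψ`, given a local expansion of `ψ`. -/
lemma exists_density_expansion {ι : Type*} {I : Finset ι} {c : ι → ℝ} {p q : ι → ℕ} {w : ℕ}
    (hw : 1 ≤ w) {a b : ℝ} (ha : 0 < a) (hb : 0 < b) (hI : ∀ i ∈ I, 2 * w + 1 ≤ p i + w * q i)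
    {L N : ℕ} (hN : 2 * w + L + 1 ≤ N) {d : ℕ} {β h t : ℝ} (hκ : 0 < 2 * d * β)
    {S T : Set (ℝ × ℝ)} (hS : MeasurableSet S) (hST : S ⊆ T) (hT : IsClosed T) (hTs : T ⊆ strip)
    {C₀ δ₀ : ℝ} (hC₀ : 0 ≤ C₀) (hδ₀ : 0 < δ₀) (hδ₀1 : δ₀ ≤ 1)
    (hψ : ∀ s u, |s| ≤ δ₀ → |u| ≤ δ₀ →
      |psi d β h (t + s) u - phi d β h t + (a * s ^ (2 * w) + b * u ^ 2) - monomialSum I c p q s u|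
        ≤ C₀ * (|s| ^ N + |u| ^ N))
    (hbox : ∀ s u, |s| ≤ δ₀ → |u| ≤ δ₀ → (t + s, u) ∈ S)
    (hmax : ∀ z ∈ T, z.1 ≠ t → phi d β h z.1 < phi d β h t) :
    ∃ C : ℝ, ∀ m : ℕ, 1 ≤ m →
      |(∫ z in S, (density (2 * d * β) |h| z * Real.exp (-(2 * phi d β h t))) ^ m)
        - laplaceScale w m ^ (1 + w) * ∑ j ∈ Finset.range (L + 1),
          laplaceCoeff I c p q w a b L j * laplaceScale w m ^ j|
      ≤ C * laplaceScale w m ^ (1 + w + (L + 1)) := by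
  have hpi := Real.pi_gt_three
  have hIoo : ∀ u, |u| ≤ δ₀ → u ∈ Set.Ioo (-Real.pi) Real.pi := fun u hu =>
    abs_lt.1 (by linarith)
  have hG : Continuous fun z => density (2 * d * β) |h| z * Real.exp (-(2 * phi d β h t)) :=
    (continuous_density _ _).mul continuous_const
  have hint : IntegrableOn (density (2 * d * β) |h|) strip := by
    simpa using (integral_density_pow (H := |h|) hκ (le_refl 1)).1
  obtain ⟨A, hA⟩ := exists_density_le hκ |h|
    (show 0 < 1 / 2 * Real.exp (2 * phi d β h t) by positivity)
  refine exists_laplace_expansion (t := t) (ψ := fun s u => psi d β h (t + s) u - phi d β h t)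
    hw ha hb hI hN hC₀ hδ₀ ?_ hψ hS ?_ hG.measurable ((hint.mono_set (hST.trans hTs)).mul_const _)
    ?_ ?_
  · refine ContinuousOn.sub ?_ continuousOn_const
    exact (contDiffOn_psi d β h).continuousOn.comp (f := fun z : ℝ × ℝ => (t + z.1, z.2))
      (by fun_prop) fun z hz => ⟨trivial, hIoo _ hz.2⟩
  · exact fun z _ => mul_nonneg (density_nonneg _ _ z) (Real.exp_pos _).le
  · intro s u hs hu
    refine ⟨hbox s u hs hu, ?_⟩
    rw [mul_sub, sub_eq_add_neg, Real.exp_add, exp_two_psi _ _ _ _ (hIoo u hu)]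
  · intro δ hδ
    have htail := exists_tail_bound hG hT hTs (A := A) (t := t) ?_ ?_ δ hδ
    · obtain ⟨ρ, hρ0, hρ1, hρ⟩ := htail
      exact ⟨ρ, hρ0, hρ1, fun s u hsu => hρ s u (hST hsu)⟩
    · intro z hz
      calc _ ≤ 1 / 2 * Real.exp (2 * phi d β h t) * Real.exp (-(2 * phi d β h t)) := by
            gcongr; exact hA z hz
        _ = 1 / 2 := by rw [mul_assoc, ← Real.exp_add, add_neg_cancel, Real.exp_zero, mul_one]
    · intro z hz hne
      have hlt : density (2 * d * β) |h| z < Real.exp (2 * phi d β h t) := by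
        obtain ⟨s, u⟩ := z
        have hle : density (2 * d * β) |h| (s, 0) ≤ Real.exp (2 * phi d β h t) := by
          rw [density_eq_exp_phi]
          refine Real.exp_le_exp.2 ?_
          by_cases hs : s = t
          · rw [hs]
          · linarith [hmax _ hz hs]
        by_cases hu : u = 0
        · subst hu
          have hs : s ≠ t := fun e => hne (by rw [e])
          rw [density_eq_exp_phi]
          exact Real.exp_lt_exp.2 (by linarith [hmax _ hz hs])
        · exact (density_lt_of_ne_zero (hTs hz).2 hu).trans_le hle
      calc _ < Real.exp (2 * phi d β h t) * Real.exp (-(2 * phi d β h t)) := by gcongr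
        _ = 1 := by rw [← Real.exp_add, add_neg_cancel, Real.exp_zero]

/-- The Laplace expansion at a nondegenerate maximum point `(t, 0)` of `ψ`, over a subset `S` of the
strip in which this is the only maximum point. -/
lemma exists_regular_expansion {d : ℕ} {β h t : ℝ} (hκ : 0 < 2 * d * β)
    (hcrit : 2 * d * β * Real.tanh t = t - |h|)
    (hnd : 1 / Real.cosh t ^ 2 < 1 / (2 * d * β)) {S T : Set (ℝ × ℝ)} (hS : MeasurableSet S)
    (hST : S ⊆ T) (hT : IsClosed T) (hTs : T ⊆ strip) {δ₀ : ℝ} (hδ₀ : 0 < δ₀) (hδ₀1 : δ₀ ≤ 1)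
    (hbox : ∀ s u, |s| ≤ δ₀ → |u| ≤ δ₀ → (t + s, u) ∈ S)
    (hmax : ∀ z ∈ T, z.1 ≠ t → phi d β h z.1 < phi d β h t) (M : ℕ) :
    ∃ C : ℝ, ∀ m : ℕ, 1 ≤ m →
      |(∫ z in S, (density (2 * d * β) |h| z * Real.exp (-(2 * phi d β h t))) ^ m)
        - laplaceScale 1 m ^ (1 + 1) * ∑ j ∈ Finset.range (2 * M + 1),
          laplaceCoeff (cubicIndices (6 * M + 4)) (fun i => alpha d β h t i.1 i.2) Prod.fst Prod.snd 1
            (-alpha d β h t 2 0) (-alpha d β h t 0 2) (2 * M) j * laplaceScale 1 m ^ j|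
      ≤ C * laplaceScale 1 m ^ (1 + 1 + (2 * M + 1)) := by
  have ha : 0 < -alpha d β h t 2 0 := by rw [alpha_two_zero]; linarith
  have hα : alpha d β h t 1 0 = 0 := by
    rw [alpha_one_zero, sub_eq_zero, eq_div_iff hκ.ne']; linarith
  obtain ⟨C, hC0, hC⟩ := exists_psi_taylor d β h t (K := 6 * M + 4) (by omega)
  refine exists_density_expansion (N := 6 * M + 4 + 1) le_rfl ha (neg_alpha_zero_two_pos d β h t)
    le_of_mem_cubicIndices (by omega) hκ hS hST hT hTs hC0 hδ₀ hδ₀1 (fun s u hs hu => ?_) hbox hmax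
  have := hC s u (hs.trans hδ₀1) (hu.trans hδ₀1)
  rwa [hα, zero_mul, sub_zero] at this

lemma gammaMax_eq_laplaceCoeff {d : ℕ} {β h t : ℝ} (hβ : β ≠ 0) (ha : 0 < -alpha d β h t 2 0)
    (hb : 0 < -alpha d β h t 0 2) {M p : ℕ} (hp : 1 ≤ p) (hpM : p ≤ M) :
    1 / (2 * Real.pi) ^ (3 / 2 : ℝ) * (2 * d * β) ^ (-1 / 2 : ℝ) *
      laplaceCoeff (cubicIndices (6 * M + 4)) (fun i => alpha d β h t i.1 i.2) Prod.fst Prod.snd 1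
        (-alpha d β h t 2 0) (-alpha d β h t 0 2) (2 * M) (2 * p) = gammaMax d β h t p := by
  rw [laplaceCoeff_regular_even _ _ _ hp (by omega) (by omega), gammaMax, mul_assoc]
  congr 1
  rw [Finset.mul_sum]
  refine Finset.sum_congr rfl fun k _ => ?_
  rw [mul_left_comm]
  congr 1
  rw [Finset.mul_sum]
  refine Finset.sum_congr rfl fun f hf => ?_
  obtain ⟨-, -, -, he1, he2⟩ := Finset.mem_filter.1 hf
  rw [moment_one_even ha he1, moment_one_even hb he2, tFactor, if_neg hβ]
  ring

lemma laplace_leading {d : ℕ} {β h t : ℝ}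
    (hnd : 1 / Real.cosh t ^ 2 < 1 / (2 * d * β)) :
    1 / (2 * Real.pi) ^ (3 / 2 : ℝ) * (2 * d * β) ^ (-1 / 2 : ℝ) *
      (moment 1 (-alpha d β h t 2 0) 0 * moment 1 (-alpha d β h t 0 2) 0)
    = √(2 / Real.pi) * (2 * d * β) ^ (-1 / 2 : ℝ)
        * (1 / (2 * d * β) - 1 / Real.cosh t ^ 2) ^ (-1 / 2 : ℝ) * Real.cosh t := by
  have hpi := Real.pi_pos
  have hc := Real.cosh_pos t
  set g := 1 / (2 * d * β) - 1 / Real.cosh t ^ 2 with hg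
  have hg0 : 0 < g := by rw [hg]; linarith
  have ea : -alpha d β h t 2 0 = g / 2 := by rw [alpha_two_zero, hg]; ring
  have eb : -alpha d β h t 0 2 = 1 / (8 * Real.cosh t ^ 2) := by rw [alpha_zero_two, neg_neg]
  rw [moment_one_zero, moment_one_zero, ea, eb, ← Real.sqrt_mul (by positivity)]
  have e2 : g ^ (-1 / 2 : ℝ) = (√g)⁻¹ := by
    rw [Real.sqrt_eq_rpow, ← Real.rpow_neg hg0.le]; norm_num
  have e3 : Real.pi / (g / 2) * (Real.pi / (1 / (8 * Real.cosh t ^ 2)))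
      = (4 * Real.pi * Real.cosh t) ^ 2 / g := by field_simp; ring
  have e4 : √(2 * Real.pi) = √(2 / Real.pi) * Real.pi := by
    rw [show 2 * Real.pi = 2 / Real.pi * Real.pi ^ 2 by field_simp,
      Real.sqrt_mul (by positivity), Real.sqrt_sq hpi.le]
  have e5 : √(2 / Real.pi) * √(2 / Real.pi) = 2 / Real.pi := Real.mul_self_sqrt (by positivity)
  have h5 : √(2 / Real.pi) ≠ 0 := (Real.sqrt_pos.2 (by positivity)).ne'
  have hg' : √g ≠ 0 := (Real.sqrt_pos.2 hg0).ne'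
  rw [two_pi_rpow, e2, e3, Real.sqrt_div (by positivity), Real.sqrt_sq (by positivity), e4]
  have e6 : 1 / (2 * Real.pi * (√(2 / Real.pi) * Real.pi)) * 4 * Real.pi = √(2 / Real.pi) := by
    rw [div_mul_eq_mul_div, div_mul_eq_mul_div, div_eq_iff (by positivity)]
    have e7 : √(2 / Real.pi) * √(2 / Real.pi) * Real.pi = 2 := by rw [e5]; field_simp
    linear_combination (-2 * Real.pi) * e7
  calc _ = (1 / (2 * Real.pi * (√(2 / Real.pi) * Real.pi)) * 4 * Real.pi)
        * (2 * d * β) ^ (-1 / 2 : ℝ) * (√g)⁻¹ * Real.cosh t := by ring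
    _ = _ := by rw [e6]

/-- The asymptotic expansion when `(t, 0)` is the only maximum point of `ψ` in the strip. -/
lemma isLittleO_regular {d : ℕ} {β h t : ℝ} (hκ : 0 < 2 * d * β)
    (hcrit : 2 * d * β * Real.tanh t = t - |h|) (hnd : 1 / Real.cosh t ^ 2 < 1 / (2 * d * β))
    (hmax : ∀ s, s ≠ t → phi d β h s < phi d β h t) (M : ℕ) :
    (fun n : ℕ => balancedSum d β h n - 2 ^ n * Real.exp (n * phi d β h t)
        * ∑ p ∈ Finset.range (M + 1), gammaField d β h t p * (n : ℝ) ^ (-(p : ℝ) - 1 / 2))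
      =o[evenAtTop]
    (fun n : ℕ => (2 : ℝ) ^ n * Real.exp (n * phi d β h t) * (n : ℝ) ^ (-(M : ℝ) - 1 / 2)) := by
  have hβ : β ≠ 0 := fun e => by simp [e] at hκ
  have ha : 0 < -alpha d β h t 2 0 := by rw [alpha_two_zero]; linarith
  have hb := neg_alpha_zero_two_pos d β h t
  have hclosed : IsClosed strip := isClosed_univ.prod isClosed_Icc
  have hexp : ∀ p : ℕ, (-((2 * p + 1 : ℕ) / (2 * (1 : ℕ) : ℝ)) : ℝ) = -(p : ℝ) - 1 / 2 := fun p => by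
    push_cast; ring
  have := isLittleO_of_laplace (w := 1) le_rfl (Z := balancedSum d β h)
    (X := fun n => Real.exp (n * phi d β h t)) (γ := gammaField d β h t) (M := M)
    (laplaceCoeff_regular_odd (fun i => alpha d β h t i.1 i.2) (-alpha d β h t 2 0)
      (-alpha d β h t 0 2) (6 * M + 4) (2 * M)) ?_
    (exists_regular_expansion hκ hcrit hnd measurableSet_strip subset_rfl hclosed subset_rfl one_pos
      le_rfl (fun s u _ hu => ⟨trivial, abs_le.1 (by linarith [Real.pi_gt_three])⟩)
      (fun z _ => hmax z.1) M)
    (fun m hm => balancedSum_eq_integral t hκ hm)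
  · simpa only [hexp] using this
  · intro p hp
    rcases Nat.eq_zero_or_pos p with h0 | h0
    · subst h0
      rw [mul_zero, laplaceCoeff_zero le_of_mem_cubicIndices, gammaField, if_pos rfl, if_neg hβ]
      exact laplace_leading hnd
    · rw [gammaMax_eq_laplaceCoeff hβ ha hb h0 hp, gammaField, if_neg h0.ne']

lemma integral_strip_eq_two_mul {f : ℝ × ℝ → ℝ} (hf : IntegrableOn f strip)
    (heven : ∀ s u, f (-s, u) = f (s, u)) :
    ∫ z in strip, f z
      = 2 * ∫ z in Set.Ioi (0 : ℝ) ×ˢ Set.Icc (-Real.pi) Real.pi, f z := by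
  have hsub : Set.Ioi (0 : ℝ) ×ˢ Set.Icc (-Real.pi) Real.pi ⊆ strip :=
    Set.prod_mono (Set.subset_univ _) subset_rfl
  have h2 := hf.mono_set hsub
  rw [strip, Measure.volume_eq_prod] at *
  rw [setIntegral_prod _ hf, setIntegral_prod _ h2, Measure.restrict_univ, ← integral_comp_abs]
  refine integral_congr_ae (ae_of_all _ fun s => ?_)
  rcases abs_choice s with e | e
  · simp only [e]
  · simp only [e, heven]

/-- The asymptotic expansion below the critical temperature without field, where `ψ` has the two
maximum points `(±t, 0)`; by symmetry the integral is twice the one over positive `s`. -/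
lemma isLittleO_two_maxima {d : ℕ} {β t : ℝ} (hκ : 0 < 2 * d * β) (ht : 0 < t)
    (hcrit : 2 * d * β * Real.tanh t = t) (M : ℕ) :
    (fun n : ℕ => balancedSum d β 0 n - 2 ^ n * Real.exp (n * phi d β 0 t)
        * ∑ p ∈ Finset.range (M + 1), gammaLow d β t p * (n : ℝ) ^ (-(p : ℝ) - 1 / 2))
      =o[evenAtTop]
    (fun n : ℕ => (2 : ℝ) ^ n * Real.exp (n * phi d β 0 t) * (n : ℝ) ^ (-(M : ℝ) - 1 / 2)) := by
  have hβ : β ≠ 0 := fun e => by simp [e] at hκ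
  have hcrit' : 2 * d * β * Real.tanh t = t - |0| := by simpa using hcrit
  have hnd := inv_cosh_sq_lt hκ ht hcrit'
  have ha : 0 < -alpha d β 0 t 2 0 := by rw [alpha_two_zero]; linarith
  have hb := neg_alpha_zero_two_pos d β 0 t
  set r := 1 / (2 * Real.pi) ^ (3 / 2 : ℝ) * (2 * d * β) ^ (-1 / 2 : ℝ) with hr
  have hexp : ∀ p : ℕ, (-((2 * p + 1 : ℕ) / (2 * (1 : ℕ) : ℝ)) : ℝ) = -(p : ℝ) - 1 / 2 := fun p => by
    push_cast; ring
  have hδ : 0 < min 1 (t / 2) := by positivity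
  have := isLittleO_of_laplace (w := 1) le_rfl (Z := balancedSum d β 0)
    (X := fun n => Real.exp (n * phi d β 0 t)) (γ := gammaLow d β t) (M := M) (r := 2 * r)
    (laplaceCoeff_regular_odd (fun i => alpha d β 0 t i.1 i.2) (-alpha d β 0 t 2 0)
      (-alpha d β 0 t 0 2) (6 * M + 4) (2 * M)) ?_
    (exists_regular_expansion hκ hcrit' hnd (S := Set.Ioi 0 ×ˢ Set.Icc (-Real.pi) Real.pi)
      (T := Set.Ici 0 ×ˢ Set.Icc (-Real.pi) Real.pi)
      (measurableSet_Ioi.prod measurableSet_Icc)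
      (Set.prod_mono Set.Ioi_subset_Ici_self subset_rfl) (isClosed_Ici.prod isClosed_Icc)
      (Set.prod_mono (Set.subset_univ _) subset_rfl) hδ (min_le_left _ _)
      (fun s u hs hu => ⟨?_, abs_le.1 ?_⟩)
      (fun z hz hne => phi_lt_of_nonneg hκ ht hcrit' hz.1 hne) M)
    (fun m hm => ?_)
  · simpa only [hexp] using this
  · intro p hp
    rcases Nat.eq_zero_or_pos p with h0 | h0
    · subst h0
      rw [mul_zero, laplaceCoeff_zero le_of_mem_cubicIndices, gammaLow, if_pos rfl, mul_assoc, hr,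
        laplace_leading hnd]
      ring
    · rw [mul_assoc, hr, gammaMax_eq_laplaceCoeff hβ ha hb h0 hp, gammaLow, if_neg h0.ne']
  · have h1 := (abs_le.1 (hs.trans (min_le_right _ _))).1
    change 0 < t + s
    linarith
  · have := hu.trans (min_le_left _ _)
    linarith [Real.pi_gt_three]
  · have hint : IntegrableOn (fun z =>
        (density (2 * d * β) |0| z * Real.exp (-(2 * phi d β 0 t))) ^ m) strip := by
      simp_rw [mul_pow]
      exact (integral_density_pow hκ hm).1.mul_const _
    rw [balancedSum_eq_integral t hκ hm, integral_strip_eq_two_mul hint]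
    · ring
    · intro s u
      simp [density]

/-! ### The Taylor polynomials of `ψ` at the critical point -/

lemma norm_cosh_sub_sum_le (z : ℂ) (K : ℕ) :
    ‖Complex.cosh z - ∑ m ∈ Finset.range (K + 1), z ^ (2 * m) / ((2 * m)! : ℂ)‖
      ≤ ‖z‖ ^ (2 * K + 1) * Real.exp ‖z‖ := by
  have h1 := Complex.norm_exp_sub_sum_le_norm_mul_exp z (2 * K + 1)
  have h2 := Complex.norm_exp_sub_sum_le_norm_mul_exp (-z) (2 * K + 1)
  rw [norm_neg] at h2
  have hsum : ∑ m ∈ Finset.range (K + 1), z ^ (2 * m) / ((2 * m)! : ℂ)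
      = (1 / 2) * (∑ m ∈ Finset.range (2 * K + 1), z ^ m / (m ! : ℂ)
        + ∑ m ∈ Finset.range (2 * K + 1), (-z) ^ m / (m ! : ℂ)) := by
    rw [← Finset.sum_add_distrib, sum_range_even]
    · rw [Finset.mul_sum]
      refine Finset.sum_congr rfl fun m _ => ?_
      rw [(even_two_mul m).neg_pow]; ring
    · intro p
      rw [(odd_two_mul_add_one p).neg_pow]; ring
  have e : Complex.cosh z - ∑ m ∈ Finset.range (K + 1), z ^ (2 * m) / ((2 * m)! : ℂ)
      = (1 / 2) * ((Complex.exp z - ∑ m ∈ Finset.range (2 * K + 1), z ^ m / (m ! : ℂ))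
        + (Complex.exp (-z) - ∑ m ∈ Finset.range (2 * K + 1), (-z) ^ m / (m ! : ℂ))) := by
    rw [hsum, Complex.cosh]; ring
  rw [e, norm_mul]
  have h3 : ‖(1 / 2 : ℂ)‖ = 1 / 2 := by norm_num
  rw [h3]
  have := norm_add_le (Complex.exp z - ∑ m ∈ Finset.range (2 * K + 1), z ^ m / (m ! : ℂ))
    (Complex.exp (-z) - ∑ m ∈ Finset.range (2 * K + 1), (-z) ^ m / (m ! : ℂ))
  linarith

lemma abs_cosh_sub_sum_le (x : ℝ) (K : ℕ) :
    |Real.cosh x - ∑ m ∈ Finset.range (K + 1), x ^ (2 * m) / ((2 * m)! : ℝ)|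
      ≤ |x| ^ (2 * K + 1) * Real.exp |x| := by
  have h := norm_cosh_sub_sum_le (x : ℂ) K
  rw [Complex.norm_real, Real.norm_eq_abs] at h
  rw [← Real.norm_eq_abs (_ - _), ← Complex.norm_real]
  push_cast
  exact h

lemma abs_cos_sub_sum_le (x : ℝ) (K : ℕ) :
    |Real.cos x - ∑ m ∈ Finset.range (K + 1), (-1) ^ m * x ^ (2 * m) / ((2 * m)! : ℝ)|
      ≤ |x| ^ (2 * K + 1) * Real.exp |x| := by
  have h := norm_cosh_sub_sum_le (x * Complex.I) K
  rw [norm_mul, Complex.norm_I, mul_one, Complex.norm_real, Real.norm_eq_abs,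
    Complex.cosh_mul_I] at h
  rw [← Real.norm_eq_abs (_ - _), ← Complex.norm_real]
  push_cast
  convert h using 6 with m
  rw [mul_pow, pow_mul Complex.I, Complex.I_sq]; ring

/-- The Taylor polynomial of `cosh (2 s) / 2 + cos u / 2 - 1`. -/
noncomputable def coshCosPoly (K : ℕ) (s u : ℝ) : ℝ :=
  ∑ m ∈ Finset.Icc 1 K, 1 / 2 * (1 / ((2 * m)! : ℝ)) * ((2 * s) ^ (2 * m) + (-1) ^ m * u ^ (2 * m))

lemma abs_sub_coshCosPoly_le (K : ℕ) :
    ∃ C, 0 ≤ C ∧ ∀ s u : ℝ, |s| ≤ 1 / 4 → |u| ≤ 1 / 4 →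
      |(1 / 2 * Real.cosh (2 * s) + 1 / 2 * Real.cos u - 1) - coshCosPoly K s u|
        ≤ C * (|s| ^ (K + 1) + |u| ^ (K + 1)) := by
  refine ⟨2 ^ (2 * K + 1) * Real.exp 1, by positivity, fun s u hs hu => ?_⟩
  have e : (1 / 2 * Real.cosh (2 * s) + 1 / 2 * Real.cos u - 1) - coshCosPoly K s u
      = 1 / 2 * (Real.cosh (2 * s) - ∑ m ∈ Finset.range (K + 1), (2 * s) ^ (2 * m) / ((2 * m)! : ℝ))
        + 1 / 2 * (Real.cos u
          - ∑ m ∈ Finset.range (K + 1), (-1) ^ m * u ^ (2 * m) / ((2 * m)! : ℝ)) := by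
    have hr : Finset.range (K + 1) = insert 0 (Finset.Icc 1 K) := by
      ext x; simp only [Finset.mem_range, Finset.mem_insert, Finset.mem_Icc]; omega
    have h0 : (0 : ℕ) ∉ Finset.Icc 1 K := by simp
    have hW : coshCosPoly K s u = 1 / 2 * ∑ m ∈ Finset.Icc 1 K, (2 * s) ^ (2 * m) / ((2 * m)! : ℝ)
        + 1 / 2 * ∑ m ∈ Finset.Icc 1 K, (-1) ^ m * u ^ (2 * m) / ((2 * m)! : ℝ) := by
      rw [coshCosPoly, Finset.mul_sum, Finset.mul_sum, ← Finset.sum_add_distrib]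
      exact Finset.sum_congr rfl fun m _ => by ring
    rw [hr, Finset.sum_insert h0, Finset.sum_insert h0, hW]
    norm_num
    ring
  have h1 := abs_cosh_sub_sum_le (2 * s) K
  have h2 := abs_cos_sub_sum_le u K
  have h3 : |2 * s| ^ (2 * K + 1) * Real.exp |2 * s|
      ≤ 2 ^ (2 * K + 1) * |s| ^ (K + 1) * Real.exp 1 := by
    rw [abs_mul, abs_two, mul_pow]
    gcongr 2 ^ (2 * K + 1) * ?_ * Real.exp ?_
    · exact pow_le_pow_of_le_one (abs_nonneg _) (by linarith) (by omega)
    · linarith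
  have h4 : |u| ^ (2 * K + 1) * Real.exp |u| ≤ 2 ^ (2 * K + 1) * |u| ^ (K + 1) * Real.exp 1 := by
    gcongr ?_ * Real.exp ?_
    · have h5 : |u| ^ (2 * K + 1) ≤ |u| ^ (K + 1) :=
        pow_le_pow_of_le_one (abs_nonneg _) (by linarith) (by omega)
      have h6 : (1 : ℝ) ≤ 2 ^ (2 * K + 1) := one_le_pow₀ (by norm_num)
      have h7 : 0 ≤ |u| ^ (K + 1) := by positivity
      nlinarith
    · linarith
  have h8 : 0 ≤ 2 ^ (2 * K + 1) * Real.exp 1 * (|s| ^ (K + 1) + |u| ^ (K + 1)) := by positivity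
  rw [e]
  refine (abs_add_le _ _).trans ?_
  rw [abs_mul, abs_mul, abs_of_pos (by norm_num : (0 : ℝ) < 1 / 2)]
  calc _ ≤ 1 / 2 * (2 ^ (2 * K + 1) * |s| ^ (K + 1) * Real.exp 1)
        + 1 / 2 * (2 ^ (2 * K + 1) * |u| ^ (K + 1) * Real.exp 1) := by
        gcongr
        · exact h1.trans h3
        · exact h2.trans h4
    _ = 1 / 2 * (2 ^ (2 * K + 1) * Real.exp 1 * (|s| ^ (K + 1) + |u| ^ (K + 1))) := by ring
    _ ≤ _ := by linarith

lemma abs_cosh_add_cos_sub_one_le {s u : ℝ} (hs : |s| ≤ 1 / 4) :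
    |1 / 2 * Real.cosh (2 * s) + 1 / 2 * Real.cos u - 1| ≤ 2 * (s ^ 2 + u ^ 2) := by
  have hs2 : s ^ 2 ≤ 1 / 16 := by
    rw [← sq_abs]
    nlinarith [abs_nonneg s]
  have h1 : Real.cosh (2 * s) - 1 ≤ 4 * s ^ 2 := by
    have h := Real.cosh_le_exp_half_sq (2 * s)
    have h2 := Real.abs_exp_sub_one_le (x := (2 * s) ^ 2 / 2)
      (by rw [abs_of_nonneg (by positivity)]; linarith)
    rw [abs_of_nonneg (by positivity : 0 ≤ (2 * s) ^ 2 / 2)] at h2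
    have := le_abs_self (Real.exp ((2 * s) ^ 2 / 2) - 1)
    linarith
  have h2 := Real.one_le_cosh (2 * s)
  have h3 := Real.one_sub_sq_div_two_le_cos (x := u)
  have h4 := Real.cos_le_one u
  rw [abs_le]
  constructor <;> nlinarith [sq_nonneg s, sq_nonneg u]

/-- The logarithmic series at `cosh (2 s) / 2 + cos u / 2`, truncated at order `K` together with the
series of `cosh` and `cos`. -/
lemma abs_log_sub_sum_le (K : ℕ) :
    ∃ C, 0 ≤ C ∧ ∀ s u : ℝ, |s| ≤ 1 / 4 → |u| ≤ 1 / 4 →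
      |Real.log (1 / 2 * Real.cosh (2 * s) + 1 / 2 * Real.cos u)
        - ∑ n ∈ Finset.Icc 1 K, (-1) ^ (n - 1) / (n : ℝ) * coshCosPoly K s u ^ n|
        ≤ C * (|s| ^ (K + 1) + |u| ^ (K + 1)) := by
  obtain ⟨C₁, hC₁0, hC₁⟩ := abs_sub_coshCosPoly_le K
  refine ⟨2 * (2 ^ (K + 1) * 2 ^ K) + ∑ n ∈ Finset.Icc 1 K, C₁ * n * (K + 1) ^ (n - 1),
    by positivity, fun s u hs hu => ?_⟩
  set x := 1 / 2 * Real.cosh (2 * s) + 1 / 2 * Real.cos u - 1 with hx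
  set W := coshCosPoly K s u with hW
  set g := |s| ^ (K + 1) + |u| ^ (K + 1) with hg
  have hg0 : 0 ≤ g := by positivity
  have hxs : |x| ≤ 2 * (s ^ 2 + u ^ 2) := abs_cosh_add_cos_sub_one_le hs
  have hs2 : s ^ 2 ≤ 1 / 16 := by rw [← sq_abs]; nlinarith [abs_nonneg s]
  have hu2 : u ^ 2 ≤ 1 / 16 := by rw [← sq_abs]; nlinarith [abs_nonneg u]
  have hx1 : |x| ≤ 1 / 2 := by linarith
  have hxK : |x| ^ (K + 1) ≤ 2 ^ (K + 1) * 2 ^ K * g := by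
    have hpow : ∀ v : ℝ, |v| ≤ 1 / 4 → (v ^ 2) ^ (K + 1) ≤ |v| ^ (K + 1) := fun v hv => by
      rw [← sq_abs, ← pow_mul]
      exact pow_le_pow_of_le_one (abs_nonneg _) (by linarith) (by omega)
    calc |x| ^ (K + 1) ≤ (2 * (s ^ 2 + u ^ 2)) ^ (K + 1) := by gcongr
      _ = 2 ^ (K + 1) * (s ^ 2 + u ^ 2) ^ (K + 1) := mul_pow _ _ _
      _ ≤ 2 ^ (K + 1) * (2 ^ (K + 1 - 1) * ((s ^ 2) ^ (K + 1) + (u ^ 2) ^ (K + 1))) := by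
          gcongr; exact add_pow_le (sq_nonneg s) (sq_nonneg u) _
      _ ≤ 2 ^ (K + 1) * (2 ^ K * g) := by
          rw [Nat.add_sub_cancel, hg]
          gcongr 2 ^ (K + 1) * (2 ^ K * ?_)
          exact add_le_add (hpow s hs) (hpow u hu)
      _ = _ := by ring
  have hlog : |Real.log (1 + x) - ∑ n ∈ Finset.Icc 1 K, (-1) ^ (n - 1) / (n : ℝ) * x ^ n|
      ≤ 2 * (2 ^ (K + 1) * 2 ^ K * g) := by
    have h := Real.abs_log_sub_add_sum_range_le (x := -x) (by rw [abs_neg]; linarith) K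
    rw [sub_neg_eq_add, abs_neg] at h
    have hsum : ∑ n ∈ Finset.Icc 1 K, (-1) ^ (n - 1) / (n : ℝ) * x ^ n
        = -∑ i ∈ Finset.range K, (-x) ^ (i + 1) / ((i : ℝ) + 1) := by
      have hI : Finset.Icc 1 K = (Finset.range K).image (· + 1) := by
        ext y
        simp only [Finset.mem_Icc, Finset.mem_image, Finset.mem_range]
        exact ⟨fun hy => ⟨y - 1, by omega, by omega⟩, fun ⟨a, ha, hb⟩ => by omega⟩
      rw [hI, Finset.sum_image (by intro a _ b _ hab; exact Nat.succ_injective hab),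
        ← Finset.sum_neg_distrib]
      refine Finset.sum_congr rfl fun i _ => ?_
      rw [Nat.add_sub_cancel, neg_pow x (i + 1), pow_succ (-1 : ℝ) i]
      push_cast
      ring
    rw [hsum, sub_neg_eq_add, add_comm]
    refine h.trans ?_
    rw [div_le_iff₀ (by linarith)]
    have : 0 ≤ 2 ^ (K + 1) * 2 ^ K * g := by positivity
    nlinarith
  have hWK : |W| ≤ K := by
    rw [hW, coshCosPoly]
    calc _ ≤ ∑ m ∈ Finset.Icc 1 K, (1 : ℝ) := by
          refine (Finset.abs_sum_le_sum_abs _ _).trans (Finset.sum_le_sum fun m _ => ?_)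
          have h1 : (1 : ℝ) ≤ (2 * m)! := by exact_mod_cast Nat.factorial_pos _
          have h2 : |(2 * s) ^ (2 * m) + (-1) ^ m * u ^ (2 * m)| ≤ 2 := by
            refine (abs_add_le _ _).trans ?_
            rw [abs_mul, abs_pow, abs_pow, abs_pow, abs_neg, abs_one, one_pow, one_mul, abs_mul,
              abs_two]
            have h3 : (2 * |s|) ^ (2 * m) ≤ 1 := pow_le_one₀ (by positivity) (by linarith)
            have h4 : |u| ^ (2 * m) ≤ 1 := pow_le_one₀ (by positivity) (by linarith)
            linarith
          rw [abs_mul, abs_of_nonneg (by positivity)]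
          calc _ ≤ 1 / 2 * (1 : ℝ) * 2 := by
                gcongr
                rw [div_le_one (by positivity)]; exact h1
            _ = 1 := by norm_num
      _ = K := by simp
  have hpoly : |∑ n ∈ Finset.Icc 1 K, (-1) ^ (n - 1) / (n : ℝ) * x ^ n
      - ∑ n ∈ Finset.Icc 1 K, (-1) ^ (n - 1) / (n : ℝ) * W ^ n|
      ≤ (∑ n ∈ Finset.Icc 1 K, C₁ * n * (K + 1) ^ (n - 1)) * g := by
    rw [← Finset.sum_sub_distrib, Finset.sum_mul]
    refine (Finset.abs_sum_le_sum_abs _ _).trans (Finset.sum_le_sum fun n hn => ?_)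
    have hn1 : (1 : ℝ) ≤ n := by exact_mod_cast (Finset.mem_Icc.1 hn).1
    rw [← mul_sub, abs_mul, abs_div, abs_pow, abs_neg, abs_one, one_pow, Nat.abs_cast]
    have hK0 : (0 : ℝ) ≤ K := Nat.cast_nonneg K
    calc _ ≤ 1 * (|x - W| * n * max |x| |W| ^ (n - 1)) := by
          gcongr
          · rw [div_le_one (by linarith)]; exact hn1
          · exact abs_pow_sub_pow_le x W n
      _ ≤ 1 * ((C₁ * g) * n * (K + 1) ^ (n - 1)) := by
          gcongr
          · exact hC₁ s u hs hu
          · exact max_le (by linarith) (by linarith)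
      _ = _ := by ring
  have e : 1 / 2 * Real.cosh (2 * s) + 1 / 2 * Real.cos u = 1 + x := by rw [hx]; ring
  rw [e]
  calc _ ≤ _ := abs_sub_le _ _ _
    _ ≤ _ := add_le_add hlog hpoly
    _ = _ := by ring

/-- The coefficient of `s ^ (2 p) u ^ (2 q)` in half the truncated logarithmic series at
`cosh (2 s) / 2 + cos u / 2`. The choice `j i ∈ {m i, 0}` says whether the `i`-th factor
contributes its `cosh` or its `cos` term. It is `alphaCrit p q` when `p + q` does not exceed the
truncation order. -/
noncomputable def truncCoeff (K p q : ℕ) : ℝ :=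
  (2 : ℝ) ^ (2 * (p : ℤ) - 1) * (-1) ^ q *
    ∑ n ∈ Finset.Icc 1 K, (-1 : ℝ) ^ (n - 1) / (n * 2 ^ n) *
      ∑ m ∈ Fintype.piFinset (fun _ : Fin n => Finset.Icc 1 K), (∏ i, 1 / ((2 * m i)! : ℝ)) *
        ∑ j ∈ Fintype.piFinset fun i => ({m i, 0} : Finset ℕ),
          if ∑ i, j i = p ∧ ∑ i, (m i - j i) = q then (1 : ℝ) else 0

lemma sum_add_sum_sub {n : ℕ} {m j : Fin n → ℕ}
    (hj : j ∈ Fintype.piFinset fun i => ({m i, 0} : Finset ℕ)) :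
    ∑ i, j i + ∑ i, (m i - j i) = ∑ i, m i := by
  rw [← Finset.sum_add_distrib]
  refine Finset.sum_congr rfl fun i _ => ?_
  have := Fintype.mem_piFinset.1 hj i
  simp only [Finset.mem_insert, Finset.mem_singleton] at this
  omega

/-- Compositions of `p + q` have at most `p + q` parts, each at most `p + q`, so truncation does not
affect the coefficients of low order. -/
lemma truncCoeff_eq {K p q : ℕ} (h : p + q ≤ K) : truncCoeff K p q = alphaCrit p q := by
  rw [truncCoeff, alphaCrit]
  congr 1
  symm
  refine Finset.sum_subset_zero_on_sdiff (Finset.Icc_subset_Icc_right h) (fun n hn => ?_)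
    (fun n hn => ?_)
  · rw [Finset.mem_sdiff, Finset.mem_Icc, Finset.mem_Icc] at hn
    rw [Finset.sum_eq_zero, mul_zero]
    intro m hm
    rw [Finset.sum_eq_zero, mul_zero]
    intro j hj
    rw [if_neg]
    rintro ⟨h1, h2⟩
    have h3 := sum_add_sum_sub hj
    have h4 : n ≤ ∑ i, m i := by
      calc n = ∑ _i : Fin n, 1 := by simp
        _ ≤ _ := Finset.sum_le_sum fun i _ =>
          (Finset.mem_Icc.1 (Fintype.mem_piFinset.1 hm i)).1
    omega
  · congr 1
    refine Finset.sum_subset_zero_on_sdiff (fun m hm => ?_) (fun m hm => ?_) fun m _ => rfl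
    · rw [compositions, Finset.mem_filter, Fintype.mem_piFinset] at hm
      rw [Fintype.mem_piFinset]
      exact fun i => Finset.Icc_subset_Icc_right h (hm.1 i)
    · rw [Finset.mem_sdiff, Fintype.mem_piFinset, compositions, Finset.mem_filter,
        Fintype.mem_piFinset] at hm
      rw [Finset.sum_eq_zero, mul_zero]
      intro j hj
      rw [if_neg]
      rintro ⟨h1, h2⟩
      have h3 := sum_add_sum_sub hj
      refine hm.2 ⟨fun i => ?_, by omega⟩
      have h4 := Finset.mem_Icc.1 (hm.1 i)
      have h5 := Finset.single_le_sum (f := m) (fun _ _ => Nat.zero_le _) (Finset.mem_univ i)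
      exact Finset.mem_Icc.2 ⟨h4.1, by omega⟩

lemma coshCosPoly_pow (K n : ℕ) (s u : ℝ) :
    coshCosPoly K s u ^ n = 1 / 2 ^ n * ∑ m ∈ Fintype.piFinset (fun _ : Fin n => Finset.Icc 1 K),
      (∏ i, 1 / ((2 * m i)! : ℝ)) * ∑ j ∈ Fintype.piFinset fun i => ({m i, 0} : Finset ℕ),
        (2 * s) ^ (2 * ∑ i, j i) * ((-1) ^ (∑ i, (m i - j i)) * u ^ (2 * ∑ i, (m i - j i))) := by
  have h := Finset.prod_univ_sum (fun _ : Fin n => Finset.Icc 1 K) (fun _ m =>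
    1 / 2 * (1 / ((2 * m)! : ℝ)) * ((2 * s) ^ (2 * m) + (-1) ^ m * u ^ (2 * m)))
  rw [Finset.prod_const, Finset.card_univ, Fintype.card_fin] at h
  rw [coshCosPoly, h, Finset.mul_sum]
  refine Finset.sum_congr rfl fun m hm => ?_
  rw [Finset.prod_mul_distrib, Finset.prod_mul_distrib, Finset.prod_const, Finset.card_univ,
    Fintype.card_fin, mul_assoc, one_div_pow]
  congr 2
  have hpair : ∀ i, (2 * s) ^ (2 * m i) + (-1) ^ m i * u ^ (2 * m i)
      = ∑ j ∈ ({m i, 0} : Finset ℕ), (2 * s) ^ (2 * j) * ((-1) ^ (m i - j) * u ^ (2 * (m i - j))) := by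
    intro i
    have : m i ≠ 0 := by
      have := (Finset.mem_Icc.1 (Fintype.mem_piFinset.1 hm i)).1
      omega
    rw [Finset.sum_pair this]
    simp
  rw [Finset.prod_congr rfl fun i _ => hpair i, Finset.prod_univ_sum]
  refine Finset.sum_congr rfl fun j _ => ?_
  rw [Finset.prod_mul_distrib, Finset.prod_mul_distrib, Finset.prod_pow_eq_pow_sum,
    Finset.prod_pow_eq_pow_sum, Finset.prod_pow_eq_pow_sum, Finset.mul_sum, Finset.mul_sum]

lemma half_sum_coshCosPoly_pow (K : ℕ) (s u : ℝ) :
    1 / 2 * ∑ n ∈ Finset.Icc 1 K, (-1) ^ (n - 1) / (n : ℝ) * coshCosPoly K s u ^ n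
      = ∑ i ∈ Finset.range (K * K + 1) ×ˢ Finset.range (K * K + 1),
        truncCoeff K i.1 i.2 * s ^ (2 * i.1) * u ^ (2 * i.2) := by
  have hR : ∀ i : ℕ × ℕ, truncCoeff K i.1 i.2 * s ^ (2 * i.1) * u ^ (2 * i.2)
      = ∑ n ∈ Finset.Icc 1 K, 1 / 2 * ((-1) ^ (n - 1) / (n : ℝ)) * (1 / 2 ^ n) *
        ∑ m ∈ Fintype.piFinset (fun _ : Fin n => Finset.Icc 1 K), (∏ i, 1 / ((2 * m i)! : ℝ)) *
          ∑ j ∈ Fintype.piFinset fun i => ({m i, 0} : Finset ℕ),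
            if (∑ i, j i, ∑ i, (m i - j i)) = i then
              (2 * s) ^ (2 * ∑ i, j i) * ((-1) ^ (∑ i, (m i - j i)) * u ^ (2 * ∑ i, (m i - j i)))
            else 0 := by
    rintro ⟨p, q⟩
    rw [truncCoeff, mul_assoc, mul_comm, ← mul_assoc, Finset.mul_sum]
    refine Finset.sum_congr rfl fun n _ => ?_
    rw [← mul_assoc, mul_comm _ ((-1 : ℝ) ^ (n - 1) / (n * 2 ^ n)), mul_assoc, Finset.mul_sum,
      Finset.mul_sum, Finset.mul_sum]
    refine Finset.sum_congr rfl fun m _ => ?_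
    simp only [Finset.mul_sum]
    refine Finset.sum_congr rfl fun j _ => ?_
    simp only [Prod.mk.injEq]
    split_ifs with hc
    · obtain ⟨rfl, rfl⟩ := hc
      have e : (2 : ℝ) ^ (2 * ((∑ i, j i : ℕ) : ℤ) - 1) = 1 / 2 * 2 ^ (2 * ∑ i, j i) := by
        rw [zpow_sub₀ two_ne_zero, zpow_one, ← Nat.cast_ofNat (R := ℤ) (n := 2), ← Nat.cast_mul,
          zpow_natCast]
        ring
      simp only [← Finset.mul_sum]
      rw [e, mul_pow]
      field_simp
    · ring
  simp_rw [hR]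
  rw [Finset.sum_comm, Finset.mul_sum]
  refine Finset.sum_congr rfl fun n hn => ?_
  rw [← Finset.mul_sum, Finset.sum_comm, coshCosPoly_pow, ← mul_assoc, ← mul_assoc]
  congr 1
  refine Finset.sum_congr rfl fun m hm => ?_
  rw [← Finset.mul_sum, Finset.sum_comm]
  congr 1
  refine Finset.sum_congr rfl fun j hj => ?_
  rw [Finset.sum_ite_eq, if_pos]
  have h1 := sum_add_sum_sub hj
  have h2 : ∑ i, m i ≤ K * K := by
    calc ∑ i, m i ≤ ∑ _i : Fin n, K := Finset.sum_le_sum fun i _ =>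
          (Finset.mem_Icc.1 (Fintype.mem_piFinset.1 hm i)).2
      _ = n * K := by simp
      _ ≤ K * K := Nat.mul_le_mul_right K (Finset.mem_Icc.1 hn).2
  rw [Finset.mem_product, Finset.mem_range, Finset.mem_range]
  dsimp only
  omega

lemma alphaCrit_zero_zero : alphaCrit 0 0 = 0 := by simp [alphaCrit]

lemma alphaCrit_one_zero : alphaCrit 1 0 = 1 / 2 := by
  have h1 : compositions 1 1 = {fun _ => 1} := by decide
  have h2 : ((Fintype.piFinset fun _ : Fin 1 => ({1, 0} : Finset ℕ)).filter
      fun j => ∑ i, j i = 1 ∧ ∑ i, (1 - j i) = 0).card = 1 := by decide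
  rw [alphaCrit, show Finset.Icc 1 (1 + 0) = {1} by decide, Finset.sum_singleton, h1,
    Finset.sum_singleton, Finset.sum_boole, h2]
  norm_num

lemma alphaCrit_zero_one : alphaCrit 0 1 = -(1 / 8) := by
  have h1 : compositions 1 1 = {fun _ => 1} := by decide
  have h2 : ((Fintype.piFinset fun _ : Fin 1 => ({1, 0} : Finset ℕ)).filter
      fun j => ∑ i, j i = 0 ∧ ∑ i, (1 - j i) = 1).card = 1 := by decide
  rw [alphaCrit, show Finset.Icc 1 (0 + 1) = {1} by decide, Finset.sum_singleton, h1,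
    Finset.sum_singleton, Finset.sum_boole, h2]
  norm_num

lemma alphaCrit_two_zero : alphaCrit 2 0 = -(1 / 12) := by
  have h1 : compositions 2 1 = {fun _ => 2} := by decide
  have h2 : compositions 2 2 = {fun _ => 1} := by decide
  have h3 : ((Fintype.piFinset fun _ : Fin 1 => ({2, 0} : Finset ℕ)).filter
      fun j => ∑ i, j i = 2 ∧ ∑ i, (2 - j i) = 0).card = 1 := by decide
  have h4 : ((Fintype.piFinset fun _ : Fin 2 => ({1, 0} : Finset ℕ)).filter
      fun j => ∑ i, j i = 2 ∧ ∑ i, (1 - j i) = 0).card = 1 := by decide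
  have hI : Finset.Icc 1 (2 + 0) = {1, 2} := by decide
  rw [alphaCrit, hI, Finset.sum_pair (by decide), h1, h2, Finset.sum_singleton,
    Finset.sum_singleton, Finset.sum_boole, Finset.sum_boole, h3, h4]
  norm_num [Nat.factorial]

/-! ### The critical temperature -/

/-- The halved exponent pairs of the Taylor monomials of weight above `4` at criticality. -/
def quinticIndices (K : ℕ) : Finset (ℕ × ℕ) :=
  {i ∈ Finset.range (K * K + 1) ×ˢ Finset.range (K * K + 1) | i.1 + i.2 ≤ K ∧ 3 ≤ i.1 + 2 * i.2}

lemma le_of_mem_quinticIndices {K : ℕ} :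
    ∀ i ∈ quinticIndices K, 2 * 2 + 1 ≤ 2 * i.1 + 2 * (2 * i.2) :=
  fun i hi => by have := (Finset.mem_filter.1 hi).2; omega

/-- Taylor expansion of the critical `ψ` at the origin. -/
lemma exists_psi_taylor_crit {d : ℕ} {β : ℝ} (hκ : 2 * d * β = 1) {K : ℕ} (hK : 2 ≤ K) :
    ∃ C, 0 ≤ C ∧ ∀ s u, |s| ≤ 1 / 4 → |u| ≤ 1 / 4 →
      |psi d β 0 (0 + s) u - phi d β 0 0 + (1 / 12 * s ^ (2 * 2) + 1 / 8 * u ^ 2)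
        - monomialSum (quinticIndices K) (fun i => alphaCrit i.1 i.2) (fun i => 2 * i.1)
            (fun i => 2 * i.2) s u| ≤ C * (|s| ^ (K + 1) + |u| ^ (K + 1)) := by
  obtain ⟨C, hC0, hC⟩ := abs_log_sub_sum_le K
  set R := Finset.range (K * K + 1) ×ˢ Finset.range (K * K + 1) with hR
  set C' := ∑ i ∈ R, |truncCoeff K i.1 i.2| with hC'
  refine ⟨1 / 2 * C + C', by positivity, fun s u hs hu => ?_⟩
  set g := |s| ^ (K + 1) + |u| ^ (K + 1) with hg
  have hg0 : 0 ≤ g := by positivity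
  have hlow : (R.filter fun i => i.1 + i.2 ≤ K).filter (fun i => ¬ 3 ≤ i.1 + 2 * i.2)
      = {(0, 0), (1, 0), (2, 0), (0, 1)} := by
    ext ⟨x, y⟩
    have hKK : 2 * K ≤ K * K := Nat.mul_le_mul_right K hK
    simp only [hR, Finset.mem_filter, Finset.mem_product, Finset.mem_range, Finset.mem_insert,
      Finset.mem_singleton, Prod.mk.injEq]
    omega
  have hsmall : ∑ i ∈ R with i.1 + i.2 ≤ K, truncCoeff K i.1 i.2 * s ^ (2 * i.1) * u ^ (2 * i.2)
      = monomialSum (quinticIndices K) (fun i => alphaCrit i.1 i.2) (fun i => 2 * i.1)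
            (fun i => 2 * i.2) s u + (1 / 2 * s ^ 2 - 1 / 12 * s ^ 4 - 1 / 8 * u ^ 2) := by
    rw [Finset.sum_congr rfl fun i hi => by rw [truncCoeff_eq (Finset.mem_filter.1 hi).2],
      ← Finset.sum_filter_add_sum_filter_not _ (fun i => 3 ≤ i.1 + 2 * i.2), hlow,
      Finset.filter_filter]
    congr 1
    rw [Finset.sum_insert (by decide), Finset.sum_insert (by decide), Finset.sum_insert (by decide),
      Finset.sum_singleton, alphaCrit_zero_zero, alphaCrit_one_zero, alphaCrit_two_zero,
      alphaCrit_zero_one]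
    ring
  have hlarge : |∑ i ∈ R with ¬ i.1 + i.2 ≤ K,
      truncCoeff K i.1 i.2 * s ^ (2 * i.1) * u ^ (2 * i.2)| ≤ C' * g := by
    rw [hC', Finset.sum_mul]
    refine ((Finset.abs_sum_le_sum_abs _ _).trans (Finset.sum_le_sum fun i hi => ?_)).trans
      (Finset.sum_le_sum_of_subset_of_nonneg (Finset.filter_subset _ _)
        fun i _ _ => by positivity)
    rw [abs_mul, abs_mul, abs_pow, abs_pow, mul_assoc]
    refine mul_le_mul_of_nonneg_left ?_ (abs_nonneg _)
    have hi' := (Finset.mem_filter.1 hi).2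
    -- the larger of `|s|`, `|u|` carries the whole power
    have hmax : max |s| |u| ^ (K + 1) ≤ g := by
      rcases max_choice |s| |u| with h | h <;> rw [h, hg]
      · have : 0 ≤ |u| ^ (K + 1) := by positivity
        linarith
      · have : 0 ≤ |s| ^ (K + 1) := by positivity
        linarith
    calc |s| ^ (2 * i.1) * |u| ^ (2 * i.2)
        ≤ max |s| |u| ^ (2 * i.1) * max |s| |u| ^ (2 * i.2) := by
          gcongr
          · exact le_max_left _ _
          · exact le_max_right _ _
      _ = max |s| |u| ^ (2 * i.1 + 2 * i.2) := (pow_add _ _ _).symm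
      _ ≤ max |s| |u| ^ (K + 1) := pow_le_pow_of_le_one (le_max_of_le_left (abs_nonneg _))
          (max_le (by linarith) (by linarith)) (by omega)
      _ ≤ g := hmax
  have hlog := hC s u hs hu
  have hsplit := half_sum_coshCosPoly_pow K s u
  rw [← hR, ← Finset.sum_filter_add_sum_filter_not R (fun i => i.1 + i.2 ≤ K), hsmall] at hsplit
  have hφ : phi d β 0 0 = 0 := by simp [phi]
  have hψ : psi d β 0 (0 + s) u
      = 1 / 2 * Real.log (1 / 2 * Real.cosh (2 * s) + 1 / 2 * Real.cos u) - 1 / 2 * s ^ 2 := by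
    rw [psi, hκ, abs_zero, sub_zero, zero_add, div_one]; ring
  rw [hφ, hψ]
  set Λ := Real.log (1 / 2 * Real.cosh (2 * s) + 1 / 2 * Real.cos u)
  set T₁ := ∑ n ∈ Finset.Icc 1 K, (-1) ^ (n - 1) / (n : ℝ) * coshCosPoly K s u ^ n
  set T₂ := ∑ i ∈ R with ¬ i.1 + i.2 ≤ K, truncCoeff K i.1 i.2 * s ^ (2 * i.1) * u ^ (2 * i.2)
  set Q := monomialSum (quinticIndices K) (fun i => alphaCrit i.1 i.2) (fun i => 2 * i.1)
            (fun i => 2 * i.2) s u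
  have e : 1 / 2 * Λ - 1 / 2 * s ^ 2 - 0 + (1 / 12 * s ^ (2 * 2) + 1 / 8 * u ^ 2) - Q
      = 1 / 2 * (Λ - T₁) + T₂ := by linear_combination hsplit
  rw [e]
  calc _ ≤ |1 / 2 * (Λ - T₁)| + |T₂| := abs_add_le _ _
    _ ≤ 1 / 2 * (C * g) + C' * g := by
        rw [abs_mul, abs_of_pos (by norm_num : (0 : ℝ) < 1 / 2)]
        gcongr
    _ = _ := by ring

lemma excess_quintic {K k : ℕ} {f : Fin k → ℕ × ℕ}
    (hf : f ∈ Fintype.piFinset fun _ : Fin k => quinticIndices K) :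
    excess (fun i : ℕ × ℕ => 2 * i.1) (fun i => 2 * i.2) 2 f + 4 * k
      = 2 * (∑ j, (f j).1 + 2 * ∑ j, (f j).2) := by
  have h1 := excess_add (p := fun i : ℕ × ℕ => 2 * i.1) (q := fun i => 2 * i.2) (w := 2)
    fun j => le_of_mem_quinticIndices _ (Fintype.mem_piFinset.1 hf j)
  rw [← Finset.mul_sum, ← Finset.mul_sum] at h1
  omega

lemma laplaceCoeff_crit_odd (c : ℕ × ℕ → ℝ) (a b : ℝ) (K L p : ℕ) :
    laplaceCoeff (quinticIndices K) c (fun i => 2 * i.1) (fun i => 2 * i.2) 2 a b L (2 * p + 1)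
      = 0 := by
  refine Finset.sum_eq_zero fun k _ => ?_
  rw [Finset.sum_eq_zero, mul_zero]
  intro f hf
  have := excess_quintic hf
  rw [if_neg (by omega)]

/-- At criticality at most `p` monomials can have total excess `2 p`; as `P + 2 Q = p + 2 k ≤ 3 p`,
the cutoff `K ≥ 3 p` is harmless. -/
lemma laplaceCoeff_crit_even (c : ℕ × ℕ → ℝ) (a b : ℝ) {K L p : ℕ} (hp : 1 ≤ p) (hL : 2 * p ≤ L)
    (hK : 3 * p ≤ K) :
    laplaceCoeff (quinticIndices K) c (fun i => 2 * i.1) (fun i => 2 * i.2) 2 a b L (2 * p)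
      = ∑ k ∈ Finset.Icc 1 p, 1 / (k ! : ℝ) * ∑ f ∈ critIndices p k,
        (∏ j, c (f j)) * (moment 2 a (2 * ∑ j, (f j).1) * moment 1 b (2 * ∑ j, (f j).2)) := by
  rw [laplaceCoeff]
  have hsub : Finset.Icc 1 p ⊆ Finset.range (L + 1) := fun k hk => by
    rw [Finset.mem_Icc] at hk
    rw [Finset.mem_range]; omega
  rw [← Finset.sum_subset hsub]
  · refine Finset.sum_congr rfl fun k hk => ?_
    rw [Finset.mem_Icc] at hk
    congr 1
    rw [← Finset.sum_filter]
    simp_rw [← Finset.mul_sum]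
    refine Finset.sum_congr ?_ fun _ _ => rfl
    ext f
    rw [Finset.mem_filter, critIndices, Finset.mem_filter]
    have hle : ∀ j, (f j).1 ≤ ∑ j, (f j).1 ∧ (f j).2 ≤ ∑ j, (f j).2 := fun j =>
      ⟨Finset.single_le_sum (f := fun j => (f j).1) (fun _ _ => Nat.zero_le _) (Finset.mem_univ j),
        Finset.single_le_sum (f := fun j => (f j).2) (fun _ _ => Nat.zero_le _) (Finset.mem_univ j)⟩
    constructor
    · rintro ⟨hmem, hex⟩
      have h1 := excess_quintic hmem
      refine ⟨?_, fun j => ?_, by omega⟩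
      · rw [Fintype.mem_piFinset]
        intro j
        have := hle j
        rw [Finset.mem_product, Finset.mem_range, Finset.mem_range]
        omega
      · exact (Finset.mem_filter.1 (Fintype.mem_piFinset.1 hmem j)).2.2
    · rintro ⟨-, h3, hsum⟩
      have hmem : f ∈ Fintype.piFinset fun _ : Fin k => quinticIndices K := by
        rw [Fintype.mem_piFinset]
        intro j
        have := hle j
        have hKK : K ≤ K * K := Nat.le_mul_self K
        rw [quinticIndices, Finset.mem_filter, Finset.mem_product, Finset.mem_range,
          Finset.mem_range]
        exact ⟨⟨by omega, by omega⟩, by omega, h3 j⟩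
      have h1 := excess_quintic hmem
      exact ⟨hmem, by omega⟩
  · intro k _ hk
    rw [Finset.sum_eq_zero, mul_zero]
    intro f hf
    rw [if_neg]
    intro hex
    have h1 := excess_quintic hf
    have h2 : 3 * k ≤ ∑ j, (f j).1 + 2 * ∑ j, (f j).2 := by
      rw [Finset.mul_sum, ← Finset.sum_add_distrib]
      calc 3 * k = ∑ _j : Fin k, 3 := by simp [mul_comm]
        _ ≤ _ := Finset.sum_le_sum fun j _ =>
          (Finset.mem_filter.1 (Fintype.mem_piFinset.1 hf j)).2.2
    rw [Finset.mem_Icc] at hk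
    have hk0 : k = 0 := by omega
    subst hk0
    simp [excess] at hex
    omega

lemma moment_two_mul_moment_one (P Q : ℕ) :
    moment 2 (1 / 12) (2 * P) * moment 1 (1 / 8) (2 * Q)
      = (3 : ℝ) ^ ((P : ℝ) / 2 + 1 / 4) * (2 : ℝ) ^ (P + 3 * Q + 1)
          * Real.Gamma ((P : ℝ) / 2 + 1 / 4) * Real.Gamma ((Q : ℝ) + 1 / 2) := by
  rw [moment_even (by norm_num) (by norm_num) (even_two_mul P), moment_one_even (by norm_num)
    (even_two_mul Q)]
  have e1 : ((2 * P : ℕ) + 1 : ℝ) / (2 * (2 : ℕ)) = (P : ℝ) / 2 + 1 / 4 := by push_cast; ring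
  have e2 : ((2 * Q : ℕ) + 1 : ℝ) / 2 = (Q : ℝ) + 1 / 2 := by push_cast; ring
  rw [neg_div, neg_div, e1, e2, one_div (12 : ℝ), one_div (8 : ℝ),
    Real.inv_rpow (by norm_num), Real.inv_rpow (by norm_num), ← Real.rpow_neg (by norm_num),
    ← Real.rpow_neg (by norm_num), neg_neg, neg_neg]
  have e3 : (12 : ℝ) ^ ((P : ℝ) / 2 + 1 / 4)
      = 3 ^ ((P : ℝ) / 2 + 1 / 4) * 2 ^ ((P : ℝ) + 1 / 2) := by
    rw [show (12 : ℝ) = 3 * 2 ^ (2 : ℝ) by norm_num, Real.mul_rpow (by norm_num) (by norm_num),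
      ← Real.rpow_mul (by norm_num)]
    congr 2; ring
  have e4 : (8 : ℝ) ^ ((Q : ℝ) + 1 / 2) = 2 ^ (3 * (Q : ℝ) + 3 / 2) := by
    rw [show (8 : ℝ) = 2 ^ (3 : ℝ) by norm_num, ← Real.rpow_mul (by norm_num)]
    congr 1; ring
  have e5 : (2 : ℝ) ^ ((P : ℝ) + 1 / 2) * 2 ^ (3 * (Q : ℝ) + 3 / 2) * (1 / 2)
      = 2 ^ (P + 3 * Q + 1) := by
    rw [← Real.rpow_natCast, ← Real.rpow_add (by norm_num), one_div, ← Real.rpow_neg_one,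
      ← Real.rpow_add (by norm_num)]
    congr 1; push_cast; ring
  rw [e3, e4, ← e5]
  push_cast
  ring

lemma gammaCrit_eq_laplaceCoeff {M p : ℕ} (hpM : p ≤ M) :
    1 / (2 * Real.pi) ^ (3 / 2 : ℝ) *
      laplaceCoeff (quinticIndices (3 * M + 4)) (fun i => alphaCrit i.1 i.2) (fun i => 2 * i.1)
        (fun i => 2 * i.2) 2 (1 / 12) (1 / 8) (2 * M) (2 * p) = gammaCrit p := by
  rcases Nat.eq_zero_or_pos p with h0 | h0
  · subst h0
    have h := moment_two_mul_moment_one 0 0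
    rw [mul_zero] at h
    rw [mul_zero, laplaceCoeff_zero le_of_mem_quinticIndices, h, gammaCrit, if_pos rfl]
    have hpi := Real.pi_pos
    have e2 : (3 / 4 : ℝ) ^ (1 / 4 : ℝ) = 3 ^ (1 / 4 : ℝ) / √2 := by
      rw [Real.div_rpow (by norm_num) (by norm_num), Real.sqrt_eq_rpow,
        show (4 : ℝ) = 2 ^ (2 : ℝ) by norm_num, ← Real.rpow_mul (by norm_num)]
      norm_num
    have e3 : Real.Gamma ((0 : ℕ) + 1 / 2) = √Real.pi := by
      rw [Nat.cast_zero, zero_add, Real.Gamma_one_half_eq]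
    have h2 : √(2 : ℝ) ≠ 0 := by positivity
    have h3 : √Real.pi ≠ 0 := by positivity
    rw [two_pi_rpow, Real.sqrt_mul (by norm_num), e2, e3]
    norm_num
    field_simp
  · rw [laplaceCoeff_crit_even _ _ _ h0 (by omega) (by omega), gammaCrit, if_neg h0.ne']
    congr 1
    refine Finset.sum_congr rfl fun k _ => ?_
    congr 1
    refine Finset.sum_congr rfl fun f _ => ?_
    rw [moment_two_mul_moment_one]
    ring

/-- The asymptotic expansion at the critical temperature without field. -/
lemma isLittleO_critical {d : ℕ} {β : ℝ} (hκ : 2 * d * β = 1) (M : ℕ) :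
    (fun n : ℕ => balancedSum d β 0 n - 2 ^ n * ∑ p ∈ Finset.range (M + 1),
        gammaCrit p * (n : ℝ) ^ (-(p : ℝ) / 2 - 1 / 4))
      =o[evenAtTop] (fun n : ℕ => (2 : ℝ) ^ n * (n : ℝ) ^ (-(M : ℝ) / 2 - 1 / 4)) := by
  have hκ0 : 0 < 2 * d * β := by rw [hκ]; exact one_pos
  obtain ⟨C, hC0, hC⟩ := exists_psi_taylor_crit hκ (K := 3 * M + 4) (by omega)
  have hpi := Real.pi_gt_three
  have hexp : ∀ p : ℕ, (-((2 * p + 1 : ℕ) / (2 * (2 : ℕ) : ℝ)) : ℝ) = -(p : ℝ) / 2 - 1 / 4 :=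
    fun p => by push_cast; ring
  have hφ : phi d β 0 0 = 0 := by simp [phi]
  have := isLittleO_of_laplace (w := 2) (by norm_num) (Z := balancedSum d β 0)
    (X := fun n => Real.exp (n * phi d β 0 0)) (γ := gammaCrit) (M := M)
    (laplaceCoeff_crit_odd (fun i => alphaCrit i.1 i.2) (1 / 12) (1 / 8) (3 * M + 4) (2 * M))
    (fun p hp => ?_)
    (exists_density_expansion (w := 2) (N := 3 * M + 4 + 1) (δ₀ := 1 / 4) (t := 0) (by norm_num)
      (by norm_num) (by norm_num) le_of_mem_quinticIndices (by omega) hκ0 measurableSet_strip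
      subset_rfl (isClosed_univ.prod isClosed_Icc) subset_rfl hC0 (by norm_num) (by norm_num) hC
      (fun s u _ hu => ⟨trivial, abs_le.1 (by linarith)⟩)
      (fun z _ hz => phi_lt_zero hκ0 hκ.le hz))
    (fun m hm => balancedSum_eq_integral 0 hκ0 hm)
  · simpa only [hexp, hφ, mul_zero, Real.exp_zero, mul_one] using this
  · rw [hκ, Real.one_rpow, mul_one, gammaCrit_eq_laplaceCoeff hp]

/-! ### Infinite temperature -/

/-- At infinite temperature there is no Hubbard–Stratonovich variable; a decoupled Gaussian factor
`exp (-2 s ^ 2)` is used in its place, so that the same two-dimensional expansion applies. -/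
noncomputable def freeDensity (H : ℝ) (z : ℝ × ℝ) : ℝ :=
  Real.exp (-2 * z.1 ^ 2) *
    ((1 / 2 * Real.cosh (2 * H) + 1 / 2 * Real.cos z.2) * (Real.cosh H ^ 2)⁻¹)

/-- The Taylor coefficients of `ψ` in the second variable only. -/
noncomputable def freeCoeff (d : ℕ) (h : ℝ) (i : ℕ × ℕ) : ℝ :=
  if i.1 = 0 then alpha d 0 h |h| i.1 i.2 else 0

lemma continuous_freeDensity (H : ℝ) : Continuous (freeDensity H) := by
  unfold freeDensity; fun_prop

lemma freeDensity_nonneg (H : ℝ) (z : ℝ × ℝ) : 0 ≤ freeDensity H z := by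
  have h1 := Real.one_le_cosh (2 * H)
  have h2 := Real.neg_one_le_cos z.2
  have h3 : 0 ≤ 1 / 2 * Real.cosh (2 * H) + 1 / 2 * Real.cos z.2 := by linarith
  unfold freeDensity
  positivity

lemma integrableOn_freeDensity (H : ℝ) : IntegrableOn (freeDensity H) strip := by
  rw [IntegrableOn, volume_restrict_strip]
  exact (integrable_exp_neg_mul_sq (b := 2) (by norm_num)).mul_prod
    (f := fun s : ℝ => Real.exp (-2 * s ^ 2))
    (g := fun u : ℝ => (1 / 2 * Real.cosh (2 * H) + 1 / 2 * Real.cos u) * (Real.cosh H ^ 2)⁻¹)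
    (Continuous.integrableOn_Icc (by fun_prop))

lemma half_cosh_two_mul_add (H : ℝ) : 1 / 2 * Real.cosh (2 * H) + 1 / 2 = Real.cosh H ^ 2 := by
  rw [Real.cosh_two_mul, Real.sinh_sq]; ring

lemma freeDensity_le (H : ℝ) (z : ℝ × ℝ) : freeDensity H z ≤ Real.exp (-2 * z.1 ^ 2) := by
  have hc := Real.cosh_pos H
  refine mul_le_of_le_one_right (Real.exp_pos _).le ?_
  rw [← div_eq_mul_inv, div_le_one (by positivity), ← half_cosh_two_mul_add]
  linarith [Real.cos_le_one z.2]

lemma freeDensity_lt_one (H : ℝ) {z : ℝ × ℝ} (hz : z ∈ strip) (hne : z ≠ (0, 0)) :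
    freeDensity H z < 1 := by
  by_cases h1 : z.1 = 0
  · have hu : z.2 ≠ 0 := fun h2 => hne (Prod.ext h1 h2)
    have hc := Real.cosh_pos H
    have h := density_lt_of_ne_zero (κ := 0) (H := H) (s := H) hz.2 hu
    simp only [density, div_zero, Real.exp_zero, mul_one, Real.cos_zero] at h
    rw [half_cosh_two_mul_add] at h
    rw [freeDensity, h1]
    simp only [ne_eq, OfNat.ofNat_ne_zero, not_false_eq_true, zero_pow, mul_zero, Real.exp_zero,
      one_mul]
    rwa [← div_eq_mul_inv, div_lt_one (by positivity)]
  · refine (freeDensity_le H z).trans_lt ?_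
    rw [Real.exp_lt_one_iff]
    have : 0 < z.1 ^ 2 := by positivity
    linarith

lemma phi_zero_abs (d : ℕ) (h : ℝ) : phi d 0 h |h| = Real.log (Real.cosh |h|) := by
  simp [phi]

lemma exists_free_expansion (d : ℕ) (h : ℝ) (M : ℕ) :
    ∃ C : ℝ, ∀ m : ℕ, 1 ≤ m →
      |(∫ z in strip, freeDensity |h| z ^ m)
        - laplaceScale 1 m ^ (1 + 1) * ∑ j ∈ Finset.range (2 * M + 1),
          laplaceCoeff (cubicIndices (6 * M + 4)) (freeCoeff d h) Prod.fst Prod.snd 1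
            1 (-alpha d 0 h |h| 0 2) (2 * M) j * laplaceScale 1 m ^ j|
      ≤ C * laplaceScale 1 m ^ (1 + 1 + (2 * M + 1)) := by
  have hpi := Real.pi_gt_three
  have hIoo : ∀ u : ℝ, |u| ≤ 1 → u ∈ Set.Ioo (-Real.pi) Real.pi := fun u hu =>
    abs_lt.1 (by linarith)
  have hc := Real.cosh_pos |h|
  obtain ⟨C, hC0, hC⟩ := exists_psi_taylor d 0 h |h| (K := 6 * M + 4) (by omega)
  refine exists_laplace_expansion (N := 6 * M + 4 + 1) (C₀ := C) (δ₀ := 1) (t := 0)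
    (ψ := fun s u => psi d 0 h |h| u - phi d 0 h |h| - s ^ 2) le_rfl one_pos
    (neg_alpha_zero_two_pos d 0 h |h|) le_of_mem_cubicIndices (by omega) hC0 one_pos ?_ ?_
    measurableSet_strip (fun z _ => freeDensity_nonneg _ z) (continuous_freeDensity _).measurable
    (integrableOn_freeDensity _) ?_ ?_
  · refine ContinuousOn.sub (ContinuousOn.sub ?_ continuousOn_const) (by fun_prop)
    exact (contDiffOn_psi d 0 h).continuousOn.comp (f := fun z : ℝ × ℝ => (|h|, z.2))
      (by fun_prop) fun z hz => ⟨trivial, hIoo _ hz.2⟩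
  · intro s u _ hu
    have h1 := hC 0 u (by simp) hu
    have h2 : monomialSum (cubicIndices (6 * M + 4)) (fun i => alpha d 0 h |h| i.1 i.2)
        Prod.fst Prod.snd 0 u
        = monomialSum (cubicIndices (6 * M + 4)) (freeCoeff d h) Prod.fst Prod.snd s u := by
      refine Finset.sum_congr rfl fun i _ => ?_
      rw [freeCoeff]
      split_ifs with hi
      · simp [hi]
      · simp [hi]
    rw [h2] at h1
    have h3 : 0 ≤ C * |s| ^ (6 * M + 4 + 1) := by positivity
    simp only [add_zero, mul_zero, sub_zero, mul_one, abs_zero, ne_eq, OfNat.ofNat_ne_zero,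
      not_false_eq_true, zero_pow, zero_add, Nat.add_eq_zero_iff, one_ne_zero, and_false] at h1
    refine (le_of_eq ?_).trans (h1.trans ?_)
    · congr 1; ring
    · rw [mul_add]; linarith
  · intro s u hs hu
    refine ⟨⟨trivial, abs_le.1 (by linarith)⟩, ?_⟩
    have h1 := exp_two_psi d 0 h |h| (hIoo u hu)
    rw [density, sub_self, mul_zero, div_zero, Real.exp_zero, mul_one] at h1
    rw [zero_add, mul_sub, mul_sub, sub_eq_add_neg, sub_eq_add_neg, Real.exp_add, Real.exp_add, h1,
      phi_zero_abs, Real.exp_neg, show (2 : ℝ) * Real.log (Real.cosh |h|)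
        = ((2 : ℕ) : ℝ) * Real.log (Real.cosh |h|) by norm_num, Real.exp_nat_mul, Real.exp_log hc,
      freeDensity]
    rw [neg_mul]
    ring
  · refine exists_tail_bound (continuous_freeDensity _) (isClosed_univ.prod isClosed_Icc)
      subset_rfl (A := 1) (fun z hz => ?_) fun z hz hne => freeDensity_lt_one _ hz hne
    refine (freeDensity_le _ z).trans ?_
    have h1 : 1 ≤ z.1 ^ 2 := by rw [← sq_abs]; nlinarith
    have h2 : Real.exp (-2 * z.1 ^ 2) ≤ (Real.exp 1)⁻¹ := by
      rw [← Real.exp_neg]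
      exact Real.exp_le_exp.2 (by linarith)
    have h3 : (2 : ℝ) ≤ Real.exp 1 := by linarith [Real.add_one_le_exp (1 : ℝ)]
    refine h2.trans ?_
    rw [one_div]
    gcongr

lemma gammaField_zero_eq_laplaceCoeff (d : ℕ) (h : ℝ) {M p : ℕ} (hpM : p ≤ M) :
    1 / (2 * Real.pi) ^ (3 / 2 : ℝ) * √2 *
      laplaceCoeff (cubicIndices (6 * M + 4)) (freeCoeff d h) Prod.fst Prod.snd 1
        1 (-alpha d 0 h |h| 0 2) (2 * M) (2 * p) = gammaField d 0 h |h| p := by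
  have hpi := Real.pi_pos
  have hb := neg_alpha_zero_two_pos d 0 h |h|
  rcases Nat.eq_zero_or_pos p with h0 | h0
  · subst h0
    have hc := Real.cosh_pos |h|
    rw [mul_zero, laplaceCoeff_zero le_of_mem_cubicIndices, gammaField, if_pos rfl, if_pos rfl,
      moment_one_zero, moment_one_zero, two_pi_rpow, Real.sqrt_mul (by norm_num) Real.pi,
      alpha_zero_two, neg_neg, div_one]
    have e1 : √(Real.pi / (1 / (8 * Real.cosh |h| ^ 2))) = √Real.pi * (2 * √2 * Real.cosh |h|) := by
      rw [show Real.pi / (1 / (8 * Real.cosh |h| ^ 2)) = Real.pi * (2 ^ 2 * 2 * Real.cosh |h| ^ 2) by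
        field_simp; ring, Real.sqrt_mul hpi.le, Real.sqrt_mul (by norm_num),
        Real.sqrt_mul (by norm_num), Real.sqrt_sq (by norm_num), Real.sqrt_sq hc.le]
    have e2 : √Real.pi * √Real.pi = Real.pi := Real.mul_self_sqrt hpi.le
    have h2 : √(2 : ℝ) ≠ 0 := by positivity
    have h3 : √Real.pi ≠ 0 := by positivity
    rw [e1, Real.sqrt_div (by norm_num)]
    calc _ = √2 * (√Real.pi * √Real.pi) * Real.cosh |h| / (Real.pi * √Real.pi) := by field_simp
      _ = _ := by rw [e2]; field_simp
  · rw [laplaceCoeff_regular_even _ _ _ h0 (by omega) (by omega), gammaField, if_neg h0.ne',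
      gammaMax, mul_assoc]
    congr 1
    rw [Finset.mul_sum]
    refine Finset.sum_congr rfl fun k _ => ?_
    rw [mul_left_comm]
    congr 1
    rw [Finset.mul_sum]
    refine Finset.sum_congr rfl fun f hf => ?_
    obtain ⟨-, -, -, he1, he2⟩ := Finset.mem_filter.1 hf
    rw [tFactor, if_pos rfl]
    by_cases hP : ∑ i, (f i).1 = 0
    · have hz : ∀ j, (f j).1 = 0 := fun j => (Finset.sum_eq_zero_iff.1 hP) j (Finset.mem_univ j)
      have hprod : ∏ j, freeCoeff d h (f j) = ∏ j, alpha d 0 h |h| (f j).1 (f j).2 :=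
        Finset.prod_congr rfl fun j _ => by rw [freeCoeff, if_pos (hz j)]
      rw [if_pos hP, moment_one_even one_pos he1, moment_one_even hb he2, Real.one_rpow, hprod]
      ring
    · have hprod : ∏ j, freeCoeff d h (f j) = 0 := by
        obtain ⟨j, hj, hne⟩ := Finset.exists_ne_zero_of_sum_ne_zero hP
        exact Finset.prod_eq_zero hj (by rw [freeCoeff, if_neg hne])
      rw [if_neg hP, hprod]
      ring

lemma balancedSum_zero_eq_integral (d : ℕ) (h : ℝ) {m : ℕ} (hm : 1 ≤ m) :
    balancedSum d 0 h (2 * m) = 2 ^ (2 * m) * Real.exp ((2 * m : ℕ) * phi d 0 h |h|)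
      * ((1 / (2 * Real.pi) ^ (3 / 2 : ℝ) * √2) * √(2 * m)
        * ∫ z in strip, freeDensity |h| z ^ m) := by
  have hpi := Real.pi_pos
  have hm0 : (0 : ℝ) < m := by exact_mod_cast hm
  have hc := Real.cosh_pos |h|
  have h1 := integral_Icc_pow_eq m |h|
  have h2 : balancedSum d 0 h (2 * m) = ∑ σ : Fin (2 * m) → ℤˣ with halfDifference σ = 0,
      Real.exp (|h| * totalSpin σ) := by
    rw [← balancedSum_abs, balancedSum]
    simp
  rw [← h2] at h1
  set J := ∫ u in Set.Icc (-Real.pi) Real.pi, (1 / 2 * Real.cosh (2 * |h|) + 1 / 2 * Real.cos u) ^ m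
  have h3 : ∫ z in strip, freeDensity |h| z ^ m
      = √(Real.pi / (2 * m)) * (J * ((Real.cosh |h| ^ 2)⁻¹) ^ m) := by
    have e : (fun z => freeDensity |h| z ^ m) = fun z : ℝ × ℝ => Real.exp (-(2 * m) * z.1 ^ 2)
        * ((1 / 2 * Real.cosh (2 * |h|) + 1 / 2 * Real.cos z.2) ^ m * ((Real.cosh |h| ^ 2)⁻¹) ^ m) := by
      funext z
      rw [freeDensity, mul_pow, ← Real.exp_nat_mul, mul_pow]
      congr 2
      ring
    rw [e, volume_restrict_strip, integral_prod_mul (fun s : ℝ => Real.exp (-(2 * m) * s ^ 2))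
      (fun u : ℝ => (1 / 2 * Real.cosh (2 * |h|) + 1 / 2 * Real.cos u) ^ m
        * ((Real.cosh |h| ^ 2)⁻¹) ^ m), integral_gaussian, integral_mul_const]
  have h4 : Real.exp ((2 * m : ℕ) * phi d 0 h |h|) * ((Real.cosh |h| ^ 2)⁻¹) ^ m = 1 := by
    rw [phi_zero_abs, Real.exp_nat_mul, Real.exp_log hc, pow_mul, ← mul_pow,
      mul_inv_cancel₀ (by positivity), one_pow]
  have h5 : √(2 * m : ℝ) * √(Real.pi / (2 * m)) = √Real.pi := by
    rw [← Real.sqrt_mul (by positivity)]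
    congr 1
    field_simp
  have h6 : (2 : ℝ) ^ (2 * m) = 4 ^ m := by rw [pow_mul]; norm_num
  have hs2 : √(2 : ℝ) ≠ 0 := by positivity
  have hs3 : √Real.pi ≠ 0 := by positivity
  rw [h3, h6, two_pi_rpow, Real.sqrt_mul (by norm_num) Real.pi]
  calc balancedSum d 0 h (2 * m) = 1 / (2 * Real.pi) * (2 * Real.pi * balancedSum d 0 h (2 * m)) := by
        field_simp
    _ = 1 / (2 * Real.pi * (√2 * √Real.pi)) * √2 * √Real.pi * (4 ^ m * J) := by
        rw [h1]; field_simp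
    _ = (Real.exp ((2 * m : ℕ) * phi d 0 h |h|) * ((Real.cosh |h| ^ 2)⁻¹) ^ m)
        * (1 / (2 * Real.pi * (√2 * √Real.pi)) * √2 * (√(2 * m) * √(Real.pi / (2 * m)))
          * (4 ^ m * J)) := by rw [h4, h5, one_mul]
    _ = _ := by ring

/-- The asymptotic expansion at infinite temperature. -/
lemma isLittleO_free (d : ℕ) (h : ℝ) (M : ℕ) :
    (fun n : ℕ => balancedSum d 0 h n - 2 ^ n * Real.exp (n * phi d 0 h |h|)
        * ∑ p ∈ Finset.range (M + 1), gammaField d 0 h |h| p * (n : ℝ) ^ (-(p : ℝ) - 1 / 2))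
      =o[evenAtTop]
    (fun n : ℕ => (2 : ℝ) ^ n * Real.exp (n * phi d 0 h |h|) * (n : ℝ) ^ (-(M : ℝ) - 1 / 2)) := by
  have hexp : ∀ p : ℕ, (-((2 * p + 1 : ℕ) / (2 * (1 : ℕ) : ℝ)) : ℝ) = -(p : ℝ) - 1 / 2 := fun p => by
    push_cast; ring
  have := isLittleO_of_laplace (w := 1) le_rfl (Z := balancedSum d 0 h)
    (X := fun n => Real.exp (n * phi d 0 h |h|)) (γ := gammaField d 0 h |h|) (M := M)
    (laplaceCoeff_regular_odd (freeCoeff d h) 1 (-alpha d 0 h |h| 0 2) (6 * M + 4) (2 * M))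
    (fun p hp => gammaField_zero_eq_laplaceCoeff d h hp) (exists_free_expansion d h M)
    (fun m hm => balancedSum_zero_eq_integral d h hm)
  simpa only [hexp] using this

lemma gammaField_eq_gammaHigh {d : ℕ} {β : ℝ} (hd : 0 < d) (hβ0 : 0 ≤ β) (hκ1 : 2 * d * β < 1) (p : ℕ) :
    gammaField d β 0 0 p = gammaHigh d β p := by
  rw [gammaField, gammaHigh]
  split_ifs with h0 hβ
  · simp [hβ]
  · rw [Real.cosh_zero, one_pow, mul_one, mul_assoc]
    have hd0 : (0 : ℝ) < d := by exact_mod_cast hd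
    have hβ1 : 0 < β := lt_of_le_of_ne hβ0 (Ne.symm hβ)
    have hκ : 0 < 2 * d * β := by positivity
    have : 1 < 1 / (2 * d * β) := by rw [one_lt_div hκ]; exact hκ1
    rw [← Real.mul_rpow hκ.le (by linarith)]
    congr 2
    field_simp
  · rfl

end CurieWeiss

/-! ### The four regimes -/

theorem proposition5 (d : ℕ) (hd : 0 < d) (β h : ℝ) (hβ : 0 ≤ β) :
    (h = 0 → β < CurieWeiss.betaC d → ∀ M : ℕ,
      (fun n : ℕ => CurieWeiss.balancedSum d β h n
          - 2 ^ n * ∑ p ∈ Finset.range (M + 1),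
              CurieWeiss.gammaHigh d β p * (n : ℝ) ^ (-(p : ℝ) - 1 / 2))
        =o[CurieWeiss.evenAtTop]
      (fun n : ℕ => (2 : ℝ) ^ n * (n : ℝ) ^ (-(M : ℝ) - 1 / 2))) ∧
    (h = 0 → β = CurieWeiss.betaC d → ∀ M : ℕ,
      (fun n : ℕ => CurieWeiss.balancedSum d β h n
          - 2 ^ n * ∑ p ∈ Finset.range (M + 1),
              CurieWeiss.gammaCrit p * (n : ℝ) ^ (-(p : ℝ) / 2 - 1 / 4))
        =o[CurieWeiss.evenAtTop]
      (fun n : ℕ => (2 : ℝ) ^ n * (n : ℝ) ^ (-(M : ℝ) / 2 - 1 / 4))) ∧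
    (h = 0 → CurieWeiss.betaC d < β →
      ∃ z t : ℝ, IsGreatest {x : ℝ | Real.tanh (β / CurieWeiss.betaC d * x) = x} z ∧
        t = 2 * d * β * z ∧ ∀ M : ℕ,
      (fun n : ℕ => CurieWeiss.balancedSum d β h n
          - 2 ^ n * Real.exp (n * CurieWeiss.phi d β h t) * ∑ p ∈ Finset.range (M + 1),
              CurieWeiss.gammaLow d β t p * (n : ℝ) ^ (-(p : ℝ) - 1 / 2))
        =o[CurieWeiss.evenAtTop]
      (fun n : ℕ => (2 : ℝ) ^ n * Real.exp (n * CurieWeiss.phi d β h t)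
          * (n : ℝ) ^ (-(M : ℝ) - 1 / 2))) ∧
    (h ≠ 0 →
      ∃ z t : ℝ, IsGreatest {x : ℝ | Real.tanh (β / CurieWeiss.betaC d * x + |h|) = x} z ∧
        t = 2 * d * β * z + |h| ∧ ∀ M : ℕ,
      (fun n : ℕ => CurieWeiss.balancedSum d β h n
          - 2 ^ n * Real.exp (n * CurieWeiss.phi d β h t) * ∑ p ∈ Finset.range (M + 1),
              CurieWeiss.gammaField d β h t p * (n : ℝ) ^ (-(p : ℝ) - 1 / 2))
        =o[CurieWeiss.evenAtTop]
      (fun n : ℕ => (2 : ℝ) ^ n * Real.exp (n * CurieWeiss.phi d β h t)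
          * (n : ℝ) ^ (-(M : ℝ) - 1 / 2))) := by
  have hd0 : (0 : ℝ) < d := by exact_mod_cast hd
  have hratio : β / CurieWeiss.betaC d = 2 * d * β := by
    rw [CurieWeiss.betaC, div_div_eq_mul_div, div_one]; ring
  have hκ0 : 0 ≤ 2 * d * β := by positivity
  refine ⟨?_, ?_, ?_, ?_⟩
  · rintro rfl hlt M
    have hκ1 : 2 * d * β < 1 := by
      rw [CurieWeiss.betaC, lt_div_iff₀ (by positivity)] at hlt
      linarith
    have hφ : CurieWeiss.phi d β 0 0 = 0 := by simp [CurieWeiss.phi]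
    suffices hmain : (fun n : ℕ => CurieWeiss.balancedSum d β 0 n
          - 2 ^ n * Real.exp (n * CurieWeiss.phi d β 0 0) * ∑ p ∈ Finset.range (M + 1),
              CurieWeiss.gammaField d β 0 0 p * (n : ℝ) ^ (-(p : ℝ) - 1 / 2))
        =o[CurieWeiss.evenAtTop]
      (fun n : ℕ => (2 : ℝ) ^ n * Real.exp (n * CurieWeiss.phi d β 0 0)
          * (n : ℝ) ^ (-(M : ℝ) - 1 / 2)) by
      simpa only [hφ, mul_zero, Real.exp_zero, mul_one,
        CurieWeiss.gammaField_eq_gammaHigh hd hβ hκ1] using hmain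
    -- `β = 0` is separate because the Hubbard–Stratonovich transform degenerates there
    rcases hβ.eq_or_lt with h0 | h0
    · subst h0
      simpa only [abs_zero] using CurieWeiss.isLittleO_free d 0 M
    · have hκ : 0 < 2 * d * β := by positivity
      refine CurieWeiss.isLittleO_regular hκ (by simp) ?_
        (fun s hs => CurieWeiss.phi_lt_zero hκ hκ1.le hs) M
      rw [Real.cosh_zero, one_pow, div_one, one_lt_div hκ]
      exact hκ1
  · rintro rfl heq M
    refine CurieWeiss.isLittleO_critical ?_ M
    rw [heq, CurieWeiss.betaC]
    field_simp
  · rintro rfl hlt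
    have hκ1 : 1 < 2 * d * β := by
      rw [CurieWeiss.betaC, div_lt_iff₀ (by positivity)] at hlt
      linarith
    obtain ⟨z, hz, hpos⟩ := CurieWeiss.exists_isGreatest_meanField hκ0 le_rfl (Or.inr hκ1)
    simp only [add_zero] at hz hpos
    refine ⟨z, 2 * d * β * z, by rw [hratio]; exact hz, rfl, fun M => ?_⟩
    refine CurieWeiss.isLittleO_two_maxima (by linarith) hpos ?_ M
    rw [show Real.tanh (2 * d * β * z) = z from hz.1]
  · intro hh
    obtain ⟨z, hz, hpos⟩ := CurieWeiss.exists_isGreatest_meanField hκ0 (abs_nonneg h)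
      (Or.inl (abs_pos.2 hh))
    refine ⟨z, 2 * d * β * z + |h|, by rw [hratio]; exact hz, rfl, fun M => ?_⟩
    rcases hβ.eq_or_lt with h0 | h0
    · subst h0
      simpa only [mul_zero, zero_mul, zero_add] using CurieWeiss.isLittleO_free d h M
    · have hκ : 0 < 2 * d * β := by positivity
      have hcrit : 2 * d * β * Real.tanh (2 * d * β * z + |h|) = 2 * d * β * z + |h| - |h| := by
        rw [show Real.tanh (2 * d * β * z + |h|) = z from hz.1]; ring
      exact CurieWeiss.isLittleO_regular hκ hcrit (CurieWeiss.inv_cosh_sq_lt hκ hpos hcrit)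
        (fun s hs => CurieWeiss.phi_lt_of_ne hκ hpos hh hcrit hs) M
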